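/- Fix an integer $m>1$ and real numbers $M$, $N$, $K$. There is a constant $C$, depending only on $m,M,N,K$, such that the following holds. Let $\eta>0$ and $\delta>0$ satisfy $\delta\eta\le 1/32$ and $\delta\le 1/32$. For all sufficiently large $n$, let $X^{(n)}_1,\dots,X^{(n)}_m$ be independent random $n\times n$ complex matrices, all of whose entries are i.i.d. copies of $\xi_n/\sqrt n$, where $\xi_n$ is a complex random variable with $\mathbb{E}\xi_n=0$, $\mathbb{E}|\xi_n|^2=1$ and $|\xi_n|\le K n^{\delta}$ almost surely (the law of $\xi_n$ may depend on $n$, all variables are defined on one probability space, and nothing is assumed about the joint law for different $n$). Let $Y=Y^{(n)}$ be the $mn\times mn$ matrix of $n\times n$ blocks $Y_{a,a+1}=X^{(n)}_a$ for $1\le a<m$, $Y_{m,1}=X^{(n)}_m$, and all other blocks zero. For $z\in\mathbb{C}$ let $\nu_n(\cdot,z)$ be the empirical spectral distribution of the Hermitian matrix $(Y-zI)^*(Y-zI)$, that is, the uniform probability measure on its $mn$ eigenvalues counted with multiplicity, and for $\operatorname{Im}\alpha>0$ let $$\Delta_n(\alpha,z)=\int\frac{\nu_n(dx,z)}{x-\alpha}$$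 be its Stieltjes transform. Put $y_n=n^{-\eta\delta}$, $\delta_n=n^{-1/4}y_n^{-5}n^{\delta}$ and $$r_n(\alpha,z)=\Delta_n^3(\alpha,z)+2\Delta_n^2(\alpha,z)+\frac{\alpha+1-|z|^2}{\alpha}\Delta_n(\alpha,z)+\frac1\alpha .$$ Then, almost surely, for all sufficiently large $n$, $$\sup\bigl\{|r_n(\alpha,z)| : |z|\le M,\ |\operatorname{Re}\alpha|\le N,\ \operatorname{Im}\alpha\ge y_n\bigr\}\le C\,\delta_n .$$ -/

import Mathlib

open MeasureTheory ProbabilityTheory Filter Matrix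
open scoped ENNReal

noncomputable section

/-- The `mn × mn` block matrix whose `(a, a+1)` block is `X a`, where block indices are cyclic
(so that the `(m, 1)` block is `X m`), and whose other blocks vanish. -/
def blockCyclic {m n : ℕ} (X : Fin m → Matrix (Fin n) (Fin n) ℂ) :
    Matrix (Fin m × Fin n) (Fin m × Fin n) ℂ :=
  Matrix.of fun p q => if q.1 = finRotate m p.1 then X p.1 p.2 q.2 else 0

/-- The empirical spectral distribution of a Hermitian matrix, as a measure on `ℝ`. -/
def hermitianESD {ι : Type*} [Fintype ι] [DecidableEq ι] {A : Matrix ι ι ℂ}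
    (hA : A.IsHermitian) : Measure ℝ :=
  (Fintype.card ι : ℝ≥0∞)⁻¹ • ∑ i, Measure.dirac (hA.eigenvalues i)

/-- The Stieltjes transform of a measure on `ℝ`. -/
def stieltjes (μ : Measure ℝ) (α : ℂ) : ℂ :=
  ∫ x, 1 / ((x : ℂ) - α) ∂μ

/-- The Stieltjes transform at `α` of the empirical spectral distribution of
`(Y - z I)ᴴ (Y - z I)`. -/
def shiftedStieltjes {ι : Type*} [Fintype ι] [DecidableEq ι] (Y : Matrix ι ι ℂ) (α z : ℂ) : ℂ :=
  stieltjes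
    (hermitianESD (Matrix.isHermitian_conjTranspose_mul_self (Y - z • (1 : Matrix ι ι ℂ)))) α

/-- The random matrices `X 1, …, X m` of order `n` have jointly independent entries (so they are
independent, with independent entries), every entry is a copy of `ξ / √n`, the variable `ξ` has
mean `0` and variance `1`, and `|ξ| ≤ b` almost surely. -/
structure IsBoundedEnsemble {Ω : Type*} [MeasurableSpace Ω] (P : Measure Ω) {m n : ℕ}
    (X : Fin m → Ω → Matrix (Fin n) (Fin n) ℂ) (ξ : Ω → ℂ) (b : ℝ) : Prop where
  indep : iIndepFun (fun (p : Fin m × Fin n × Fin n) (ω : Ω) => X p.1 ω p.2.1 p.2.2) P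
  identDistrib : ∀ k i j,
    IdentDistrib (fun ω => X k ω i j) (fun ω => ξ ω / ((Real.sqrt (n : ℝ) : ℝ) : ℂ)) P P
  mean_zero : ∫ ω, ξ ω ∂P = 0
  variance_one : ∫ ω, ‖ξ ω‖ ^ 2 ∂P = 1
  bounded : ∀ᵐ ω ∂P, ‖ξ ω‖ ≤ b

/-- `y_n = n ^ (-η δ)`. -/
def cutoff (η δ : ℝ) (n : ℕ) : ℝ := (n : ℝ) ^ (-(η * δ))

/-- `δ_n = n ^ (-1/4) y_n ^ (-5) n ^ δ`. -/
def errorRate (η δ : ℝ) (n : ℕ) : ℝ :=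
  (n : ℝ) ^ (-(1 / 4) : ℝ) * cutoff η δ n ^ (-5 : ℤ) * (n : ℝ) ^ δ

end

set_option linter.unusedSectionVars false

section Resolvent

variable {ι : Type*} [Fintype ι] [DecidableEq ι]

/-- The resolvent `(Aᴴ A - α)⁻¹` of the Gram matrix of `A`. -/
noncomputable def gramResolvent (A : Matrix ι ι ℂ) (α : ℂ) : Matrix ι ι ℂ :=
  (Aᴴ * A - α • (1 : Matrix ι ι ℂ))⁻¹

theorem spectral_sub_smul_one {H : Matrix ι ι ℂ} (hH : H.IsHermitian) (α : ℂ) :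
    H - α • (1 : Matrix ι ι ℂ) = (hH.eigenvectorUnitary : Matrix ι ι ℂ) *
      diagonal (fun i => (hH.eigenvalues i : ℂ) - α) *
        star (hH.eigenvectorUnitary : Matrix ι ι ℂ) := by
  have h := hH.spectral_theorem
  rw [Unitary.conjStarAlgAut_apply] at h
  have hd : diagonal (fun i => (hH.eigenvalues i : ℂ) - α)
      = diagonal (RCLike.ofReal ∘ hH.eigenvalues) - α • (1 : Matrix ι ι ℂ) := by
    rw [smul_one_eq_diagonal, diagonal_sub]; rfl
  rw [hd, mul_sub, sub_mul, ← h]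
  simp

theorem eigenvalue_sub_ne_zero {α : ℂ} (hα : 0 < α.im) (x : ℝ) : (x : ℂ) - α ≠ 0 := by
  intro h
  have := congrArg Complex.im h
  simp at this
  exact hα.ne' this

theorem spectral_mul_inv {H : Matrix ι ι ℂ} (hH : H.IsHermitian) {α : ℂ} (hα : 0 < α.im) :
    (H - α • (1 : Matrix ι ι ℂ)) * ((hH.eigenvectorUnitary : Matrix ι ι ℂ) *
      diagonal (fun i => ((hH.eigenvalues i : ℂ) - α)⁻¹) *
        star (hH.eigenvectorUnitary : Matrix ι ι ℂ)) = 1 := by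
  rw [spectral_sub_smul_one hH]
  set U := (hH.eigenvectorUnitary : Matrix ι ι ℂ)
  have hU : star U * U = 1 := Unitary.coe_star_mul_self _
  have hU' : U * star U = 1 := Unitary.coe_mul_star_self _
  set D := diagonal (fun i => (hH.eigenvalues i : ℂ) - α)
  set D' := diagonal (fun i => ((hH.eigenvalues i : ℂ) - α)⁻¹)
  have hD : D * D' = 1 := by
    simp only [D, D', diagonal_mul_diagonal]
    simp [mul_inv_cancel₀ (eigenvalue_sub_ne_zero hα _)]
  calc U * D * star U * (U * D' * star U) = U * D * (star U * U) * D' * star U := by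
        simp only [mul_assoc]
    _ = 1 := by rw [hU, mul_one, mul_assoc U, hD, mul_one, hU']

variable {A : Matrix ι ι ℂ} {α : ℂ}

theorem gram_sub_mul_gramResolvent (A : Matrix ι ι ℂ) (hα : 0 < α.im) :
    (Aᴴ * A - α • (1 : Matrix ι ι ℂ)) * gramResolvent A α = 1 := by
  have h := spectral_mul_inv (isHermitian_conjTranspose_mul_self A) hα
  rw [gramResolvent, inv_eq_right_inv h, h]

theorem gramResolvent_mul_gram_sub (A : Matrix ι ι ℂ) (hα : 0 < α.im) :
    gramResolvent A α * (Aᴴ * A - α • (1 : Matrix ι ι ℂ)) = 1 :=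
  mul_eq_one_comm.mp (gram_sub_mul_gramResolvent A hα)

theorem trace_gramResolvent (A : Matrix ι ι ℂ) (hα : 0 < α.im) :
    (gramResolvent A α).trace =
      ∑ i, ((((isHermitian_conjTranspose_mul_self A).eigenvalues i : ℝ) : ℂ) - α)⁻¹ := by
  have hH := isHermitian_conjTranspose_mul_self A
  rw [gramResolvent, inv_eq_right_inv (spectral_mul_inv hH hα), trace_mul_cycle]
  have hU : star (hH.eigenvectorUnitary : Matrix ι ι ℂ) * hH.eigenvectorUnitary = 1 :=
    Unitary.coe_star_mul_self _
  rw [hU, one_mul, trace_diagonal]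

theorem shiftedStieltjes_eq (Y : Matrix ι ι ℂ) (z : ℂ) (hα : 0 < α.im) :
    shiftedStieltjes Y α z = (Fintype.card ι : ℂ)⁻¹ *
      (gramResolvent (Y - z • (1 : Matrix ι ι ℂ)) α).trace := by
  rw [trace_gramResolvent _ hα, shiftedStieltjes, stieltjes, hermitianESD, integral_smul_measure,
    integral_finsetSum_measure]
  · simp [integral_dirac]
  · intro i _
    exact integrable_dirac (by simp)

/-- Ward identity. -/
theorem gramResolvent_sub_conjTranspose (A : Matrix ι ι ℂ) (hα : 0 < α.im) :
    gramResolvent A α - (gramResolvent A α)ᴴ =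
      (2 * α.im * Complex.I) • ((gramResolvent A α)ᴴ * gramResolvent A α) := by
  set R := gramResolvent A α
  have h1 : (Aᴴ * A - α • (1 : Matrix ι ι ℂ)) * R = 1 := gram_sub_mul_gramResolvent A hα
  have h2 : Rᴴ * (Aᴴ * A - (star α) • (1 : Matrix ι ι ℂ)) = 1 := by
    have := congrArg conjTranspose h1
    simpa [conjTranspose_mul, conjTranspose_sub] using this
  have h3 : (2 * α.im * Complex.I) = α - star α := by
    apply Complex.ext <;> simp; ring
  calc R - Rᴴ = Rᴴ * (Aᴴ * A - (star α) • (1 : Matrix ι ι ℂ)) * R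
        - Rᴴ * ((Aᴴ * A - α • (1 : Matrix ι ι ℂ)) * R) := by rw [h2, h1, one_mul, mul_one]
    _ = _ := by
      rw [h3, sub_smul]
      simp only [mul_sub, sub_mul, mul_assoc, mul_smul_comm, smul_mul_assoc, mul_one, one_mul]
      abel

theorem gramResolvent_sub_conjTranspose' (A : Matrix ι ι ℂ) (hα : 0 < α.im) :
    gramResolvent A α - (gramResolvent A α)ᴴ =
      (2 * α.im * Complex.I) • (gramResolvent A α * (gramResolvent A α)ᴴ) := by
  set R := gramResolvent A α
  have h1 : R * (Aᴴ * A - α • (1 : Matrix ι ι ℂ)) = 1 := gramResolvent_mul_gram_sub A hα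
  have h2 : (Aᴴ * A - (star α) • (1 : Matrix ι ι ℂ)) * Rᴴ = 1 := by
    have := congrArg conjTranspose h1
    simpa [conjTranspose_mul, conjTranspose_sub] using this
  have h3 : (2 * α.im * Complex.I) = α - star α := by
    apply Complex.ext <;> simp; ring
  calc R - Rᴴ = R * ((Aᴴ * A - (star α) • (1 : Matrix ι ι ℂ)) * Rᴴ)
        - R * (Aᴴ * A - α • (1 : Matrix ι ι ℂ)) * Rᴴ := by rw [h2, h1, one_mul, mul_one]
    _ = _ := by
      rw [h3, sub_smul]
      simp only [mul_sub, sub_mul, mul_assoc, mul_smul_comm, smul_mul_assoc, mul_one, one_mul]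
      abel

theorem star_dotProduct_self_eq (u : ι → ℂ) : star u ⬝ᵥ u = ((∑ i, ‖u i‖ ^ 2 : ℝ) : ℂ) := by
  simp [dotProduct, ← Complex.conj_mul']

theorem im_star_dotProduct_sub (R : Matrix ι ι ℂ) (v : ι → ℂ) :
    star v ⬝ᵥ ((R - Rᴴ) *ᵥ v) = 2 * (star v ⬝ᵥ (R *ᵥ v)).im * Complex.I := by
  have : star v ⬝ᵥ (Rᴴ *ᵥ v) = star (star v ⬝ᵥ (R *ᵥ v)) := by
    rw [star_dotProduct, star_mulVec, conjTranspose_conjTranspose, ← dotProduct_mulVec]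
  rw [sub_mulVec, dotProduct_sub, this]
  apply Complex.ext <;> simp; ring

/-- `Im ⟨v, R v⟩ = Im α ‖R v‖²`. -/
theorem im_quadForm (A : Matrix ι ι ℂ) (hα : 0 < α.im) (v : ι → ℂ) :
    (star v ⬝ᵥ (gramResolvent A α *ᵥ v)).im
      = α.im * ∑ i, ‖(gramResolvent A α *ᵥ v) i‖ ^ 2 := by
  set R := gramResolvent A α
  have h := im_star_dotProduct_sub R v
  rw [gramResolvent_sub_conjTranspose A hα, smul_mulVec, dotProduct_smul, ← mulVec_mulVec,
    dotProduct_mulVec, ← star_mulVec, star_dotProduct_self_eq] at h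
  have := congrArg Complex.im h
  simp only [smul_eq_mul, Complex.mul_im, Complex.mul_re, Complex.ofReal_im, Complex.ofReal_re,
    Complex.I_re, Complex.I_im, Complex.re_ofNat, Complex.im_ofNat] at this
  linarith

theorem im_quadForm' (A : Matrix ι ι ℂ) (hα : 0 < α.im) (v : ι → ℂ) :
    (star v ⬝ᵥ (gramResolvent A α *ᵥ v)).im
      = α.im * ∑ i, ‖(star v ᵥ* gramResolvent A α) i‖ ^ 2 := by
  set R := gramResolvent A α
  have h := im_star_dotProduct_sub R v
  have e : Rᴴ *ᵥ v = star (star v ᵥ* R) := by rw [star_vecMul, star_star]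
  rw [gramResolvent_sub_conjTranspose' A hα, smul_mulVec, dotProduct_smul, ← mulVec_mulVec,
    dotProduct_mulVec, e, dotProduct_comm, star_dotProduct_self_eq] at h
  have := congrArg Complex.im h
  simp only [smul_eq_mul, Complex.mul_im, Complex.mul_re, Complex.ofReal_im, Complex.ofReal_re,
    Complex.I_re, Complex.I_im, Complex.re_ofNat, Complex.im_ofNat] at this
  linarith

theorem im_gramResolvent_diag (A : Matrix ι ι ℂ) (hα : 0 < α.im) (p : ι) :
    (gramResolvent A α p p).im = α.im * ∑ i, ‖gramResolvent A α i p‖ ^ 2 := by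
  simpa using im_quadForm A hα (Pi.single p 1)

theorem im_gramResolvent_diag' (A : Matrix ι ι ℂ) (hα : 0 < α.im) (p : ι) :
    (gramResolvent A α p p).im = α.im * ∑ i, ‖gramResolvent A α p i‖ ^ 2 := by
  have h := im_quadForm' A hα (Pi.single p 1)
  have e : star (Pi.single p (1 : ℂ)) = (Pi.single p 1 : ι → ℂ) := by
    rw [← Pi.single_star, star_one]
  rw [e] at h
  simpa using h

theorem norm_gramResolvent_diag_le (A : Matrix ι ι ℂ) (hα : 0 < α.im) (p : ι) :
    ‖gramResolvent A α p p‖ ≤ 1 / α.im := by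
  set R := gramResolvent A α
  have h := im_gramResolvent_diag A hα p
  have h1 : ‖R p p‖ ^ 2 ≤ ∑ i, ‖R i p‖ ^ 2 :=
    Finset.single_le_sum (f := fun i => ‖R i p‖ ^ 2) (fun i _ => by positivity) (Finset.mem_univ p)
  have h2 : (R p p).im ≤ ‖R p p‖ := (le_abs_self _).trans (Complex.abs_im_le_norm _)
  rw [le_div_iff₀ hα]
  by_contra! hc
  have h3 : α.im * ‖R p p‖ ^ 2 ≤ ‖R p p‖ :=
    (mul_le_mul_of_nonneg_left h1 hα.le).trans (h ▸ h2)
  have h4 : 0 < ‖R p p‖ := by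
    by_contra! h5
    nlinarith [norm_nonneg (R p p)]
  nlinarith

theorem sum_norm_sq_col_le (A : Matrix ι ι ℂ) (hα : 0 < α.im) (p : ι) :
    ∑ i, ‖gramResolvent A α i p‖ ^ 2 ≤ (1 / α.im) ^ 2 := by
  have h := im_gramResolvent_diag A hα p
  have h2 : (gramResolvent A α p p).im ≤ 1 / α.im :=
    ((le_abs_self _).trans (Complex.abs_im_le_norm _)).trans (norm_gramResolvent_diag_le A hα p)
  have : ∑ i, ‖gramResolvent A α i p‖ ^ 2 = (gramResolvent A α p p).im / α.im := by
    rw [h]; field_simp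
  rw [this, sq, div_eq_mul_one_div]
  exact mul_le_mul_of_nonneg_right h2 (by positivity)

theorem sum_norm_sq_row_le (A : Matrix ι ι ℂ) (hα : 0 < α.im) (p : ι) :
    ∑ i, ‖gramResolvent A α p i‖ ^ 2 ≤ (1 / α.im) ^ 2 := by
  have h1 := im_gramResolvent_diag A hα p
  have h2 := im_gramResolvent_diag' A hα p
  rw [h1] at h2
  rw [← mul_left_cancel₀ hα.ne' h2]
  exact sum_norm_sq_col_le A hα p

theorem norm_gramResolvent_apply_le (A : Matrix ι ι ℂ) (hα : 0 < α.im) (i j : ι) :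
    ‖gramResolvent A α i j‖ ≤ 1 / α.im := by
  have h := sum_norm_sq_col_le A hα j
  have h1 : ‖gramResolvent A α i j‖ ^ 2 ≤ ∑ i, ‖gramResolvent A α i j‖ ^ 2 :=
    Finset.single_le_sum (f := fun i => ‖gramResolvent A α i j‖ ^ 2) (fun i _ => by positivity)
      (Finset.mem_univ i)
  exact le_of_sq_le_sq (h1.trans h) (by positivity)

/-- `A R = R̃ A`, where `R̃` is the resolvent of `A Aᴴ`. -/
theorem mul_gramResolvent_comm (A : Matrix ι ι ℂ) (hα : 0 < α.im) :
    A * gramResolvent A α = gramResolvent Aᴴ α * A := by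
  have h1 := gram_sub_mul_gramResolvent A hα
  have h2 := gramResolvent_mul_gram_sub Aᴴ hα
  rw [conjTranspose_conjTranspose] at h2
  calc A * gramResolvent A α
      = gramResolvent Aᴴ α * (A * Aᴴ - α • (1 : Matrix ι ι ℂ)) * (A * gramResolvent A α) := by
        rw [h2, one_mul]
    _ = gramResolvent Aᴴ α * A * ((Aᴴ * A - α • (1 : Matrix ι ι ℂ)) * gramResolvent A α) := by
        simp only [mul_sub, sub_mul, mul_assoc, mul_smul_comm, smul_mul_assoc, mul_one, one_mul]
    _ = _ := by rw [h1, mul_one]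

theorem mul_gramResolvent_mul_conjTranspose (A : Matrix ι ι ℂ) (hα : 0 < α.im) :
    A * gramResolvent A α * Aᴴ = 1 + α • gramResolvent Aᴴ α := by
  have h2 := gramResolvent_mul_gram_sub Aᴴ hα
  rw [conjTranspose_conjTranspose, mul_sub, mul_smul_comm, mul_one, sub_eq_iff_eq_add] at h2
  rw [mul_gramResolvent_comm A hα, mul_assoc, h2]

theorem trace_gramResolvent_conjTranspose (A : Matrix ι ι ℂ) (hα : 0 < α.im) :
    (gramResolvent Aᴴ α).trace = (gramResolvent A α).trace := by
  have h1 := congrArg trace (mul_gramResolvent_mul_conjTranspose A hα)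
  have h2 := congrArg trace (gramResolvent_mul_gram_sub A hα)
  have h0 : α ≠ 0 := by rintro rfl; simp at hα
  rw [trace_mul_cycle, trace_add, trace_smul, trace_mul_comm] at h1
  rw [mul_sub, trace_sub, h1, mul_smul_comm, mul_one, trace_smul] at h2
  simp only [smul_eq_mul] at h2
  have : α * (gramResolvent Aᴴ α).trace = α * (gramResolvent A α).trace := by
    linear_combination h2
  exact mul_left_cancel₀ h0 this

/-- `Im (α R_pp) ≥ 0`. -/
theorem im_mul_gramResolvent_diag_nonneg (A : Matrix ι ι ℂ) (hα : 0 < α.im) (p : ι) :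
    0 ≤ (α * gramResolvent A α p p).im := by
  have h := mul_gramResolvent_mul_conjTranspose Aᴴ hα
  rw [conjTranspose_conjTranspose] at h
  have h1 := congrFun (congrFun h p) p
  have h2 : (Aᴴ * gramResolvent Aᴴ α * A) p p
      = star (fun i => A i p) ⬝ᵥ (gramResolvent Aᴴ α *ᵥ fun i => A i p) := by
    simp only [mul_apply, dotProduct, mulVec, Finset.sum_mul, Finset.mul_sum, conjTranspose_apply,
      Pi.star_apply]
    rw [Finset.sum_comm]
    simp only [mul_assoc]
  rw [h2] at h1
  have h3 := congrArg Complex.im h1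
  rw [im_quadForm _ hα] at h3
  simp only [Matrix.add_apply, Matrix.smul_apply, one_apply_eq, smul_eq_mul, Complex.add_im,
    Complex.one_im, zero_add] at h3
  rw [← h3]
  positivity

end Resolvent

section RowRemoval

variable {ι : Type*} [Fintype ι] [DecidableEq ι] {α : ℂ}

theorem gram_updateRow_zero (A : Matrix ι ι ℂ) (p : ι) :
    Aᴴ * A = (A.updateRow p 0)ᴴ * A.updateRow p 0 + vecMulVec (star (A p)) (A p) := by
  ext j k
  simp only [mul_apply, Matrix.add_apply, conjTranspose_apply, vecMulVec_apply, Pi.star_apply]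
  rw [← Finset.add_sum_erase _ _ (Finset.mem_univ p),
    ← Finset.add_sum_erase (a := p) _ (fun i => star (A.updateRow p 0 i j) * A.updateRow p 0 i k)
      (Finset.mem_univ p), add_comm]
  simp only [updateRow_self, Pi.zero_apply, mul_zero, zero_add]
  congr 1
  refine Finset.sum_congr rfl fun i hi => ?_
  rw [updateRow_ne (Finset.ne_of_mem_erase hi)]

/-- The quadratic form of the row `p` of `A` in the resolvent of `A` with this row removed. -/
noncomputable def rowForm (A : Matrix ι ι ℂ) (α : ℂ) (p : ι) : ℂ :=
  A p ⬝ᵥ (gramResolvent (A.updateRow p 0) α *ᵥ star (A p))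

theorem gramResolvent_updateRow_sub (A : Matrix ι ι ℂ) (hα : 0 < α.im) (p : ι) :
    gramResolvent (A.updateRow p 0) α - gramResolvent A α =
      vecMulVec (gramResolvent A α *ᵥ star (A p)) (A p ᵥ* gramResolvent (A.updateRow p 0) α) := by
  set R := gramResolvent A α
  set R' := gramResolvent (A.updateRow p 0) α
  have h1 : R * (Aᴴ * A - α • (1 : Matrix ι ι ℂ)) = 1 := gramResolvent_mul_gram_sub A hα
  have h2 : ((A.updateRow p 0)ᴴ * A.updateRow p 0 - α • (1 : Matrix ι ι ℂ)) * R' = 1 :=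
    gram_sub_mul_gramResolvent _ hα
  rw [← mul_vecMulVec, ← vecMulVec_mul]
  have h3 : vecMulVec (star (A p)) (A p) = (Aᴴ * A - α • (1 : Matrix ι ι ℂ)) -
      ((A.updateRow p 0)ᴴ * A.updateRow p 0 - α • (1 : Matrix ι ι ℂ)) := by
    rw [gram_updateRow_zero A p]; abel
  rw [h3, sub_mul, mul_sub, h2, ← mul_assoc, h1, one_mul, mul_one]

theorem mulVec_star_row (A : Matrix ι ι ℂ) (hα : 0 < α.im) (p : ι) :
    gramResolvent (A.updateRow p 0) α *ᵥ star (A p)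
      = (1 + rowForm A α p) • (gramResolvent A α *ᵥ star (A p)) := by
  have h := congrArg (· *ᵥ star (A p)) (gramResolvent_updateRow_sub A hα p)
  simp only [sub_mulVec, vecMulVec_mulVec] at h
  rw [sub_eq_iff_eq_add] at h
  rw [h, add_smul, one_smul, add_comm, rowForm, dotProduct_mulVec]
  congr 1
  ext i
  simp [mul_comm]

theorem mul_gramResolvent_diag_eq (A : Matrix ι ι ℂ) (hα : 0 < α.im) (p : ι) :
    α * gramResolvent Aᴴ α p p * (1 + rowForm A α p) = -1 := by
  have h1 := congrFun (congrFun (mul_gramResolvent_mul_conjTranspose A hα) p) p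
  have h2 : (A * gramResolvent A α * Aᴴ) p p = A p ⬝ᵥ (gramResolvent A α *ᵥ star (A p)) := by
    simp only [mul_apply, dotProduct, mulVec, Finset.sum_mul, Finset.mul_sum, conjTranspose_apply,
      Pi.star_apply]
    rw [Finset.sum_comm]
    simp only [mul_assoc]
  rw [h2] at h1
  have h3 := congrArg (A p ⬝ᵥ ·) (mulVec_star_row A hα p)
  simp only [dotProduct_smul, smul_eq_mul] at h3
  rw [h1] at h3
  simp only [Matrix.add_apply, Matrix.smul_apply, one_apply_eq, smul_eq_mul] at h3
  change rowForm A α p = _ at h3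
  linear_combination -h3

theorem norm_sum_mul_mul_le {d u v : ι → ℂ} (hd : ∀ i, ‖d i‖ ≤ 1) {s : ℝ}
    (hu : ∑ i, ‖u i‖ ^ 2 ≤ s) (hv : ∑ i, ‖v i‖ ^ 2 ≤ s) : ‖∑ i, d i * (u i * v i)‖ ≤ s := by
  calc ‖∑ i, d i * (u i * v i)‖ ≤ ∑ i, (‖u i‖ ^ 2 + ‖v i‖ ^ 2) / 2 := by
        refine norm_sum_le_of_le _ fun i _ => ?_
        rw [norm_mul, norm_mul]
        nlinarith [hd i, norm_nonneg (d i), norm_nonneg (u i), norm_nonneg (v i),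
          sq_nonneg (‖u i‖ - ‖v i‖), mul_nonneg (norm_nonneg (u i)) (norm_nonneg (v i))]
    _ = (∑ i, ‖u i‖ ^ 2 + ∑ i, ‖v i‖ ^ 2) / 2 := by
        rw [← Finset.sum_div, Finset.sum_add_distrib]
    _ ≤ s := by linarith

/-- Removing a row changes weighted traces of the resolvent of `Aᴴ A` by at most `1 / Im α`. -/
theorem norm_sum_diag_updateRow_sub_le (A : Matrix ι ι ℂ) (hα : 0 < α.im) (p : ι) {d : ι → ℂ}
    (hd : ∀ i, ‖d i‖ ≤ 1) :
    ‖∑ i, d i * (gramResolvent (A.updateRow p 0) α i i - gramResolvent A α i i)‖ ≤ 1 / α.im := by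
  set R := gramResolvent A α
  set R' := gramResolvent (A.updateRow p 0) α with hR'
  set q := rowForm A α p with hq
  have hne : 1 + q ≠ 0 := by
    intro h
    have := mul_gramResolvent_diag_eq A hα p
    rw [← hq, h] at this
    simp at this
  have hu : R *ᵥ star (A p) = (1 + q)⁻¹ • (R' *ᵥ star (A p)) := by
    rw [mulVec_star_row A hα p, smul_smul, inv_mul_cancel₀ hne, one_smul]
  have h1 : ∀ i, R' i i - R i i = (1 + q)⁻¹ * ((R' *ᵥ star (A p)) i * (A p ᵥ* R') i) := by
    intro i
    have h := congrFun (congrFun (gramResolvent_updateRow_sub A hα p) i) i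
    rw [Matrix.sub_apply, vecMulVec_apply] at h
    rw [h, hu, Pi.smul_apply, smul_eq_mul, mul_assoc]
  have hq1 : q.im = α.im * ∑ i, ‖(R' *ᵥ star (A p)) i‖ ^ 2 := by
    have := im_quadForm (A.updateRow p 0) hα (star (A p))
    rwa [star_star] at this
  have hq2 : q.im = α.im * ∑ i, ‖(A p ᵥ* R') i‖ ^ 2 := by
    have := im_quadForm' (A.updateRow p 0) hα (star (A p))
    rwa [star_star] at this
  have key : ‖∑ i, d i * ((R' *ᵥ star (A p)) i * (A p ᵥ* R') i)‖ ≤ q.im / α.im :=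
    norm_sum_mul_mul_le hd (by rw [hq1]; field_simp; rfl) (by rw [hq2]; field_simp; rfl)
  have e : ∑ i, d i * (R' i i - R i i)
      = (1 + q)⁻¹ * ∑ i, d i * ((R' *ᵥ star (A p)) i * (A p ᵥ* R') i) := by
    rw [Finset.mul_sum]
    refine Finset.sum_congr rfl fun i _ => ?_
    rw [h1]; ring
  have hle : q.im ≤ ‖1 + q‖ := by
    have := (le_abs_self _).trans (Complex.abs_im_le_norm (1 + q))
    simpa using this
  have hpos : 0 < ‖1 + q‖ := norm_pos_iff.mpr hne
  rw [e, norm_mul, norm_inv, inv_mul_le_iff₀ hpos, mul_one_div]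
  exact key.trans (by gcongr)

theorem gramResolvent_conjTranspose_updateRow (A : Matrix ι ι ℂ) (hα : 0 < α.im) {p i : ι}
    (hi : i ≠ p) (j : ι) :
    (gramResolvent (A.updateRow p 0)ᴴ α i j - gramResolvent Aᴴ α i j) * gramResolvent Aᴴ α p p
      = -(gramResolvent Aᴴ α i p * gramResolvent Aᴴ α p j) := by
  set A' := A.updateRow p 0 with hA'
  set R := gramResolvent Aᴴ α
  set R' := gramResolvent A'ᴴ α
  have h0 : α ≠ 0 := by rintro rfl; simp at hα
  have h1 : (A * Aᴴ - α • (1 : Matrix ι ι ℂ)) * R = 1 := by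
    have := gram_sub_mul_gramResolvent Aᴴ hα
    rwa [conjTranspose_conjTranspose] at this
  have h2 : R' * (A' * A'ᴴ - α • (1 : Matrix ι ι ℂ)) = 1 := by
    have := gramResolvent_mul_gram_sub A'ᴴ hα
    rwa [conjTranspose_conjTranspose] at this
  have hG : ∀ k l, (A' * A'ᴴ) k l = if k = p ∨ l = p then 0 else (A * Aᴴ) k l := by
    intro k l
    simp only [mul_apply, conjTranspose_apply]
    split_ifs with h
    · rcases h with rfl | rfl <;> simp [A']
    · rw [not_or] at h
      simp [A', updateRow_ne h.1, updateRow_ne h.2]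
  have h3 : R' i p = 0 := by
    have h := congrFun (congrFun h2 i) p
    rw [mul_sub, Matrix.sub_apply, mul_apply, one_apply_ne hi] at h
    simp only [hG, or_true, if_true, mul_zero, Finset.sum_const_zero, zero_sub, mul_smul_comm,
      mul_one, Matrix.smul_apply, smul_eq_mul, neg_eq_zero, mul_eq_zero, h0, false_or] at h
    exact h
  have h4 : R' - R = R' * (A * Aᴴ - A' * A'ᴴ) * R := by
    have : A * Aᴴ - A' * A'ᴴ = (A * Aᴴ - α • (1 : Matrix ι ι ℂ))
        - (A' * A'ᴴ - α • (1 : Matrix ι ι ℂ)) := by abel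
    rw [this, mul_sub, sub_mul, h2, mul_assoc, h1, one_mul, mul_one]
  have h5 : ∀ j, R' i j - R i j = (R' * (A * Aᴴ - A' * A'ᴴ)) i p * R p j := by
    intro j
    have h := congrFun (congrFun h4 i) j
    rw [Matrix.sub_apply, mul_apply] at h
    rw [h]
    refine Finset.sum_eq_single p (fun l _ hl => ?_) (by simp)
    have : (R' * (A * Aᴴ - A' * A'ᴴ)) i l = 0 := by
      rw [mul_apply]
      refine Finset.sum_eq_zero fun k _ => ?_
      by_cases hk : k = p
      · rw [hk, h3, zero_mul]
      · rw [Matrix.sub_apply, hG, if_neg (by simp [hk, hl]), sub_self, mul_zero]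
    rw [this, zero_mul]
  have h6 := h5 p
  rw [h3, zero_sub] at h6
  rw [h5 j]
  linear_combination (-R p j) * h6

/-- Removing a row changes weighted traces of the resolvent of `A Aᴴ` by at most `3 / Im α`. -/
theorem norm_sum_diag_conjTranspose_updateRow_sub_le (A : Matrix ι ι ℂ) (hα : 0 < α.im) (p : ι)
    {d : ι → ℂ} (hd : ∀ i, ‖d i‖ ≤ 1) :
    ‖∑ i, d i * (gramResolvent (A.updateRow p 0)ᴴ α i i - gramResolvent Aᴴ α i i)‖
      ≤ 3 / α.im := by
  set R := gramResolvent Aᴴ α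
  set R' := gramResolvent (A.updateRow p 0)ᴴ α
  have hne : R p p ≠ 0 := by
    intro h
    have := mul_gramResolvent_diag_eq A hα p
    rw [show gramResolvent Aᴴ α p p = 0 from h] at this
    simp at this
  have hpos : 0 < ‖R p p‖ := norm_pos_iff.mpr hne
  have hle : (R p p).im ≤ ‖R p p‖ := (le_abs_self _).trans (Complex.abs_im_le_norm _)
  rw [← Finset.add_sum_erase _ _ (Finset.mem_univ p)]
  have hpp : ‖d p * (R' p p - R p p)‖ ≤ 2 / α.im := by
    rw [norm_mul]
    have h1 := norm_sub_le (R' p p) (R p p)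
    have h2 := norm_gramResolvent_diag_le (A.updateRow p 0)ᴴ hα p
    have h3 := norm_gramResolvent_diag_le Aᴴ hα p
    have h4 : ‖R' p p - R p p‖ ≤ 2 / α.im := by
      rw [show 2 / α.im = 1 / α.im + 1 / α.im by ring]
      exact h1.trans (add_le_add h2 h3)
    exact (mul_le_of_le_one_left (norm_nonneg _) (hd p)).trans h4
  let d' : ι → ℂ := fun i => if i = p then 0 else -d i
  have hd' : ∀ i, ‖d' i‖ ≤ 1 := by
    intro i
    simp only [d']
    split_ifs
    · simp
    · simpa using hd i
  have e : ∑ i ∈ Finset.univ.erase p, d i * (R' i i - R i i)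
      = (R p p)⁻¹ * ∑ i, d' i * (R i p * R p i) := by
    rw [← Finset.add_sum_erase (a := p) _ (fun i => d' i * (R i p * R p i)) (Finset.mem_univ p)]
    simp only [d', if_true, zero_mul, zero_add]
    rw [Finset.mul_sum]
    refine Finset.sum_congr rfl fun i hi => ?_
    have hi' := Finset.ne_of_mem_erase hi
    have h := gramResolvent_conjTranspose_updateRow A hα hi' i
    rw [if_neg hi', eq_inv_mul_iff_mul_eq₀ hne]
    linear_combination d i * h
  have key : ‖∑ i, d' i * (R i p * R p i)‖ ≤ (R p p).im / α.im := by
    refine norm_sum_mul_mul_le hd' ?_ ?_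
    · rw [im_gramResolvent_diag _ hα]; field_simp; rfl
    · rw [im_gramResolvent_diag' _ hα]; field_simp; rfl
  have h2 : ‖∑ i ∈ Finset.univ.erase p, d i * (R' i i - R i i)‖ ≤ 1 / α.im := by
    rw [e, norm_mul, norm_inv, inv_mul_le_iff₀ hpos, mul_one_div]
    exact key.trans (by gcongr)
  calc _ ≤ 2 / α.im + 1 / α.im := (norm_add_le _ _).trans (add_le_add hpp h2)
    _ = 3 / α.im := by ring

end RowRemoval

section Resampling

variable {κ E : Type*} [Fintype κ] [DecidableEq κ] [MeasurableSpace E]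

theorem measurable_piecewise (S : Finset κ) :
    Measurable fun q : (κ → E) × (κ → E) => S.piecewise q.2 q.1 := by
  refine measurable_pi_lambda _ fun i => ?_
  by_cases hi : i ∈ S
  · simp only [Finset.piecewise, hi, if_true]; fun_prop
  · simp only [Finset.piecewise, hi, if_false]; fun_prop

variable (μ : Measure E) [IsProbabilityMeasure μ]

/-- Replacing the coordinates in `S` by those of an independent copy preserves the law. -/
theorem measurePreserving_piecewise (S : Finset κ) :
    MeasurePreserving (fun q : (κ → E) × (κ → E) => S.piecewise q.2 q.1)
      ((Measure.pi fun _ => μ).prod (Measure.pi fun _ => μ)) (Measure.pi fun _ : κ => μ) := by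
  refine ⟨measurable_piecewise S, (Measure.pi_eq fun s hs => ?_).symm⟩
  rw [Measure.map_apply (measurable_piecewise S) (MeasurableSet.univ_pi hs)]
  have : (fun q : (κ → E) × (κ → E) => S.piecewise q.2 q.1) ⁻¹' Set.univ.pi s
      = (Set.univ.pi fun i => if i ∈ S then Set.univ else s i) ×ˢ
        (Set.univ.pi fun i => if i ∈ S then s i else Set.univ) := by
    ext q
    simp only [Set.mem_preimage, Set.mem_pi, Set.mem_univ, true_imp_iff, Set.mem_prod,
      Finset.piecewise]
    rw [← forall_and]
    refine forall_congr' fun i => ?_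
    by_cases hi : i ∈ S <;> simp [hi]
  rw [this, Measure.prod_prod, Measure.pi_pi, Measure.pi_pi, ← Finset.prod_mul_distrib]
  refine Finset.prod_congr rfl fun i _ => ?_
  by_cases hi : i ∈ S <;> simp [hi]

variable {G : Type*} [NormedAddCommGroup G] [NormedSpace ℝ G]

theorem integral_resample (S : Finset κ) {F : (κ → E) → G}
    (hF : Integrable F (Measure.pi fun _ => μ)) :
    ∫ x, F x ∂(Measure.pi fun _ => μ) =
      ∫ x, ∫ x', F (S.piecewise x' x) ∂(Measure.pi fun _ => μ) ∂(Measure.pi fun _ => μ) := by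
  have h := measurePreserving_piecewise μ S
  conv_lhs => rw [← h.map_eq]
  rw [integral_map h.measurable.aemeasurable (by rw [h.map_eq]; exact hF.1)]
  exact integral_prod _ (h.integrable_comp_of_integrable hF)

theorem integral_resample_symm (S : Finset κ) {F : (κ → E) → G}
    (hF : Integrable F (Measure.pi fun _ => μ)) :
    ∫ x, F x ∂(Measure.pi fun _ => μ) =
      ∫ x', ∫ x, F (S.piecewise x' x) ∂(Measure.pi fun _ => μ) ∂(Measure.pi fun _ => μ) := by
  have h := measurePreserving_piecewise μ S
  conv_lhs => rw [← h.map_eq]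
  rw [integral_map h.measurable.aemeasurable (by rw [h.map_eq]; exact hF.1)]
  exact integral_prod_symm _ (h.integrable_comp_of_integrable hF)

theorem piecewise_singleton_eq_update (k : κ) (x x' : κ → E) :
    ({k} : Finset κ).piecewise x' x = Function.update x k (x' k) := by
  ext i
  by_cases h : i = k
  · subst h; simp [Finset.piecewise]
  · simp [Finset.piecewise, h]

theorem integral_eval {F : E → G} (k : κ) (hF : AEStronglyMeasurable F μ) :
    ∫ x, F (x k) ∂(Measure.pi fun _ : κ => μ) = ∫ u, F u ∂μ := by
  have h := measurePreserving_eval (fun _ : κ => μ) k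
  conv_rhs => rw [← h.map_eq]
  rw [integral_map h.measurable.aemeasurable (by rw [h.map_eq]; exact hF)]

theorem integral_resample_one (k : κ) {F : (κ → E) → G} (hm : StronglyMeasurable F)
    (hF : Integrable F (Measure.pi fun _ => μ)) :
    ∫ x, F x ∂(Measure.pi fun _ => μ) =
      ∫ x, ∫ u, F (Function.update x k u) ∂μ ∂(Measure.pi fun _ => μ) := by
  rw [integral_resample μ {k} hF]
  congr 1
  ext x
  simp only [piecewise_singleton_eq_update]
  exact integral_eval (κ := κ) μ (F := fun u => F (Function.update x k u)) k
    (hm.comp_measurable (measurable_update x)).aestronglyMeasurable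

theorem integrable_of_measurable_bound {Z : Type*} [MeasurableSpace Z] {P : Measure Z}
    [IsFiniteMeasure P] {F : Z → ℝ} {B : ℝ} (hm : Measurable F) (hB : ∀ x, |F x| ≤ B) :
    Integrable F P :=
  Integrable.of_bound hm.aestronglyMeasurable B (Eventually.of_forall hB)

theorem integrable_of_measurable_bound_complex {Z : Type*} [MeasurableSpace Z] {P : Measure Z}
    [IsFiniteMeasure P] {F : Z → ℂ} {B : ℝ} (hm : Measurable F) (hB : ∀ x, ‖F x‖ ≤ B) :
    Integrable F P :=
  Integrable.of_bound hm.aestronglyMeasurable B (Eventually.of_forall hB)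

end Resampling

section BoundedDifferences

variable {κ E β : Type*} [Fintype κ] [DecidableEq κ] [MeasurableSpace E] [DecidableEq β]
  (μ : Measure E) [IsProbabilityMeasure μ]

/-- The average of `f` over the coordinates outside `S`. -/
noncomputable def partialMean (f : (κ → E) → ℝ) (S : Finset κ) (x : κ → E) : ℝ :=
  ∫ x', f (S.piecewise x x') ∂(Measure.pi fun _ => μ)

variable {f : (κ → E) → ℝ} {B c : ℝ}

theorem measurable_piecewise_fst (S : Finset κ) :
    Measurable fun q : (κ → E) × (κ → E) => S.piecewise q.1 q.2 :=
  (measurable_piecewise S).comp measurable_swap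

theorem measurable_piecewise_right (S : Finset κ) (x : κ → E) :
    Measurable fun x' : κ → E => S.piecewise x x' :=
  (measurable_piecewise_fst S).comp measurable_prodMk_left

theorem measurable_piecewise_left (S : Finset κ) (x : κ → E) :
    Measurable fun x' : κ → E => S.piecewise x' x :=
  (measurable_piecewise S).comp measurable_prodMk_left

theorem measurable_partialMean (hf : Measurable f) (S : Finset κ) :
    Measurable (partialMean μ f S) := by
  have : StronglyMeasurable fun q : (κ → E) × (κ → E) => f (S.piecewise q.1 q.2) :=
    (hf.comp (measurable_piecewise_fst S)).stronglyMeasurable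
  exact (this.integral_prod_right' (ν := Measure.pi fun _ => μ)).measurable

theorem abs_integral_le_of_bound {Z : Type*} [MeasurableSpace Z] {P : Measure Z}
    [IsProbabilityMeasure P] {F : Z → ℝ} (hB : ∀ x, |F x| ≤ B) : |∫ x, F x ∂P| ≤ B := by
  have := norm_integral_le_of_norm_le_const (μ := P) (f := F) (Eventually.of_forall hB)
  simpa using this

theorem abs_partialMean_le (hB : ∀ x, |f x| ≤ B) (S : Finset κ) (x : κ → E) :
    |partialMean μ f S x| ≤ B :=
  abs_integral_le_of_bound fun _ => hB _

theorem abs_partialMean_sub_le (hf : Measurable f) (hB : ∀ x, |f x| ≤ B) (row : κ → β) (b : β)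
    (hc : ∀ x x', (∀ i, row i ≠ b → x i = x' i) → |f x - f x'| ≤ c) (S : Finset κ)
    {x x' : κ → E} (h : ∀ i, row i ≠ b → x i = x' i) :
    |partialMean μ f S x - partialMean μ f S x'| ≤ c := by
  rw [partialMean, partialMean, ← integral_sub]
  · refine abs_integral_le_of_bound fun y => hc _ _ fun i hi => ?_
    simp only [Finset.piecewise]
    rw [h i hi]
  · exact integrable_of_measurable_bound (hf.comp (measurable_piecewise_right S x)) fun _ => hB _
  · exact integrable_of_measurable_bound (hf.comp (measurable_piecewise_right S x')) fun _ => hB _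

theorem integral_partialMean_resample (hf : Measurable f) (hB : ∀ x, |f x| ≤ B) {S T U : Finset κ}
    (hST : Disjoint S T) (hU : ∀ i, i ∈ U ↔ i ∈ S ∨ i ∈ T) (x : κ → E) :
    ∫ x', partialMean μ f U (T.piecewise x' x) ∂(Measure.pi fun _ => μ) = partialMean μ f S x := by
  have hi : Integrable (fun y => f (S.piecewise x y)) (Measure.pi fun _ => μ) :=
    integrable_of_measurable_bound (hf.comp (measurable_piecewise_right S x)) fun _ => hB _
  rw [partialMean, integral_resample_symm μ T hi]
  simp only [partialMean]
  congr 1; ext x'; congr 1; ext x''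
  congr 1
  ext i
  simp only [Finset.piecewise, hU]
  by_cases h1 : i ∈ S
  · have : i ∉ T := Finset.disjoint_left.mp hST h1
    simp [h1, this]
  · by_cases h2 : i ∈ T <;> simp [h1, h2]

theorem integral_exp_le_of_bounded {Z : Type*} [MeasurableSpace Z] {P : Measure Z}
    [IsProbabilityMeasure P] {h : Z → ℝ} (hm : Measurable h) (hc : ∀ x, |h x| ≤ c)
    (h0 : ∫ x, h x ∂P = 0) (t : ℝ) : ∫ x, Real.exp (t * h x) ∂P ≤ Real.exp (c ^ 2 * t ^ 2 / 2) := by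
  have := (hasSubgaussianMGF_of_mem_Icc_of_integral_eq_zero (μ := P) (a := -c) (b := c)
    hm.aemeasurable (Eventually.of_forall fun x => abs_le.mp (hc x)) h0).mgf_le t
  refine this.trans_eq ?_
  congr 3
  simp only [NNReal.coe_pow, NNReal.coe_div, coe_nnnorm, NNReal.coe_ofNat, sub_neg_eq_add]
  rw [Real.norm_eq_abs, div_pow, sq_abs]
  ring

theorem integrable_exp_of_bound {Z : Type*} [MeasurableSpace Z] {P : Measure Z}
    [IsFiniteMeasure P] {h : Z → ℝ} (hm : Measurable h) (hB : ∀ x, |h x| ≤ B) (t : ℝ) :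
    Integrable (fun x => Real.exp (t * h x)) P := by
  refine integrable_of_measurable_bound (B := Real.exp (|t| * B)) (by fun_prop) fun x => ?_
  rw [abs_of_pos (Real.exp_pos _)]
  refine Real.exp_le_exp.mpr ?_
  calc t * h x ≤ |t * h x| := le_abs_self _
    _ = |t| * |h x| := abs_mul _ _
    _ ≤ _ := mul_le_mul_of_nonneg_left (hB x) (abs_nonneg t)

theorem integral_exp_partialMean_le (hf : Measurable f) (hB : ∀ x, |f x| ≤ B) (row : κ → β)
    (hc : ∀ b x x', (∀ i, row i ≠ b → x i = x' i) → |f x - f x'| ≤ c) (t : ℝ) (T : Finset β) :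
    ∫ x, Real.exp (t * (partialMean μ f {i | row i ∈ T} x
      - ∫ y, f y ∂(Measure.pi fun _ => μ))) ∂(Measure.pi fun _ => μ)
      ≤ Real.exp (T.card * c ^ 2 * t ^ 2 / 2) := by
  set π := (Measure.pi fun _ : κ => μ)
  set a := ∫ y, f y ∂π
  induction T using Finset.induction_on with
  | empty =>
    have : ∀ x, partialMean μ f ({i | row i ∈ (∅ : Finset β)} : Finset κ) x = a := by
      intro x
      have hp : ∀ x', ({i | row i ∈ (∅ : Finset β)} : Finset κ).piecewise x x' = x' := fun x' =>
        funext fun i => Finset.piecewise_eq_of_notMem _ _ _ (by simp)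
      simp only [partialMean, hp]
      rfl
    simp only [this]
    simp
  | insert b T hb ih =>
    set S : Finset κ := {i | row i ∈ T}
    set U : Finset κ := {i | row i ∈ insert b T}
    set W : Finset κ := {i | row i = b}
    have hSW : Disjoint S W := by
      rw [Finset.disjoint_left]
      intro i hi hi'
      simp only [S, W, Finset.mem_filter, Finset.mem_univ, true_and] at hi hi'
      exact hb (hi' ▸ hi)
    have hU : ∀ i, i ∈ U ↔ i ∈ S ∨ i ∈ W := by
      intro i
      simp [U, S, W, or_comm]
    have hmU := measurable_partialMean μ hf U
    have ha : |a| ≤ B := abs_integral_le_of_bound hB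
    have hbd : ∀ V : Finset κ, ∀ x, |partialMean μ f V x - a| ≤ B + B := fun V x =>
      (abs_sub _ _).trans (add_le_add (abs_partialMean_le μ hB V x) ha)
    have hmean := integral_partialMean_resample μ hf hB hSW hU
    have hmU' : ∀ x, Measurable fun x' => partialMean μ f U (W.piecewise x' x) := fun x =>
      hmU.comp (measurable_piecewise_left W x)
    have hint : ∀ x, Integrable (fun x' => partialMean μ f U (W.piecewise x' x)) π := fun x =>
      integrable_of_measurable_bound (hmU' x) fun _ => abs_partialMean_le μ hB U _
    rw [integral_resample μ W (integrable_exp_of_bound (hmU.sub_const a) (hbd U) t)]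
    have inner : ∀ x, ∫ x', Real.exp (t * (partialMean μ f U (W.piecewise x' x) - a)) ∂π
        ≤ Real.exp (t * (partialMean μ f S x - a)) * Real.exp (c ^ 2 * t ^ 2 / 2) := by
      intro x
      have e : ∀ x', Real.exp (t * (partialMean μ f U (W.piecewise x' x) - a))
          = Real.exp (t * (partialMean μ f S x - a)) *
            Real.exp (t * (partialMean μ f U (W.piecewise x' x) - partialMean μ f S x)) := by
        intro x'
        rw [← Real.exp_add]; ring_nf
      simp only [e]
      rw [integral_const_mul]
      refine mul_le_mul_of_nonneg_left ?_ (Real.exp_pos _).le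
      refine integral_exp_le_of_bounded ((hmU' x).sub_const _) (fun x' => ?_) ?_ t
      · rw [← hmean x]
        have : partialMean μ f U (W.piecewise x' x)
            - ∫ y, partialMean μ f U (W.piecewise y x) ∂π
            = ∫ y, (partialMean μ f U (W.piecewise x' x)
              - partialMean μ f U (W.piecewise y x)) ∂π := by
          rw [integral_sub (integrable_const _) (hint x)]
          simp
        rw [this]
        refine abs_integral_le_of_bound fun y => ?_
        refine abs_partialMean_sub_le μ hf hB row b (hc b) U fun i hi => ?_
        have : i ∉ W := by simpa [W] using hi
        simp [Finset.piecewise, this]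
      · rw [integral_sub (hint x) (integrable_const _), hmean x]
        simp
    calc _ ≤ ∫ x, Real.exp (t * (partialMean μ f S x - a)) * Real.exp (c ^ 2 * t ^ 2 / 2) ∂π := by
          refine integral_mono_of_nonneg (Eventually.of_forall fun x => ?_) ?_
            (Eventually.of_forall inner)
          · exact integral_nonneg fun _ => (Real.exp_pos _).le
          · exact (integrable_exp_of_bound ((measurable_partialMean μ hf S).sub_const a)
              (hbd S) t).mul_const _
      _ ≤ Real.exp (T.card * c ^ 2 * t ^ 2 / 2) * Real.exp (c ^ 2 * t ^ 2 / 2) := by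
          rw [integral_mul_const]
          exact mul_le_mul_of_nonneg_right ih (Real.exp_pos _).le
      _ = _ := by
          rw [← Real.exp_add, Finset.card_insert_of_notMem hb]
          push_cast
          ring_nf

/-- McDiarmid's bounded differences inequality, for blocks of coordinates. -/
theorem hasSubgaussianMGF_of_boundedDifferences [Fintype β] (hf : Measurable f)
    (hB : ∀ x, |f x| ≤ B) (row : κ → β)
    (hc : ∀ b x x', (∀ i, row i ≠ b → x i = x' i) → |f x - f x'| ≤ c) {V : NNReal}
    (hV : Fintype.card β * c ^ 2 ≤ V) :
    HasSubgaussianMGF (fun x => f x - ∫ y, f y ∂(Measure.pi fun _ => μ)) V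
      (Measure.pi fun _ => μ) where
  integrable_exp_mul t := by
    refine integrable_exp_of_bound (B := B + B) (hf.sub_const _) (fun x => ?_) t
    exact (abs_sub _ _).trans (add_le_add (hB x) (abs_integral_le_of_bound hB))
  mgf_le t := by
    have h := integral_exp_partialMean_le μ hf hB row hc t Finset.univ
    have e : ∀ x, partialMean μ f ({i | row i ∈ (Finset.univ : Finset β)} : Finset κ) x = f x := by
      intro x
      have hp : ∀ x', ({i | row i ∈ (Finset.univ : Finset β)} : Finset κ).piecewise x x' = x :=
        fun x' => funext fun i => Finset.piecewise_eq_of_mem _ _ _ (by simp)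
      simp only [partialMean, hp]
      simp
    simp only [e] at h
    refine h.trans ?_
    rw [Finset.card_univ]
    gcongr

end BoundedDifferences

/-- `φ` is a bounded centred random variable of variance `v` under `μ`. -/
structure IsBoundedCentred {E : Type*} [MeasurableSpace E] (μ : Measure E) (φ : E → ℂ)
    (b v : ℝ) : Prop where
  measurable : Measurable φ
  bound : ∀ u, ‖φ u‖ ≤ b
  mean_zero : ∫ u, φ u ∂μ = 0
  variance : ∫ u, ‖φ u‖ ^ 2 ∂μ = v

section Moments

variable {κ E : Type*} [Fintype κ] [DecidableEq κ] [MeasurableSpace E]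
  {μ : Measure E} [IsProbabilityMeasure μ] {φ : E → ℂ} {b v : ℝ}

theorem IsBoundedCentred.integrable (h : IsBoundedCentred μ φ b v) : Integrable φ μ :=
  integrable_of_measurable_bound_complex h.measurable h.bound

theorem IsBoundedCentred.integrable_sq (h : IsBoundedCentred μ φ b v) :
    Integrable (fun u => ‖φ u‖ ^ 2) μ :=
  integrable_of_measurable_bound (B := b ^ 2) (h.measurable.norm.pow_const 2) fun u => by
    rw [abs_of_nonneg (by positivity)]
    gcongr
    exact h.bound u

theorem IsBoundedCentred.integral_conj (h : IsBoundedCentred μ φ b v) :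
    ∫ u, star (φ u) ∂μ = 0 := by
  have := _root_.integral_conj (μ := μ) (f := φ)
  rw [h.mean_zero, map_zero] at this
  exact this

theorem IsBoundedCentred.bound_nonneg (h : IsBoundedCentred μ φ b v) : 0 ≤ b := by
  obtain ⟨u⟩ := μ.nonempty_of_neZero
  exact (norm_nonneg _).trans (h.bound u)

theorem IsBoundedCentred.variance_nonneg (h : IsBoundedCentred μ φ b v) : 0 ≤ v := by
  rw [← h.variance]
  positivity

theorem IsBoundedCentred.integral_sq_sub_sq_le (h : IsBoundedCentred μ φ b v) :
    ∫ u, (‖φ u‖ ^ 2 - v) ^ 2 ∂μ ≤ b ^ 2 * v := by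
  have hv := h.variance_nonneg
  calc ∫ u, (‖φ u‖ ^ 2 - v) ^ 2 ∂μ
      ≤ ∫ u, ((b ^ 2 - 2 * v) * ‖φ u‖ ^ 2 + v ^ 2) ∂μ := by
        refine integral_mono_of_nonneg (Eventually.of_forall fun _ => sq_nonneg _)
          ((h.integrable_sq.const_mul _).add (integrable_const _))
          (Eventually.of_forall fun u => ?_)
        have h1 : ‖φ u‖ ^ 2 ≤ b ^ 2 := by
          have := h.bound u
          gcongr
        have : ‖φ u‖ ^ 2 * ‖φ u‖ ^ 2 ≤ b ^ 2 * ‖φ u‖ ^ 2 :=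
          mul_le_mul_of_nonneg_right h1 (by positivity)
        simp only
        nlinarith
    _ = (b ^ 2 - 2 * v) * v + v ^ 2 := by
        rw [integral_add (h.integrable_sq.const_mul _) (integrable_const _), integral_const_mul,
          h.variance]
        simp
    _ ≤ b ^ 2 * v := by nlinarith

theorem integrable_norm_sq {Z : Type*} [MeasurableSpace Z] {P : Measure Z}
    [IsFiniteMeasure P] {F : Z → ℂ} {B : ℝ} (hm : Measurable F) (hB : ∀ x, ‖F x‖ ≤ B) :
    Integrable (fun x => ‖F x‖ ^ 2) P :=
  integrable_of_measurable_bound (B := B ^ 2) (hm.norm.pow_const 2) fun u => by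
    rw [abs_of_nonneg (by positivity)]
    have := hB u
    gcongr

/-- Orthogonality of an increment that is centred in the coordinate `k`. -/
theorem integral_norm_add_sq (μ : Measure E) [IsProbabilityMeasure μ] (k : κ)
    {f g : (κ → E) → ℂ} {Bf Bg : ℝ} (hf : Measurable f)
    (hg : Measurable g) (hBf : ∀ x, ‖f x‖ ≤ Bf) (hBg : ∀ x, ‖g x‖ ≤ Bg)
    (hfk : ∀ x u, f (Function.update x k u) = f x)
    (hgk : ∀ x, ∫ u, g (Function.update x k u) ∂μ = 0) :
    ∫ x, ‖f x + g x‖ ^ 2 ∂(Measure.pi fun _ => μ) =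
      ∫ x, ‖f x‖ ^ 2 ∂(Measure.pi fun _ => μ) + ∫ x, ‖g x‖ ^ 2 ∂(Measure.pi fun _ => μ) := by
  set π := (Measure.pi fun _ : κ => μ)
  have hm : Measurable fun x => star (f x) * g x := by fun_prop
  have hi : Integrable (fun x => star (f x) * g x) π := by
    refine integrable_of_measurable_bound_complex (B := Bf * Bg) hm fun x => ?_
    rw [norm_mul, norm_star]
    exact mul_le_mul (hBf x) (hBg x) (norm_nonneg _) ((norm_nonneg _).trans (hBf x))
  have h0 : ∫ x, star (f x) * g x ∂π = 0 := by
    rw [integral_resample_one μ k hm.stronglyMeasurable hi]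
    simp only [hfk]
    simp only [integral_const_mul, hgk, mul_zero, integral_zero]
  have e : ∀ x, ‖f x + g x‖ ^ 2 = ‖f x‖ ^ 2 + ‖g x‖ ^ 2 + 2 * (star (f x) * g x).re := by
    intro x
    rw [← Complex.normSq_eq_norm_sq, ← Complex.normSq_eq_norm_sq, ← Complex.normSq_eq_norm_sq]
    simp only [Complex.normSq_apply, Complex.add_re, Complex.add_im, Complex.mul_re,
      Complex.star_def, Complex.conj_re, Complex.conj_im]
    ring
  simp only [e]
  rw [integral_add, integral_add, integral_const_mul]
  · have := integral_re hi
    simp only [RCLike.re_eq_complex_re] at this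
    rw [this, h0]
    simp
  · exact integrable_norm_sq hf hBf
  · exact integrable_norm_sq hg hBg
  · exact (integrable_norm_sq hf hBf).add (integrable_norm_sq hg hBg)
  · exact hi.re.const_mul 2

variable {ν : Type*} [DecidableEq ν] {e : ν → κ}

theorem norm_linearForm_le (h : IsBoundedCentred μ φ b v) (c : ν → ℂ) (s : Finset ν)
    (x : κ → E) : ‖∑ j ∈ s, c j * φ (x (e j))‖ ≤ ∑ j ∈ s, ‖c j‖ * b := by
  refine norm_sum_le_of_le _ fun j _ => ?_
  rw [norm_mul]
  exact mul_le_mul_of_nonneg_left (h.bound _) (norm_nonneg _)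

theorem measurable_linearForm (h : IsBoundedCentred μ φ b v) (c : ν → ℂ) (s : Finset ν) :
    Measurable fun x : κ → E => ∑ j ∈ s, c j * φ (x (e j)) :=
  Finset.measurable_sum _ fun j _ => (h.measurable.comp (measurable_pi_apply (e j))).const_mul _

theorem linearForm_update (he : Function.Injective e) (c : ν → ℂ) {s : Finset ν} {k : ν}
    (hk : k ∉ s) (x : κ → E) (u : E) :
    ∑ j ∈ s, c j * φ (Function.update x (e k) u (e j)) = ∑ j ∈ s, c j * φ (x (e j)) := by
  refine Finset.sum_congr rfl fun j hj => ?_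
  rw [Function.update_of_ne]
  intro h
  exact hk (he h ▸ hj)

theorem integral_norm_linearForm_sq (h : IsBoundedCentred μ φ b v) (he : Function.Injective e)
    (c : ν → ℂ) (s : Finset ν) :
    ∫ x, ‖∑ j ∈ s, c j * φ (x (e j))‖ ^ 2 ∂(Measure.pi fun _ : κ => μ) =
      v * ∑ j ∈ s, ‖c j‖ ^ 2 := by
  induction s using Finset.induction_on with
  | empty => simp
  | insert k s hk ih =>
    have hm : Measurable fun x : κ → E => c k * φ (x (e k)) :=
      (h.measurable.comp (measurable_pi_apply (e k))).const_mul _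
    simp only [Finset.sum_insert hk, add_comm (c k * φ _)]
    rw [integral_norm_add_sq μ (e k) (measurable_linearForm h c s) hm (norm_linearForm_le h c s)
      (Bg := ‖c k‖ * b), ih]
    · have : ∫ x, ‖c k * φ (x (e k))‖ ^ 2 ∂(Measure.pi fun _ : κ => μ) = ‖c k‖ ^ 2 * v := by
        rw [integral_eval (κ := κ) μ (F := fun u => ‖c k * φ u‖ ^ 2)]
        · simp only [norm_mul, mul_pow]
          rw [integral_const_mul, h.variance]
        · exact ((h.measurable.const_mul _).norm.pow_const 2).aestronglyMeasurable
      rw [this]; ring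
    · intro x
      rw [norm_mul]
      exact mul_le_mul_of_nonneg_left (h.bound _) (norm_nonneg _)
    · exact linearForm_update he c hk
    · intro x
      simp only [Function.update_self]
      rw [integral_const_mul, h.mean_zero, mul_zero]

theorem integral_norm_linearForm_conj_sq (h : IsBoundedCentred μ φ b v)
    (he : Function.Injective e) (c : ν → ℂ) (s : Finset ν) :
    ∫ x, ‖∑ j ∈ s, c j * star (φ (x (e j)))‖ ^ 2 ∂(Measure.pi fun _ : κ => μ) =
      v * ∑ j ∈ s, ‖c j‖ ^ 2 := by
  have h1 := integral_norm_linearForm_sq h he (fun j => star (c j)) s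
  simp only [norm_star] at h1
  rw [← h1]
  congr 1
  ext x
  rw [← norm_star, star_sum]
  simp [mul_comm]

theorem integral_norm_eval_mul_sq (h : IsBoundedCentred μ φ b v) (k : κ) {f : (κ → E) → ℂ}
    {B : ℝ} (hf : Measurable f) (hB : ∀ x, ‖f x‖ ≤ B)
    (hfk : ∀ x u, f (Function.update x k u) = f x) :
    ∫ x, ‖φ (x k) * f x‖ ^ 2 ∂(Measure.pi fun _ => μ) =
      v * ∫ x, ‖f x‖ ^ 2 ∂(Measure.pi fun _ => μ) := by
  have hm : Measurable fun x : κ → E => φ (x k) * f x :=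
    (h.measurable.comp (measurable_pi_apply k)).mul hf
  have hb : ∀ x : κ → E, ‖φ (x k) * f x‖ ≤ b * B := fun x => by
    rw [norm_mul]
    exact mul_le_mul (h.bound _) (hB x) (norm_nonneg _) h.bound_nonneg
  rw [integral_resample_one μ k (hm.norm.pow_const 2).stronglyMeasurable
    (integrable_norm_sq hm hb)]
  simp only [hfk, Function.update_self, norm_mul, mul_pow]
  simp only [integral_mul_const, h.variance, integral_const_mul]

/-- The centred quadratic form of the variables indexed by `s`. -/
noncomputable def centredForm (φ : E → ℂ) (v : ℝ) (e : ν → κ) (Q : ν → ν → ℂ) (s : Finset ν)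
    (x : κ → E) : ℂ :=
  ∑ i ∈ s, ∑ j ∈ s, φ (x (e i)) * Q i j * star (φ (x (e j))) - v * ∑ i ∈ s, Q i i

theorem measurable_centredForm (h : IsBoundedCentred μ φ b v) (Q : ν → ν → ℂ) (s : Finset ν) :
    Measurable fun x : κ → E => centredForm φ v e Q s x := by
  have := h.measurable
  unfold centredForm
  refine Measurable.sub_const (Finset.measurable_sum _ fun i _ => Finset.measurable_sum _
    fun j _ => ?_) _
  exact ((this.comp (measurable_pi_apply (e i))).mul_const _).mul
    (continuous_star.measurable.comp (this.comp (measurable_pi_apply (e j))))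

theorem norm_centredForm_le (h : IsBoundedCentred μ φ b v) (Q : ν → ν → ℂ) (s : Finset ν)
    (x : κ → E) : ‖centredForm φ v e Q s x‖ ≤
      ∑ i ∈ s, ∑ j ∈ s, b * ‖Q i j‖ * b + v * ∑ i ∈ s, ‖Q i i‖ := by
  refine (norm_sub_le _ _).trans (add_le_add ?_ ?_)
  · refine norm_sum_le_of_le _ fun i _ => norm_sum_le_of_le _ fun j _ => ?_
    rw [norm_mul, norm_mul, norm_star]
    have h1 := h.bound (x (e i))
    have h2 := h.bound (x (e j))
    have := h.bound_nonneg
    gcongr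
  · rw [norm_mul, Complex.norm_real, Real.norm_of_nonneg h.variance_nonneg]
    exact mul_le_mul_of_nonneg_left (norm_sum_le _ _) h.variance_nonneg

theorem centredForm_insert (Q : ν → ν → ℂ) {s : Finset ν} {k : ν} (hk : k ∉ s) (x : κ → E) :
    centredForm φ v e Q (insert k s) x = centredForm φ v e Q s x +
      (Q k k * ((‖φ (x (e k))‖ ^ 2 - v : ℝ) : ℂ)
        + φ (x (e k)) * ∑ j ∈ s, Q k j * star (φ (x (e j)))
        + star (φ (x (e k))) * ∑ i ∈ s, Q i k * φ (x (e i))) := by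
  have h1 : ((‖φ (x (e k))‖ ^ 2 - v : ℝ) : ℂ) = φ (x (e k)) * star (φ (x (e k))) - v := by
    push_cast
    rw [Complex.star_def, Complex.mul_conj']
  rw [h1]
  simp only [centredForm, Finset.sum_insert hk, Finset.sum_add_distrib, Finset.mul_sum]
  have h2 : ∀ i, φ (x (e i)) * Q i k * star (φ (x (e k)))
    = star (φ (x (e k))) * (Q i k * φ (x (e i))) := fun i => by ring
  have h3 : ∀ i, φ (x (e k)) * Q k i * star (φ (x (e i)))
    = φ (x (e k)) * (Q k i * star (φ (x (e i)))) := fun i => by ring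
  simp only [h2, h3, mul_add]
  simp only [← Finset.mul_sum]
  ring

theorem integral_norm_centredForm_sq_le (h : IsBoundedCentred μ φ b v)
    (he : Function.Injective e) (Q : ν → ν → ℂ) (s : Finset ν) :
    ∫ x, ‖centredForm φ v e Q s x‖ ^ 2 ∂(Measure.pi fun _ : κ => μ) ≤
      3 * (b ^ 2 * v + v ^ 2) * ∑ i ∈ s, ∑ j ∈ s, ‖Q i j‖ ^ 2 := by
  set π := (Measure.pi fun _ : κ => μ)
  have hb := h.bound_nonneg
  have hv := h.variance_nonneg
  induction s using Finset.induction_on with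
  | empty => simp [centredForm]
  | insert k s hk ih =>
    have hφk : Measurable fun x : κ → E => φ (x (e k)) :=
      h.measurable.comp (measurable_pi_apply (e k))
    set D0 : (κ → E) → ℂ := fun x => Q k k * ((‖φ (x (e k))‖ ^ 2 - v : ℝ) : ℂ) with hD0
    set L1 : (κ → E) → ℂ := fun x => ∑ j ∈ s, Q k j * star (φ (x (e j))) with hL1
    set L2 : (κ → E) → ℂ := fun x => ∑ i ∈ s, Q i k * φ (x (e i)) with hL2
    have hL1' : ∀ x, L1 x = star (∑ j ∈ s, star (Q k j) * φ (x (e j))) := by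
      intro x
      simp [hL1, star_sum, mul_comm]
    have mL2 : Measurable L2 := measurable_linearForm h _ s
    have mL1 : Measurable L1 := by
      rw [funext hL1']
      exact continuous_star.measurable.comp (measurable_linearForm h _ s)
    have bL2 : ∀ x, ‖L2 x‖ ≤ ∑ i ∈ s, ‖Q i k‖ * b := norm_linearForm_le h _ s
    have bL1 : ∀ x, ‖L1 x‖ ≤ ∑ i ∈ s, ‖star (Q k i)‖ * b := fun x => by
      rw [hL1', norm_star]
      exact norm_linearForm_le h _ s x
    have uL2 : ∀ x u, L2 (Function.update x (e k) u) = L2 x := linearForm_update he _ hk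
    have uL1 : ∀ x u, L1 (Function.update x (e k) u) = L1 x := fun x u => by
      rw [hL1', hL1', linearForm_update he _ hk]
    have mD0 : Measurable D0 :=
      (Complex.measurable_ofReal.comp ((hφk.norm.pow_const 2).sub_const v)).const_mul _
    have bD0 : ∀ x, ‖D0 x‖ ≤ ‖Q k k‖ * (b ^ 2 + v) := fun x => by
      rw [hD0, norm_mul, Complex.norm_real, Real.norm_eq_abs]
      refine mul_le_mul_of_nonneg_left ((abs_sub _ _).trans ?_) (norm_nonneg _)
      rw [abs_of_nonneg hv, abs_of_nonneg (by positivity)]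
      have := h.bound (x (e k))
      gcongr
    have bφ : ∀ (L : (κ → E) → ℂ) (C : ℝ), (∀ x, ‖L x‖ ≤ C) → ∀ x, ‖φ (x (e k)) * L x‖ ≤ b * C :=
      fun L C hL x => by
        rw [norm_mul]
        exact mul_le_mul (h.bound _) (hL x) (norm_nonneg _) hb
    have n1 : ∀ x, ‖star (φ (x (e k))) * L2 x‖ = ‖φ (x (e k)) * L2 x‖ := fun x => by
      rw [norm_mul, norm_mul, norm_star]
    have i0 : Integrable (fun x => ‖D0 x‖ ^ 2) π := integrable_norm_sq mD0 bD0
    have i1 : Integrable (fun x => ‖φ (x (e k)) * L1 x‖ ^ 2) π :=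
      integrable_norm_sq (hφk.mul mL1) (bφ L1 _ bL1)
    have i2 : Integrable (fun x => ‖φ (x (e k)) * L2 x‖ ^ 2) π :=
      integrable_norm_sq (hφk.mul mL2) (bφ L2 _ bL2)
    have e0 : ∫ x, ‖D0 x‖ ^ 2 ∂π ≤ ‖Q k k‖ ^ 2 * (b ^ 2 * v) := by
      have : ∫ x, ‖D0 x‖ ^ 2 ∂π = ‖Q k k‖ ^ 2 * ∫ u, (‖φ u‖ ^ 2 - v) ^ 2 ∂μ := by
        rw [← integral_const_mul, ← integral_eval (κ := κ) μ
          (F := fun u => ‖Q k k‖ ^ 2 * (‖φ u‖ ^ 2 - v) ^ 2) (e k)]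
        · congr 1
          ext x
          rw [hD0, norm_mul, mul_pow, Complex.norm_real, Real.norm_eq_abs, sq_abs]
        · exact ((((h.measurable.norm.pow_const 2).sub_const v).pow_const 2).const_mul
            _).aestronglyMeasurable
      rw [this]
      exact mul_le_mul_of_nonneg_left h.integral_sq_sub_sq_le (by positivity)
    have e1 : ∫ x, ‖φ (x (e k)) * L1 x‖ ^ 2 ∂π = v * (v * ∑ j ∈ s, ‖Q k j‖ ^ 2) := by
      rw [integral_norm_eval_mul_sq h (e k) mL1 bL1 uL1, integral_norm_linearForm_conj_sq h he]
    have e2 : ∫ x, ‖φ (x (e k)) * L2 x‖ ^ 2 ∂π = v * (v * ∑ i ∈ s, ‖Q i k‖ ^ 2) := by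
      rw [integral_norm_eval_mul_sq h (e k) mL2 bL2 uL2,
        integral_norm_linearForm_sq h he (fun i => Q i k)]
    have i01 : Integrable (fun x => ‖D0 x‖ ^ 2 + ‖φ (x (e k)) * L1 x‖ ^ 2) π := i0.add i1
    have hD : ∫ x, ‖D0 x + φ (x (e k)) * L1 x + star (φ (x (e k))) * L2 x‖ ^ 2 ∂π ≤
        3 * (∫ x, ‖D0 x‖ ^ 2 ∂π + ∫ x, ‖φ (x (e k)) * L1 x‖ ^ 2 ∂π
          + ∫ x, ‖φ (x (e k)) * L2 x‖ ^ 2 ∂π) := by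
      rw [← integral_add i0 i1, ← integral_add i01 i2, ← integral_const_mul]
      refine integral_mono_of_nonneg (Eventually.of_forall fun _ => by positivity)
        ((i01.add i2).const_mul 3) (Eventually.of_forall fun x => ?_)
      simp only
      rw [← n1 x]
      have h1 := norm_add₃_le (a := D0 x) (b := φ (x (e k)) * L1 x) (c := star (φ (x (e k))) * L2 x)
      set p := ‖D0 x‖
      set q := ‖φ (x (e k)) * L1 x‖
      set r := ‖star (φ (x (e k))) * L2 x‖
      have h2 := pow_le_pow_left₀ (norm_nonneg _) h1 2
      nlinarith [sq_nonneg (p - q), sq_nonneg (q - r), sq_nonneg (p - r)]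
    simp only [centredForm_insert Q hk]
    have mD : Measurable fun x => D0 x + φ (x (e k)) * L1 x + star (φ (x (e k))) * L2 x :=
      (mD0.add (hφk.mul mL1)).add ((continuous_star.measurable.comp hφk).mul mL2)
    rw [integral_norm_add_sq μ (e k) (measurable_centredForm h Q s)
      (g := fun x => D0 x + φ (x (e k)) * L1 x + star (φ (x (e k))) * L2 x)
      (Bf := ∑ i ∈ s, ∑ j ∈ s, b * ‖Q i j‖ * b + v * ∑ i ∈ s, ‖Q i i‖)
      (Bg := ‖Q k k‖ * (b ^ 2 + v) + b * (∑ i ∈ s, ‖star (Q k i)‖ * b)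
        + b * ∑ i ∈ s, ‖Q i k‖ * b) mD
      (norm_centredForm_le h Q s)]
    · have e3 : ∑ i ∈ insert k s, ∑ j ∈ insert k s, ‖Q i j‖ ^ 2 = ∑ i ∈ s, ∑ j ∈ s, ‖Q i j‖ ^ 2
          + (‖Q k k‖ ^ 2 + ∑ j ∈ s, ‖Q k j‖ ^ 2 + ∑ i ∈ s, ‖Q i k‖ ^ 2) := by
        simp only [Finset.sum_insert hk, Finset.sum_add_distrib]
        ring
      have p0 : 0 ≤ ‖Q k k‖ ^ 2 := by positivity
      have p1 : 0 ≤ ∑ j ∈ s, ‖Q k j‖ ^ 2 := by positivity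
      have p2 : 0 ≤ ∑ j ∈ s, ‖Q j k‖ ^ 2 := by positivity
      rw [e3, mul_add]
      refine add_le_add ih (hD.trans ?_)
      rw [e1, e2]
      have q1 : 0 ≤ b ^ 2 * v := by positivity
      have q2 : 0 ≤ v ^ 2 := by positivity
      nlinarith [mul_nonneg q2 p0, mul_nonneg q1 p1, mul_nonneg q1 p2]
    · intro x
      refine (norm_add_le _ _).trans (add_le_add ((norm_add_le _ _).trans (add_le_add (bD0 x)
        (bφ L1 _ bL1 x))) ?_)
      rw [n1]
      exact bφ L2 _ bL2 x
    · intro x u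
      simp only [centredForm]
      congr 1
      refine Finset.sum_congr rfl fun i hi => Finset.sum_congr rfl fun j hj => ?_
      rw [Function.update_of_ne, Function.update_of_ne]
      · intro h'; exact hk (he h' ▸ hj)
      · intro h'; exact hk (he h' ▸ hi)
    · intro x
      change ∫ u, (D0 (Function.update x (e k) u)
        + φ (Function.update x (e k) u (e k)) * L1 (Function.update x (e k) u)
        + star (φ (Function.update x (e k) u (e k))) * L2 (Function.update x (e k) u)) ∂μ = 0
      simp only [uL1, uL2, hD0, Function.update_self]
      have j0 : Integrable (fun u => Q k k * ((‖φ u‖ ^ 2 - v : ℝ) : ℂ)) μ :=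
        ((h.integrable_sq.sub (integrable_const v)).ofReal).const_mul _
      have j1 : Integrable (fun u => φ u * L1 x) μ := h.integrable.mul_const _
      have j2 : Integrable (fun u => star (φ u) * L2 x) μ :=
        (integrable_of_measurable_bound_complex 
          (continuous_star.measurable.comp h.measurable) (B := b)
          (fun u => (norm_star (φ u)).trans_le (h.bound u))).mul_const _
      have j01 : Integrable (fun u => Q k k * ((‖φ u‖ ^ 2 - v : ℝ) : ℂ) + φ u * L1 x) μ :=
        j0.add j1
      rw [integral_add j01 j2, integral_add j0 j1, integral_mul_const, integral_mul_const,
        h.mean_zero, h.integral_conj, integral_const_mul, integral_complex_ofReal,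
        integral_sub h.integrable_sq (integrable_const v), h.variance]
      simp

theorem integral_norm_le_sqrt {Z : Type*} [MeasurableSpace Z] {P : Measure Z}
    [IsProbabilityMeasure P] {F : Z → ℂ} {B C : ℝ} (hm : Measurable F) (hB : ∀ x, ‖F x‖ ≤ B)
    (hC : ∫ x, ‖F x‖ ^ 2 ∂P ≤ C) : ∫ x, ‖F x‖ ∂P ≤ Real.sqrt C := by
  have hi : Integrable (fun x => ‖F x‖) P :=
    (integrable_of_measurable_bound_complex hm hB).norm
  have hi2 := integrable_norm_sq (P := P) hm hB
  refine Real.le_sqrt_of_sq_le (le_trans ?_ hC)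
  set a := ∫ x, ‖F x‖ ∂P
  have h0 : 0 ≤ ∫ x, (‖F x‖ - a) ^ 2 ∂P := integral_nonneg fun _ => sq_nonneg _
  have e : ∀ x, (‖F x‖ - a) ^ 2 = ‖F x‖ ^ 2 - 2 * a * ‖F x‖ + a ^ 2 := fun x => by ring
  simp only [e] at h0
  have hi3 : Integrable (fun x => ‖F x‖ ^ 2 - 2 * a * ‖F x‖) P := hi2.sub (hi.const_mul _)
  rw [integral_add hi3 (integrable_const _),
    integral_sub hi2 (hi.const_mul _), integral_const_mul] at h0
  simp only [integral_const, probReal_univ, one_smul] at h0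
  change 0 ≤ ∫ x, ‖F x‖ ^ 2 ∂P - 2 * a * a + a ^ 2 at h0
  linarith

variable [Fintype ν]

theorem piecewise_image_apply (x x' : κ → E) (i : ν) :
    (Finset.univ.image e).piecewise x' x (e i) = x' (e i) :=
  Finset.piecewise_eq_of_mem _ _ _ (Finset.mem_image_of_mem _ (Finset.mem_univ _))

theorem measurable_centredForm_coeff (h : IsBoundedCentred μ φ b v) {Q : (κ → E) → ν → ν → ℂ}
    (hm : ∀ i j, Measurable fun x => Q x i j) :
    Measurable fun x => centredForm φ v e (Q x) Finset.univ x := by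
  have := h.measurable
  unfold centredForm
  fun_prop

theorem norm_centredForm_coeff_le (h : IsBoundedCentred μ φ b v) {Q : (κ → E) → ν → ν → ℂ} {B : ℝ}
    (hB : ∀ x i j, ‖Q x i j‖ ≤ B) (x : κ → E) :
    ‖centredForm φ v e (Q x) Finset.univ x‖
      ≤ ∑ _ : ν, ∑ _ : ν, b * B * b + v * ∑ _ : ν, B := by
  have hb := h.bound_nonneg
  have hv := h.variance_nonneg
  refine (norm_centredForm_le h _ _ x).trans ?_
  gcongr <;> apply hB

theorem measurable_linearForm_coeff (h : IsBoundedCentred μ φ b v) {c : (κ → E) → ν → ℂ}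
    (hm : ∀ i, Measurable fun x => c x i) :
    Measurable fun x => ∑ i, c x i * φ (x (e i)) := by
  have := h.measurable
  fun_prop

theorem norm_linearForm_coeff_le (h : IsBoundedCentred μ φ b v) {c : (κ → E) → ν → ℂ} {B : ℝ}
    (hB : ∀ x i, ‖c x i‖ ≤ B) (x : κ → E) :
    ‖∑ i, c x i * φ (x (e i))‖ ≤ ∑ _ : ν, B * b := by
  have hb := h.bound_nonneg
  refine (norm_linearForm_le h _ _ x).trans ?_
  gcongr
  apply hB

/-- A quadratic form concentrates if its coefficients do not depend on its variables. -/
theorem integral_norm_centredForm_le (h : IsBoundedCentred μ φ b v) (he : Function.Injective e)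
    {Q : (κ → E) → ν → ν → ℂ} {B C : ℝ} (hm : ∀ i j, Measurable fun x => Q x i j)
    (hB : ∀ x i j, ‖Q x i j‖ ≤ B) (hQ : ∀ x x', (∀ k, k ∉ Set.range e → x k = x' k) → Q x = Q x')
    (hC : ∀ x, ∑ i, ∑ j, ‖Q x i j‖ ^ 2 ≤ C) :
    ∫ x, ‖centredForm φ v e (Q x) Finset.univ x‖ ∂(Measure.pi fun _ : κ => μ) ≤
      Real.sqrt (3 * (b ^ 2 * v + v ^ 2) * C) := by
  set π := (Measure.pi fun _ : κ => μ)
  have hb := h.bound_nonneg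
  have hv := h.variance_nonneg
  have hM := measurable_centredForm_coeff (e := e) h hm
  have hBd := norm_centredForm_coeff_le (e := e) h hB
  refine integral_norm_le_sqrt hM hBd ?_
  rw [integral_resample μ (Finset.univ.image e) (integrable_norm_sq hM hBd)]
  have e1 : ∀ x x', centredForm φ v e (Q ((Finset.univ.image e).piecewise x' x)) Finset.univ
      ((Finset.univ.image e).piecewise x' x) = centredForm φ v e (Q x) Finset.univ x' := by
    intro x x'
    have : Q ((Finset.univ.image e).piecewise x' x) = Q x := by
      refine hQ _ _ fun k hk => Finset.piecewise_eq_of_notMem _ _ _ ?_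
      simpa using hk
    rw [this]
    simp only [centredForm, piecewise_image_apply]
  simp only [e1]
  calc _ ≤ ∫ _, 3 * (b ^ 2 * v + v ^ 2) * C ∂π := by
        refine integral_mono_of_nonneg (Eventually.of_forall fun _ => by positivity)
          (integrable_const _) (Eventually.of_forall fun x => ?_)
        refine (integral_norm_centredForm_sq_le h he (Q x) Finset.univ).trans ?_
        exact mul_le_mul_of_nonneg_left (hC x) (by positivity)
    _ = _ := by simp

theorem integral_norm_linearForm_le (h : IsBoundedCentred μ φ b v) (he : Function.Injective e)
    {c : (κ → E) → ν → ℂ} {B C : ℝ} (hm : ∀ i, Measurable fun x => c x i)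
    (hB : ∀ x i, ‖c x i‖ ≤ B) (hc : ∀ x x', (∀ k, k ∉ Set.range e → x k = x' k) → c x = c x')
    (hC : ∀ x, ∑ i, ‖c x i‖ ^ 2 ≤ C) :
    ∫ x, ‖∑ i, c x i * φ (x (e i))‖ ∂(Measure.pi fun _ : κ => μ) ≤ Real.sqrt (v * C) := by
  set π := (Measure.pi fun _ : κ => μ)
  have hb := h.bound_nonneg
  have hv := h.variance_nonneg
  have hM := measurable_linearForm_coeff (e := e) h hm
  have hBd := norm_linearForm_coeff_le (e := e) h hB
  refine integral_norm_le_sqrt hM hBd ?_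
  rw [integral_resample μ (Finset.univ.image e) (integrable_norm_sq hM hBd)]
  have e1 : ∀ x x', ∑ i, c ((Finset.univ.image e).piecewise x' x) i *
      φ ((Finset.univ.image e).piecewise x' x (e i)) = ∑ i, c x i * φ (x' (e i)) := by
    intro x x'
    have : c ((Finset.univ.image e).piecewise x' x) = c x := by
      refine hc _ _ fun k hk => Finset.piecewise_eq_of_notMem _ _ _ ?_
      simpa using hk
    simp only [this, piecewise_image_apply]
  simp only [e1]
  calc _ ≤ ∫ _, v * C ∂π := by
        refine integral_mono_of_nonneg (Eventually.of_forall fun _ => by positivity)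
          (integrable_const _) (Eventually.of_forall fun x => ?_)
        refine (integral_norm_linearForm_sq h he (c x) Finset.univ).trans_le ?_
        exact mul_le_mul_of_nonneg_left (hC x) (by positivity)
    _ = _ := by simp

theorem integral_abs_le_of_hasSubgaussianMGF {Z : Type*} [MeasurableSpace Z] {P : Measure Z}
    [IsProbabilityMeasure P] {X : Z → ℝ} {V : NNReal} (hX : HasSubgaussianMGF X V P)
    {s : ℝ} (hs : 0 < s) (hV : V ≤ s ^ 2) : ∫ x, |X x| ∂P ≤ 4 * s := by
  have hst : V * (1 / s) ^ 2 / 2 ≤ 1 / 2 := by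
    rw [div_pow, one_pow, mul_one_div]
    gcongr
    exact div_le_one_of_le₀ hV (by positivity)
  have hst' : V * (-(1 / s)) ^ 2 / 2 ≤ 1 / 2 := by rwa [neg_sq]
  have h1 := (hX.mgf_le (1 / s)).trans (Real.exp_le_exp.mpr hst)
  have h2 := (hX.mgf_le (-(1 / s))).trans (Real.exp_le_exp.mpr hst')
  have he : Real.exp (1 / 2) ≤ 2 := by
    rw [← Real.le_log_iff_exp_le (by norm_num)]
    linarith [Real.log_two_gt_d9]
  have i1 := hX.integrable_exp_mul (1 / s)
  have i2 := hX.integrable_exp_mul (-(1 / s))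
  calc ∫ x, |X x| ∂P
      ≤ ∫ x, s * (Real.exp (1 / s * X x) + Real.exp (-(1 / s) * X x)) ∂P := by
        refine integral_mono_of_nonneg (Eventually.of_forall fun _ => abs_nonneg _)
          ((i1.add i2).const_mul s) (Eventually.of_forall fun x => ?_)
        simp only
        have e1 : X x = s * (1 / s * X x) := by field_simp
        have e2 : -X x = s * (-(1 / s) * X x) := by field_simp
        rcases abs_cases (X x) with ⟨h, -⟩ | ⟨h, -⟩ <;> rw [h]
        · conv_lhs => rw [e1]
          gcongr
          linarith [Real.add_one_le_exp (1 / s * X x), Real.exp_pos (-(1 / s) * X x)]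
        · conv_lhs => rw [e2]
          gcongr
          linarith [Real.add_one_le_exp (-(1 / s) * X x), Real.exp_pos (1 / s * X x)]
    _ = s * (mgf X P (1 / s) + mgf X P (-(1 / s))) := by
        rw [integral_const_mul, integral_add i1 i2]
        rfl
    _ ≤ s * (2 + 2) := by
        gcongr
        · exact h1.trans he
        · exact h2.trans he
    _ = 4 * s := by ring

end Moments

section ResolventMap

variable {ι : Type*} [Fintype ι] [DecidableEq ι] {α : ℂ}

theorem measurable_gramResolvent_apply {Z : Type*} [MeasurableSpace Z] {A : Z → Matrix ι ι ℂ}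
    (hA : ∀ i j, Measurable fun x => A x i j) (α : ℂ) (i j : ι) :
    Measurable fun x => gramResolvent (A x) α i j := by
  have hH : Continuous fun M : ι → ι → ℂ => (of M)ᴴ * of M - α • (1 : Matrix ι ι ℂ) := by
    have h1 : Continuous fun M : ι → ι → ℂ => (of M : Matrix ι ι ℂ) := continuous_id
    exact (h1.matrix_conjTranspose.matrix_mul h1).sub continuous_const
  have h : Measurable fun M : ι → ι → ℂ => gramResolvent (of M) α i j := by
    simp only [gramResolvent, inv_def, Ring.inverse_eq_inv', Matrix.smul_apply, smul_eq_mul]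
    refine Measurable.mul (Measurable.inv hH.matrix_det.measurable) ?_
    exact (hH.matrix_adjugate.matrix_elem i j).measurable
  exact h.comp (measurable_pi_lambda _ fun i => measurable_pi_lambda _ fun j => hA i j)

theorem gramResolvent_submatrix (A : Matrix ι ι ℂ) (s : ι ≃ ι) :
    gramResolvent (A.submatrix s s) α = (gramResolvent A α).submatrix s s := by
  rw [gramResolvent, gramResolvent, ← inv_submatrix_equiv, conjTranspose_submatrix,
    submatrix_mul_equiv]
  congr 1
  ext i j
  simp [Matrix.one_apply]

end ResolventMap

section Model

variable {m n : ℕ}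

/-- The block cyclic matrix with the given entries, shifted by `z`. -/
def shiftedCyclic (c : Fin m × Fin n × Fin n → ℂ) (z : ℂ) :
    Matrix (Fin m × Fin n) (Fin m × Fin n) ℂ :=
  blockCyclic (fun k => of fun i j => c (k, i, j)) - z • (1 : Matrix _ _ ℂ)

theorem shiftedCyclic_apply (c : Fin m × Fin n × Fin n → ℂ) (z : ℂ) (p q : Fin m × Fin n) :
    shiftedCyclic c z p q = (if q.1 = finRotate m p.1 then c (p.1, p.2, q.2) else 0)
      - (if p = q then z else 0) := by
  simp [shiftedCyclic, blockCyclic, Matrix.one_apply]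

/-- The normalized trace of the diagonal block `a`. -/
noncomputable def blockMean (a : Fin m) (R : Matrix (Fin m × Fin n) (Fin m × Fin n) ℂ) : ℂ :=
  (n : ℂ)⁻¹ * ∑ i, R (a, i) (a, i)

theorem sum_blockMean (R : Matrix (Fin m × Fin n) (Fin m × Fin n) ℂ) :
    ∑ a, blockMean a R = (n : ℂ)⁻¹ * R.trace := by
  simp only [blockMean, ← Finset.mul_sum, trace, diag_apply, Fintype.sum_prod_type]

theorem blockMean_sub_eq (a : Fin m) (R R' : Matrix (Fin m × Fin n) (Fin m × Fin n) ℂ) :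
    blockMean a R - blockMean a R' =
      (n : ℂ)⁻¹ * ∑ p, (if p.1 = a then 1 else 0) * (R p p - R' p p) := by
  rw [blockMean, blockMean, ← mul_sub, ← Finset.sum_sub_distrib, Fintype.sum_prod_type]
  congr 1
  rw [Finset.sum_eq_single a]
  · simp
  · intro b _ hb
    simp [hb]
  · simp

theorem norm_blockMean_sub_le (a : Fin m) {R R' : Matrix (Fin m × Fin n) (Fin m × Fin n) ℂ}
    {C : ℝ} (h : ∀ d : Fin m × Fin n → ℂ, (∀ i, ‖d i‖ ≤ 1) → ‖∑ p, d p * (R p p - R' p p)‖ ≤ C) :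
    ‖blockMean a R - blockMean a R'‖ ≤ C / n := by
  rw [blockMean_sub_eq, norm_mul, norm_inv, Complex.norm_natCast, inv_mul_eq_div]
  gcongr
  refine h _ fun p => ?_
  split_ifs <;> simp

theorem norm_blockMean_le (hn : 0 < n) (a : Fin m) {R : Matrix (Fin m × Fin n) (Fin m × Fin n) ℂ}
    {C : ℝ} (h : ∀ p, ‖R p p‖ ≤ C) : ‖blockMean a R‖ ≤ C := by
  rw [blockMean, norm_mul, norm_inv, Complex.norm_natCast, inv_mul_le_iff₀ (by positivity)]
  refine (norm_sum_le_of_le _ fun i _ => h (a, i)).trans ?_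
  simp

theorem finRotate_invariant {G : Type*} {h : Fin m → G} (hh : ∀ a, h (finRotate m a) = h a)
    (a b : Fin m) : h a = h b := by
  cases m with
  | zero => exact a.elim0
  | succ k =>
    have : ∀ i : Fin (k + 1), h i = h 0 := by
      intro i
      induction i using Fin.induction with
      | zero => rfl
      | succ i ih =>
        have := hh i.castSucc
        rw [finRotate_apply, Fin.coeSucc_eq_succ] at this
        rw [this, ih]
    rw [this a, this b]

theorem finRotate_ne_self (hm : 1 < m) (a : Fin m) : finRotate m a ≠ a := by
  have h : a ∈ (finRotate m).support := by
    rw [support_finRotate_of_le hm]; exact Finset.mem_univ a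
  exact Equiv.Perm.mem_support.mp h

/-- The row of the block cyclic matrix to which an entry belongs. -/
def entryRow (k : Fin m × Fin n × Fin n) : Fin m × Fin n := (k.1, k.2.1)

variable {E : Type*} {φ : E → ℂ} {z α : ℂ}

theorem updateRow_shiftedCyclic_congr {p : Fin m × Fin n} {x x' : Fin m × Fin n × Fin n → E}
    (h : ∀ k, entryRow k ≠ p → x k = x' k) :
    (shiftedCyclic (φ ∘ x) z).updateRow p 0 = (shiftedCyclic (φ ∘ x') z).updateRow p 0 := by
  ext r s
  by_cases hr : r = p
  · subst hr; simp
  · rw [updateRow_ne hr, updateRow_ne hr, shiftedCyclic_apply, shiftedCyclic_apply]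
    simp only [Function.comp_apply]
    rw [h (r.1, r.2, s.2) hr]

theorem norm_sum_mul_sub_le_add {ι : Type*} [Fintype ι] {d u v w : ι → ℂ} {C D : ℝ}
    (h1 : ‖∑ i, d i * (w i - u i)‖ ≤ C) (h2 : ‖∑ i, d i * (w i - v i)‖ ≤ D) :
    ‖∑ i, d i * (u i - v i)‖ ≤ C + D := by
  have : ∑ i, d i * (u i - v i) = ∑ i, d i * (w i - v i) - ∑ i, d i * (w i - u i) := by
    rw [← Finset.sum_sub_distrib]
    exact Finset.sum_congr rfl fun i _ => by ring
  rw [this, add_comm C D]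
  exact (norm_sub_le _ _).trans (add_le_add h2 h1)

theorem norm_sum_diag_sub_le (hα : 0 < α.im) {p : Fin m × Fin n}
    {x x' : Fin m × Fin n × Fin n → E} (h : ∀ k, entryRow k ≠ p → x k = x' k)
    {d : Fin m × Fin n → ℂ} (hd : ∀ i, ‖d i‖ ≤ 1) :
    ‖∑ q, d q * (gramResolvent (shiftedCyclic (φ ∘ x) z) α q q
      - gramResolvent (shiftedCyclic (φ ∘ x') z) α q q)‖ ≤ 6 / α.im := by
  have h1 := norm_sum_diag_updateRow_sub_le (shiftedCyclic (φ ∘ x) z) hα p hd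
  have h2 := norm_sum_diag_updateRow_sub_le (shiftedCyclic (φ ∘ x') z) hα p hd
  rw [← updateRow_shiftedCyclic_congr h] at h2
  have h3 : 0 < 1 / α.im := by positivity
  calc _ ≤ 1 / α.im + 1 / α.im := norm_sum_mul_sub_le_add h1 h2
    _ ≤ 6 / α.im := by rw [show 6 / α.im = 6 * (1 / α.im) by ring]; linarith

theorem norm_sum_diag_conjTranspose_sub_le (hα : 0 < α.im) {p : Fin m × Fin n}
    {x x' : Fin m × Fin n × Fin n → E} (h : ∀ k, entryRow k ≠ p → x k = x' k)
    {d : Fin m × Fin n → ℂ} (hd : ∀ i, ‖d i‖ ≤ 1) :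
    ‖∑ q, d q * (gramResolvent (shiftedCyclic (φ ∘ x) z)ᴴ α q q
      - gramResolvent (shiftedCyclic (φ ∘ x') z)ᴴ α q q)‖ ≤ 6 / α.im := by
  have h1 := norm_sum_diag_conjTranspose_updateRow_sub_le (shiftedCyclic (φ ∘ x) z) hα p hd
  have h2 := norm_sum_diag_conjTranspose_updateRow_sub_le (shiftedCyclic (φ ∘ x') z) hα p hd
  rw [← updateRow_shiftedCyclic_congr h] at h2
  calc _ ≤ 3 / α.im + 3 / α.im := norm_sum_mul_sub_le_add h1 h2
    _ = 6 / α.im := by ring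

variable [MeasurableSpace E] {μ : Measure E} [IsProbabilityMeasure μ] {b v : ℝ}

theorem measurable_shiftedCyclic (hφ : Measurable φ) (z : ℂ) (p q : Fin m × Fin n) :
    Measurable fun x : Fin m × Fin n × Fin n → E => shiftedCyclic (φ ∘ x) z p q := by
  simp only [shiftedCyclic_apply, Function.comp_apply]
  refine Measurable.sub_const ?_ _
  split_ifs
  · exact hφ.comp (measurable_pi_apply _)
  · exact measurable_const

theorem measurable_shiftedCyclic_conjTranspose (hφ : Measurable φ) (z : ℂ) (p q : Fin m × Fin n) :
    Measurable fun x : Fin m × Fin n × Fin n → E => (shiftedCyclic (φ ∘ x) z)ᴴ p q :=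
  continuous_star.measurable.comp (measurable_shiftedCyclic hφ z q p)

theorem measurable_blockMean {R : (Fin m × Fin n × Fin n → E) →
    Matrix (Fin m × Fin n) (Fin m × Fin n) ℂ} (hR : ∀ p q, Measurable fun x => R x p q)
    (a : Fin m) : Measurable fun x => blockMean a (R x) :=
  (Finset.measurable_sum _ fun i _ => hR (a, i) (a, i)).const_mul _

/-- The cyclic shift of the blocks, on entries. -/
def entryRotate (m n : ℕ) : Fin m × Fin n × Fin n ≃ Fin m × Fin n × Fin n :=
  (finRotate m).prodCongr (Equiv.refl _)

theorem measurePreserving_entryRotate (μ : Measure E) [IsProbabilityMeasure μ] :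
    MeasurePreserving (fun (x : Fin m × Fin n × Fin n → E) => x ∘ (entryRotate m n).symm)
      (Measure.pi fun _ => μ) (Measure.pi fun _ => μ) := by
  convert measurePreserving_piCongrLeft (fun _ : Fin m × Fin n × Fin n => μ) (entryRotate m n)
    using 1
  ext x k
  obtain ⟨k, rfl⟩ := (entryRotate m n).surjective k
  rw [Function.comp_apply, Equiv.symm_apply_apply]
  exact (Equiv.piCongrLeft_apply_apply (fun _ => E) (entryRotate m n) x k).symm

theorem shiftedCyclic_entryRotate (c : Fin m × Fin n × Fin n → ℂ) (z : ℂ) :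
    (shiftedCyclic (c ∘ (entryRotate m n).symm) z).submatrix
      ((finRotate m).prodCongr (Equiv.refl (Fin n))) ((finRotate m).prodCongr (Equiv.refl (Fin n)))
      = shiftedCyclic c z := by
  ext p q
  have h : ∀ a i j, (entryRotate m n).symm (finRotate m a, i, j) = (a, i, j) := fun a i j =>
    (entryRotate m n).symm_apply_apply (a, i, j)
  rw [submatrix_apply, shiftedCyclic_apply, shiftedCyclic_apply]
  simp only [Equiv.prodCongr_apply, Equiv.coe_refl, Prod.map_fst, Prod.map_snd, id_eq,
    EmbeddingLike.apply_eq_iff_eq, Function.comp_apply, h]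
  congr 2
  exact propext ((finRotate m).prodCongr (Equiv.refl (Fin n))).apply_eq_iff_eq

theorem blockMean_submatrix_rotate (a : Fin m) (R : Matrix (Fin m × Fin n) (Fin m × Fin n) ℂ) :
    blockMean a (R.submatrix ((finRotate m).prodCongr (Equiv.refl (Fin n)))
      ((finRotate m).prodCongr (Equiv.refl (Fin n)))) = blockMean (finRotate m a) R := by
  simp [blockMean]

theorem integral_blockMean_rotate (hφ : Measurable φ) (a : Fin m) :
    ∫ x, blockMean (finRotate m a) (gramResolvent (shiftedCyclic (φ ∘ x) z) α)
      ∂(Measure.pi fun _ : Fin m × Fin n × Fin n => μ) =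
    ∫ x, blockMean a (gramResolvent (shiftedCyclic (φ ∘ x) z) α)
      ∂(Measure.pi fun _ : Fin m × Fin n × Fin n => μ) := by
  have h := measurePreserving_entryRotate (m := m) (n := n) μ
  conv_lhs => rw [← h.map_eq]
  rw [integral_map h.measurable.aemeasurable]
  · refine integral_congr_ae (Eventually.of_forall fun x => ?_)
    beta_reduce
    rw [← blockMean_submatrix_rotate, ← gramResolvent_submatrix, ← Function.comp_assoc,
      shiftedCyclic_entryRotate]
  · exact (measurable_blockMean (measurable_gramResolvent_apply
      (measurable_shiftedCyclic hφ z) α) _).aestronglyMeasurable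

theorem integral_blockMean_conjTranspose_rotate (hφ : Measurable φ) (a : Fin m) :
    ∫ x, blockMean (finRotate m a) (gramResolvent (shiftedCyclic (φ ∘ x) z)ᴴ α)
      ∂(Measure.pi fun _ : Fin m × Fin n × Fin n => μ) =
    ∫ x, blockMean a (gramResolvent (shiftedCyclic (φ ∘ x) z)ᴴ α)
      ∂(Measure.pi fun _ : Fin m × Fin n × Fin n => μ) := by
  have h := measurePreserving_entryRotate (m := m) (n := n) μ
  conv_lhs => rw [← h.map_eq]
  rw [integral_map h.measurable.aemeasurable]
  · refine integral_congr_ae (Eventually.of_forall fun x => ?_)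
    beta_reduce
    have e := congrArg conjTranspose (shiftedCyclic_entryRotate (φ ∘ x) z)
    rw [conjTranspose_submatrix] at e
    rw [← blockMean_submatrix_rotate, ← gramResolvent_submatrix, ← Function.comp_assoc, e]
  · exact (measurable_blockMean (measurable_gramResolvent_apply
      (measurable_shiftedCyclic_conjTranspose hφ z) α) _).aestronglyMeasurable

/-- The expected Stieltjes transform. -/
noncomputable def meanTransform (m n : ℕ) (μ : Measure E) (φ : E → ℂ) (α z : ℂ) : ℂ :=
  ∫ x, ((m * n : ℕ) : ℂ)⁻¹ * (gramResolvent (shiftedCyclic (φ ∘ x) z) α).trace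
    ∂(Measure.pi fun _ : Fin m × Fin n × Fin n => μ)

theorem integral_blockMean_eq_of_rotate {R : (Fin m × Fin n × Fin n → E) →
    Matrix (Fin m × Fin n) (Fin m × Fin n) ℂ} {P : Measure (Fin m × Fin n × Fin n → E)}
    (hR : ∀ a, Integrable (fun x => blockMean a (R x)) P)
    (hrot : ∀ a, ∫ x, blockMean (finRotate m a) (R x) ∂P = ∫ x, blockMean a (R x) ∂P)
    (a : Fin m) :
    ∫ x, blockMean a (R x) ∂P = ∫ x, ((m * n : ℕ) : ℂ)⁻¹ * (R x).trace ∂P := by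
  have h : ∀ x, ((m * n : ℕ) : ℂ)⁻¹ * (R x).trace = (m : ℂ)⁻¹ * ∑ a, blockMean a (R x) := by
    intro x
    rw [sum_blockMean]
    push_cast
    rw [mul_inv, mul_assoc]
  simp only [h]
  rw [integral_const_mul, integral_finsetSum _ fun a _ => hR a]
  have h2 := fun b => finRotate_invariant (h := fun a => ∫ x, blockMean a (R x) ∂P) hrot b a
  simp only [h2]
  have : (m : ℂ) ≠ 0 := by
    have := a.pos
    exact_mod_cast this.ne'
  simp [this]

theorem integrable_blockMean (hn : 0 < n) (hα : 0 < α.im) {A : (Fin m × Fin n × Fin n → E) →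
    Matrix (Fin m × Fin n) (Fin m × Fin n) ℂ} (hA : ∀ p q, Measurable fun x => A x p q)
    {P : Measure (Fin m × Fin n × Fin n → E)} [IsFiniteMeasure P] (a : Fin m) :
    Integrable (fun x => blockMean a (gramResolvent (A x) α)) P :=
  integrable_of_measurable_bound_complex (B := 1 / α.im)
    (measurable_blockMean (measurable_gramResolvent_apply hA α) a)
    fun _ => norm_blockMean_le hn a fun p => norm_gramResolvent_diag_le _ hα p

theorem integral_blockMean_eq (hφ : Measurable φ) (hn : 0 < n) (hα : 0 < α.im) (a : Fin m) :
    ∫ x, blockMean a (gramResolvent (shiftedCyclic (φ ∘ x) z) α)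
      ∂(Measure.pi fun _ : Fin m × Fin n × Fin n => μ) = meanTransform m n μ φ α z :=
  integral_blockMean_eq_of_rotate
    (fun a => integrable_blockMean hn hα (measurable_shiftedCyclic hφ z) a)
    (integral_blockMean_rotate hφ) a

theorem integral_blockMean_conjTranspose_eq (hφ : Measurable φ) (hn : 0 < n) (hα : 0 < α.im)
    (a : Fin m) :
    ∫ x, blockMean a (gramResolvent (shiftedCyclic (φ ∘ x) z)ᴴ α)
      ∂(Measure.pi fun _ : Fin m × Fin n × Fin n => μ) = meanTransform m n μ φ α z := by
  rw [integral_blockMean_eq_of_rotate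
    (fun a => integrable_blockMean hn hα (measurable_shiftedCyclic_conjTranspose hφ z) a)
    (integral_blockMean_conjTranspose_rotate hφ) a, meanTransform]
  simp only [trace_gramResolvent_conjTranspose _ hα]

theorem integral_norm_sub_le_of_boundedDifferences {f : (Fin m × Fin n × Fin n → E) → ℂ}
    {B c s : ℝ} (hf : Measurable f) (hB : ∀ x, ‖f x‖ ≤ B)
    (hc : ∀ p x x', (∀ k, entryRow k ≠ p → x k = x' k) → ‖f x - f x'‖ ≤ c) (hs : 0 < s)
    (hs2 : (m * n : ℕ) * c ^ 2 ≤ s ^ 2) :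
    ∫ x, ‖f x - ∫ y, f y ∂(Measure.pi fun _ : Fin m × Fin n × Fin n => μ)‖
      ∂(Measure.pi fun _ : Fin m × Fin n × Fin n => μ) ≤ 8 * s := by
  set π := (Measure.pi fun _ : Fin m × Fin n × Fin n => μ)
  have hi : Integrable f π := integrable_of_measurable_bound_complex hf hB
  have hV : Fintype.card (Fin m × Fin n) * c ^ 2 ≤ ((⟨s ^ 2, sq_nonneg s⟩ : NNReal) : ℝ) := by
    simpa using hs2
  have h1 := hasSubgaussianMGF_of_boundedDifferences μ (f := fun x => (f x).re)
    (Complex.measurable_re.comp hf) (B := B) (fun x => (Complex.abs_re_le_norm _).trans (hB x))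
    entryRow (fun p x x' h => by
      rw [← Complex.sub_re]; exact (Complex.abs_re_le_norm _).trans (hc p x x' h)) hV
  have h2 := hasSubgaussianMGF_of_boundedDifferences μ (f := fun x => (f x).im)
    (Complex.measurable_im.comp hf) (B := B) (fun x => (Complex.abs_im_le_norm _).trans (hB x))
    entryRow (fun p x x' h => by
      rw [← Complex.sub_im]; exact (Complex.abs_im_le_norm _).trans (hc p x x' h)) hV
  have b1 := integral_abs_le_of_hasSubgaussianMGF h1 hs le_rfl
  have b2 := integral_abs_le_of_hasSubgaussianMGF h2 hs le_rfl
  have er : ∫ x, (f x).re ∂π = (∫ x, f x ∂π).re := integral_re hi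
  have ei : ∫ x, (f x).im ∂π = (∫ x, f x ∂π).im := integral_im hi
  calc _ ≤ ∫ x, (|(f x).re - ∫ y, (f y).re ∂π| + |(f x).im - ∫ y, (f y).im ∂π|) ∂π := by
        refine integral_mono_of_nonneg (Eventually.of_forall fun _ => norm_nonneg _)
          (h1.integrable.abs.add h2.integrable.abs) (Eventually.of_forall fun x => ?_)
        simp only
        rw [er, ei, ← Complex.sub_re, ← Complex.sub_im]
        exact Complex.norm_le_abs_re_add_abs_im _
    _ ≤ 4 * s + 4 * s := by
        rw [integral_add h1.integrable.abs h2.integrable.abs]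
        exact add_le_add b1 b2
    _ = 8 * s := by ring

end Model

section Forms

variable {m n : ℕ}

theorem sum_ite_block_mul (c : Fin m) (w : Fin n → ℂ) (f : Fin m × Fin n → ℂ) :
    ∑ q : Fin m × Fin n, (if q.1 = c then w q.2 else 0) * f q = ∑ j, w j * f (c, j) := by
  rw [Fintype.sum_prod_type, Finset.sum_eq_single c]
  · simp
  · intro b _ hb
    simp [hb]
  · simp

theorem sum_mul_ite_block (c : Fin m) (w : Fin n → ℂ) (f : Fin m × Fin n → ℂ) :
    ∑ q : Fin m × Fin n, f q * (if q.1 = c then w q.2 else 0) = ∑ j, f (c, j) * w j := by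
  simp only [mul_comm (f _)]
  exact sum_ite_block_mul c w f

/-- The quadratic form of a vector supported on one block. -/
theorem quadForm_block (c : Fin m) (w : Fin n → ℂ)
    (R : Matrix (Fin m × Fin n) (Fin m × Fin n) ℂ) {u : Fin m × Fin n → ℂ}
    (hu : u = fun q => if q.1 = c then w q.2 else 0) :
    u ⬝ᵥ (R *ᵥ star u) = ∑ j, ∑ k, w j * R (c, j) (c, k) * star (w k) := by
  have hs : star u = fun q => if q.1 = c then star (w q.2) else 0 := by
    ext q
    rw [hu, Pi.star_apply]
    split_ifs <;> simp
  rw [hs, hu]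
  simp only [dotProduct, mulVec]
  rw [sum_ite_block_mul]
  refine Finset.sum_congr rfl fun j _ => ?_
  rw [sum_mul_ite_block c (fun k => star (w k)), Finset.mul_sum]
  simp only [mul_assoc]

theorem quadForm_sub_single (c : Fin m) (p : Fin m × Fin n) (w : Fin n → ℂ) (z : ℂ)
    (R : Matrix (Fin m × Fin n) (Fin m × Fin n) ℂ) {u : Fin m × Fin n → ℂ}
    (hu : u = fun q => (if q.1 = c then w q.2 else 0) - if p = q then z else 0) :
    u ⬝ᵥ (R *ᵥ star u) = ∑ j, ∑ k, w j * R (c, j) (c, k) * star (w k)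
      - z * ∑ k, R p (c, k) * star (w k) - star z * ∑ j, R (c, j) p * w j
      + (‖z‖ : ℂ) ^ 2 * R p p := by
  set y : Fin m × Fin n → ℂ := fun q => if q.1 = c then w q.2 else 0 with hy
  have hu' : u = y - Pi.single p z := by
    ext q
    rw [hu, hy, Pi.sub_apply, Pi.single_apply]
    simp only [eq_comm (a := q)]
  have hs : star y = fun q => if q.1 = c then star (w q.2) else 0 := by
    ext q
    rw [hy, Pi.star_apply]
    split_ifs <;> simp
  have hs2 : star (Pi.single p z : Fin m × Fin n → ℂ) = Pi.single p (star z) :=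
    (Pi.single_star _ _).symm
  have h1 : (R *ᵥ star y) p = ∑ k, R p (c, k) * star (w k) := by
    rw [hs]
    exact sum_mul_ite_block c (fun k => star (w k)) (fun q => R p q)
  have h2 : y ⬝ᵥ (R *ᵥ Pi.single p (star z)) = star z * ∑ j, R (c, j) p * w j := by
    have e : ∀ q, (R *ᵥ Pi.single p (star z)) q = R q p * star z := fun q => by simp
    simp only [dotProduct, e]
    rw [sum_ite_block_mul, Finset.mul_sum]
    exact Finset.sum_congr rfl fun j _ => by ring
  have h3 : (R *ᵥ Pi.single p (star z)) p = R p p * star z := by simp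
  rw [hu', star_sub, hs2, mulVec_sub, dotProduct_sub, sub_dotProduct, sub_dotProduct,
    quadForm_block c w R hy, single_dotProduct, single_dotProduct, h1, h2, h3,
    ← Complex.mul_conj', ← Complex.star_def]
  ring

end Forms

section Expectation

variable {m n : ℕ} {E : Type*} {φ : E → ℂ} {z α : ℂ} [MeasurableSpace E] {μ : Measure E}
  [IsProbabilityMeasure μ] {b : ℝ}

theorem measurable_updateRow_zero {ι Z : Type*} [DecidableEq ι] [MeasurableSpace Z]
    {A : Z → Matrix ι ι ℂ} (hA : ∀ i j, Measurable fun x => A x i j) (p : ι) (i j : ι) :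
    Measurable fun x => (A x).updateRow p 0 i j := by
  by_cases h : i = p
  · subst h; simp
  · simp only [updateRow_ne h]; exact hA i j

theorem sum_sum_block_sq_le {A : Matrix (Fin m × Fin n) (Fin m × Fin n) ℂ} (hα : 0 < α.im)
    (c : Fin m) : ∑ j, ∑ k, ‖gramResolvent A α (c, j) (c, k)‖ ^ 2 ≤ n * (1 / α.im) ^ 2 := by
  calc _ ≤ ∑ _ : Fin n, (1 / α.im) ^ 2 := by
        refine Finset.sum_le_sum fun j _ => le_trans ?_ (sum_norm_sq_row_le A hα (c, j))
        rw [Fintype.sum_prod_type]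
        exact Finset.single_le_sum (f := fun d => ∑ k, ‖gramResolvent A α (c, j) (d, k)‖ ^ 2)
          (fun d _ => Finset.sum_nonneg fun k _ => by positivity) (Finset.mem_univ c)
    _ = _ := by simp

theorem sum_block_row_sq_le {A : Matrix (Fin m × Fin n) (Fin m × Fin n) ℂ} (hα : 0 < α.im)
    (c : Fin m) (p : Fin m × Fin n) :
    ∑ k, ‖gramResolvent A α p (c, k)‖ ^ 2 ≤ (1 / α.im) ^ 2 := by
  refine le_trans ?_ (sum_norm_sq_row_le A hα p)
  rw [Fintype.sum_prod_type]
  exact Finset.single_le_sum (f := fun d => ∑ k, ‖gramResolvent A α p (d, k)‖ ^ 2)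
    (fun d _ => Finset.sum_nonneg fun k _ => by positivity) (Finset.mem_univ c)

theorem sum_block_col_sq_le {A : Matrix (Fin m × Fin n) (Fin m × Fin n) ℂ} (hα : 0 < α.im)
    (c : Fin m) (p : Fin m × Fin n) :
    ∑ k, ‖gramResolvent A α (c, k) p‖ ^ 2 ≤ (1 / α.im) ^ 2 := by
  refine le_trans ?_ (sum_norm_sq_col_le A hα p)
  rw [Fintype.sum_prod_type]
  exact Finset.single_le_sum (f := fun d => ∑ k, ‖gramResolvent A α (d, k) p‖ ^ 2)
    (fun d _ => Finset.sum_nonneg fun k _ => by positivity) (Finset.mem_univ c)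

theorem integral_norm_blockMean_sub_le (hφ : Measurable φ) (hn : 0 < n) (hα : 0 < α.im) {s : ℝ}
    (hs : 0 < s) (hs2 : (m * n : ℕ) * (6 / α.im / n) ^ 2 ≤ s ^ 2) (a : Fin m) :
    ∫ x, ‖blockMean a (gramResolvent (shiftedCyclic (φ ∘ x) z) α) - meanTransform m n μ φ α z‖
      ∂(Measure.pi fun _ : Fin m × Fin n × Fin n => μ) ≤ 8 * s := by
  rw [← integral_blockMean_eq hφ hn hα a]
  refine integral_norm_sub_le_of_boundedDifferences (B := 1 / α.im)
    (measurable_blockMean (measurable_gramResolvent_apply (measurable_shiftedCyclic hφ z) α) a)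
    (fun x => norm_blockMean_le hn a fun p => norm_gramResolvent_diag_le _ hα p)
    (fun p x x' h => norm_blockMean_sub_le a fun d hd => norm_sum_diag_sub_le hα h hd) hs hs2

theorem integral_norm_blockMean_conjTranspose_sub_le (hφ : Measurable φ) (hn : 0 < n)
    (hα : 0 < α.im) {s : ℝ}
    (hs : 0 < s) (hs2 : (m * n : ℕ) * (6 / α.im / n) ^ 2 ≤ s ^ 2) (a : Fin m) :
    ∫ x, ‖blockMean a (gramResolvent (shiftedCyclic (φ ∘ x) z)ᴴ α) - meanTransform m n μ φ α z‖
      ∂(Measure.pi fun _ : Fin m × Fin n × Fin n => μ) ≤ 8 * s := by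
  rw [← integral_blockMean_conjTranspose_eq hφ hn hα a]
  refine integral_norm_sub_le_of_boundedDifferences (B := 1 / α.im)
    (measurable_blockMean (measurable_gramResolvent_apply
      (measurable_shiftedCyclic_conjTranspose hφ z) α) a)
    (fun x => norm_blockMean_le hn a fun p => norm_gramResolvent_diag_le _ hα p)
    (fun p x x' h => norm_blockMean_sub_le a fun d hd =>
      norm_sum_diag_conjTranspose_sub_le hα h hd) hs hs2

theorem injective_rowEntry (a : Fin m) (i : Fin n) :
    Function.Injective fun j : Fin n => ((a, i, j) : Fin m × Fin n × Fin n) := fun j k h => by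
  simpa using h

theorem injective_colEntry (a : Fin m) (i : Fin n) :
    Function.Injective fun j : Fin n => ((a, j, i) : Fin m × Fin n × Fin n) := fun j k h => by
  simpa using h

theorem integrable_norm_of_bound {Z : Type*} [MeasurableSpace Z] {P : Measure Z}
    [IsFiniteMeasure P] {F : Z → ℂ} {B : ℝ} (hm : Measurable F) (hB : ∀ x, ‖F x‖ ≤ B) :
    Integrable (fun x => ‖F x‖) P :=
  (integrable_of_measurable_bound_complex hm hB).norm

/-- The quadratic form of a row is close to `g + |z|² R'_pp` on average. -/
theorem integral_norm_rowForm_sub_le (h : IsBoundedCentred μ φ b ((n : ℝ)⁻¹)) (hn : 0 < n)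
    (hα : 0 < α.im) {s : ℝ} (hs : 0 < s) (hs2 : (m * n : ℕ) * (6 / α.im / n) ^ 2 ≤ s ^ 2)
    (p : Fin m × Fin n) :
    Integrable (fun x => ‖rowForm (shiftedCyclic (φ ∘ x) z) α p - (meanTransform m n μ φ α z
      + (‖z‖ : ℂ) ^ 2 * gramResolvent ((shiftedCyclic (φ ∘ x) z).updateRow p 0) α p p)‖)
      (Measure.pi fun _ : Fin m × Fin n × Fin n => μ) ∧
    ∫ x, ‖rowForm (shiftedCyclic (φ ∘ x) z) α p - (meanTransform m n μ φ α z
      + (‖z‖ : ℂ) ^ 2 * gramResolvent ((shiftedCyclic (φ ∘ x) z).updateRow p 0) α p p)‖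
      ∂(Measure.pi fun _ : Fin m × Fin n × Fin n => μ) ≤
    Real.sqrt (3 * (b ^ 2 * (n : ℝ)⁻¹ + ((n : ℝ)⁻¹) ^ 2) * (n * (1 / α.im) ^ 2))
      + 1 / α.im / n + 8 * s + 2 * (‖z‖ * Real.sqrt ((n : ℝ)⁻¹ * (1 / α.im) ^ 2)) := by
  obtain ⟨a, i⟩ := p
  set p : Fin m × Fin n := (a, i) with hp
  set c := finRotate m a with hc
  set π := (Measure.pi fun _ : Fin m × Fin n × Fin n => μ)
  set g := meanTransform m n μ φ α z
  set e : Fin n → Fin m × Fin n × Fin n := fun j => (a, i, j) with he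
  set R' : (Fin m × Fin n × Fin n → E) → Matrix (Fin m × Fin n) (Fin m × Fin n) ℂ :=
    fun x => gramResolvent ((shiftedCyclic (φ ∘ x) z).updateRow p 0) α with hR'
  have mA := measurable_shiftedCyclic (m := m) (n := n) h.measurable z
  have mR' : ∀ q r, Measurable fun x => R' x q r :=
    measurable_gramResolvent_apply (measurable_updateRow_zero mA p) α
  have bR' : ∀ x q r, ‖R' x q r‖ ≤ 1 / α.im := fun x q r => norm_gramResolvent_apply_le _ hα q r
  have dR' : ∀ x x', (∀ k, k ∉ Set.range e → x k = x' k) → R' x = R' x' := by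
    intro x x' hx
    have : (shiftedCyclic (φ ∘ x) z).updateRow p 0 = (shiftedCyclic (φ ∘ x') z).updateRow p 0 := by
      refine updateRow_shiftedCyclic_congr fun k hk => hx k ?_
      rintro ⟨j, rfl⟩
      exact hk rfl
    simp only [hR', this]
  have hinj : Function.Injective e := injective_rowEntry a i
  set Q : (Fin m × Fin n × Fin n → E) → Fin n → Fin n → ℂ := fun x j k => R' x (c, j) (c, k) with hQ
  set c1 : (Fin m × Fin n × Fin n → E) → Fin n → ℂ := fun x k => star (R' x p (c, k)) with hc1
  set c2 : (Fin m × Fin n × Fin n → E) → Fin n → ℂ := fun x k => R' x (c, k) p with hc2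
  have mQ : ∀ j k, Measurable fun x => Q x j k := fun j k => mR' _ _
  have mc1 : ∀ k, Measurable fun x => c1 x k := fun k =>
    continuous_star.measurable.comp (mR' p (c, k))
  have mc2 : ∀ k, Measurable fun x => c2 x k := fun k => mR' _ _
  have bQ : ∀ x j k, ‖Q x j k‖ ≤ 1 / α.im := fun x j k => bR' _ _ _
  have bc1 : ∀ x k, ‖c1 x k‖ ≤ 1 / α.im := fun x k => (norm_star _).trans_le (bR' _ _ _)
  have bc2 : ∀ x k, ‖c2 x k‖ ≤ 1 / α.im := fun x k => bR' _ _ _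
  have q0 := integral_norm_centredForm_le h hinj mQ bQ
    (fun x x' hx => by simp only [hQ, dR' x x' hx])
    (fun x => sum_sum_block_sq_le (A := (shiftedCyclic (φ ∘ x) z).updateRow p 0) hα c)
  have q1 := integral_norm_linearForm_le h hinj mc1 bc1
    (fun x x' hx => by simp only [hc1, dR' x x' hx])
    (fun x => by
      simp only [hc1, norm_star]
      exact sum_block_row_sq_le (A := (shiftedCyclic (φ ∘ x) z).updateRow p 0) hα c p)
  have q2 := integral_norm_linearForm_le h hinj mc2 bc2
    (fun x x' hx => by simp only [hc2, dR' x x' hx])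
    (fun x => sum_block_col_sq_le (A := (shiftedCyclic (φ ∘ x) z).updateRow p 0) hα c p)
  have q3 := integral_norm_blockMean_sub_le (μ := μ) (z := z) h.measurable hn hα hs hs2 c
  have i0 := integrable_norm_of_bound (P := π) (measurable_centredForm_coeff (e := e) h mQ)
    (norm_centredForm_coeff_le (e := e) h bQ)
  have i1 := integrable_norm_of_bound (P := π) (measurable_linearForm_coeff (e := e) h mc1)
    (norm_linearForm_coeff_le (e := e) h bc1)
  have i2 := integrable_norm_of_bound (P := π) (measurable_linearForm_coeff (e := e) h mc2)
    (norm_linearForm_coeff_le (e := e) h bc2)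
  have i3 : Integrable (fun x =>
      ‖blockMean c (gramResolvent (shiftedCyclic (φ ∘ x) z) α) - g‖) π :=
    ((integrable_blockMean hn hα mA c).sub (integrable_const g)).norm
  have expand : ∀ x, rowForm (shiftedCyclic (φ ∘ x) z) α p - (g + (‖z‖ : ℂ) ^ 2 * R' x p p)
      = centredForm φ ((n : ℝ)⁻¹) e (Q x) Finset.univ x + (blockMean c (R' x) - g)
        - z * star (∑ k, c1 x k * φ (x (e k))) - star z * ∑ k, c2 x k * φ (x (e k)) := by
    intro x
    have hrow : shiftedCyclic (φ ∘ x) z p = fun q =>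
        (if q.1 = c then (fun j => φ (x (e j))) q.2 else 0) - if p = q then z else 0 := by
      ext q
      rw [shiftedCyclic_apply]
      rfl
    rw [rowForm, quadForm_sub_single c p (fun j => φ (x (e j))) z _ hrow]
    simp only [centredForm, blockMean, hQ, hc1, hc2, star_sum, star_mul', star_star, hR']
    push_cast
    ring
  have hbm : ∀ x, ‖blockMean c (R' x) - g‖ ≤ 1 / α.im / n
      + ‖blockMean c (gramResolvent (shiftedCyclic (φ ∘ x) z) α) - g‖ := by
    intro x
    have h1 := norm_blockMean_sub_le c (fun d hd =>
      norm_sum_diag_updateRow_sub_le (shiftedCyclic (φ ∘ x) z) hα p hd)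
    exact (norm_sub_le_norm_sub_add_norm_sub _ _ _).trans (add_le_add_left h1 _)
  have hpt : ∀ x, ‖rowForm (shiftedCyclic (φ ∘ x) z) α p - (g + (‖z‖ : ℂ) ^ 2 * R' x p p)‖ ≤
      ‖centredForm φ ((n : ℝ)⁻¹) e (Q x) Finset.univ x‖ + 1 / α.im / n
      + ‖blockMean c (gramResolvent (shiftedCyclic (φ ∘ x) z) α) - g‖
      + ‖z‖ * ‖∑ k, c1 x k * φ (x (e k))‖ + ‖z‖ * ‖∑ k, c2 x k * φ (x (e k))‖ := by
    intro x
    rw [expand]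
    refine (norm_sub_le _ _).trans (add_le_add ((norm_sub_le _ _).trans (add_le_add
      ((norm_add_le _ _).trans ?_) ?_)) ?_)
    · rw [add_assoc]
      exact add_le_add_right (hbm x) _
    · rw [norm_mul, norm_star]
    · rw [norm_mul, norm_star]
  have iR : Integrable (fun x => ‖centredForm φ ((n : ℝ)⁻¹) e (Q x) Finset.univ x‖ + 1 / α.im / n
      + ‖blockMean c (gramResolvent (shiftedCyclic (φ ∘ x) z) α) - g‖
      + ‖z‖ * ‖∑ k, c1 x k * φ (x (e k))‖ + ‖z‖ * ‖∑ k, c2 x k * φ (x (e k))‖) π :=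
    (((i0.add (integrable_const _)).add i3).add (i1.const_mul _)).add (i2.const_mul _)
  have mF : Measurable fun x =>
      rowForm (shiftedCyclic (φ ∘ x) z) α p - (g + (‖z‖ : ℂ) ^ 2 * R' x p p) := by
    simp only [expand]
    exact (((measurable_centredForm_coeff (e := e) h mQ).add ((measurable_blockMean mR' c).sub_const
      g)).sub ((continuous_star.measurable.comp
        (measurable_linearForm_coeff (e := e) h mc1)).const_mul z)).sub
      ((measurable_linearForm_coeff (e := e) h mc2).const_mul _)
  refine ⟨iR.mono' mF.norm.aestronglyMeasurable (Eventually.of_forall fun x => ?_), ?_⟩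
  · rw [Real.norm_of_nonneg (norm_nonneg _)]
    exact hpt x
  calc _ ≤ ∫ x, (‖centredForm φ ((n : ℝ)⁻¹) e (Q x) Finset.univ x‖ + 1 / α.im / n
      + ‖blockMean c (gramResolvent (shiftedCyclic (φ ∘ x) z) α) - g‖
      + ‖z‖ * ‖∑ k, c1 x k * φ (x (e k))‖ + ‖z‖ * ‖∑ k, c2 x k * φ (x (e k))‖) ∂π :=
        integral_mono_of_nonneg (Eventually.of_forall fun _ => norm_nonneg _) iR
          (Eventually.of_forall hpt)
    _ = ∫ x, ‖centredForm φ ((n : ℝ)⁻¹) e (Q x) Finset.univ x‖ ∂π + 1 / α.im / n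
      + ∫ x, ‖blockMean c (gramResolvent (shiftedCyclic (φ ∘ x) z) α) - g‖ ∂π
      + ‖z‖ * ∫ x, ‖∑ k, c1 x k * φ (x (e k))‖ ∂π
      + ‖z‖ * ∫ x, ‖∑ k, c2 x k * φ (x (e k))‖ ∂π := by
        rw [integral_add (by exact (((i0.add (integrable_const _)).add i3).add (i1.const_mul _)))
          (i2.const_mul _),
          integral_add (by exact ((i0.add (integrable_const _)).add i3)) (i1.const_mul _),
          integral_add (by exact i0.add (integrable_const _)) i3,
          integral_add i0 (integrable_const _), integral_const_mul, integral_const_mul]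
        simp
    _ ≤ _ := by
        have hz := norm_nonneg z
        have q1' := mul_le_mul_of_nonneg_left q1 hz
        have q2' := mul_le_mul_of_nonneg_left q2 hz
        linarith

/-- The quadratic form of a column, with the row of the same index removed, is close to `g` on
average. -/
theorem integral_norm_colForm_sub_le (h : IsBoundedCentred μ φ b ((n : ℝ)⁻¹)) (hm : 1 < m)
    (hn : 0 < n) (hα : 0 < α.im) {s : ℝ} (hs : 0 < s)
    (hs2 : (m * n : ℕ) * (6 / α.im / n) ^ 2 ≤ s ^ 2) (p : Fin m × Fin n) :
    Integrable (fun x => ‖rowForm ((shiftedCyclic (φ ∘ x) z).updateRow p 0)ᴴ α p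
      - meanTransform m n μ φ α z‖) (Measure.pi fun _ : Fin m × Fin n × Fin n => μ) ∧
    ∫ x, ‖rowForm ((shiftedCyclic (φ ∘ x) z).updateRow p 0)ᴴ α p - meanTransform m n μ φ α z‖
      ∂(Measure.pi fun _ : Fin m × Fin n × Fin n => μ) ≤
    Real.sqrt (3 * (b ^ 2 * (n : ℝ)⁻¹ + ((n : ℝ)⁻¹) ^ 2) * (n * (1 / α.im) ^ 2))
      + 4 / α.im / n + 8 * s := by
  obtain ⟨a, i⟩ := p
  set p : Fin m × Fin n := (a, i) with hp
  set c := (finRotate m).symm a with hc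
  have hca : finRotate m c = a := (finRotate m).apply_symm_apply a
  set π := (Measure.pi fun _ : Fin m × Fin n × Fin n => μ)
  set g := meanTransform m n μ φ α z
  set e : Fin n → Fin m × Fin n × Fin n := fun j => (c, j, i) with he
  set A' : (Fin m × Fin n × Fin n → E) → Matrix (Fin m × Fin n) (Fin m × Fin n) ℂ :=
    fun x => (shiftedCyclic (φ ∘ x) z).updateRow p 0 with hA'
  set R' : (Fin m × Fin n × Fin n → E) → Matrix (Fin m × Fin n) (Fin m × Fin n) ℂ :=
    fun x => gramResolvent ((A' x)ᴴ.updateRow p 0) α with hR'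
  have mA := measurable_shiftedCyclic (m := m) (n := n) h.measurable z
  have mA' : ∀ q r, Measurable fun x => (A' x)ᴴ q r := fun q r =>
    continuous_star.measurable.comp (measurable_updateRow_zero mA p r q)
  have mR' : ∀ q r, Measurable fun x => R' x q r :=
    measurable_gramResolvent_apply (measurable_updateRow_zero mA' p) α
  have bR' : ∀ x q r, ‖R' x q r‖ ≤ 1 / α.im := fun x q r => norm_gramResolvent_apply_le _ hα q r
  have dR' : ∀ x x', (∀ k, k ∉ Set.range e → x k = x' k) → R' x = R' x' := by
    intro x x' hx
    have : (A' x)ᴴ.updateRow p 0 = (A' x')ᴴ.updateRow p 0 := by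
      ext r s
      by_cases hr : r = p
      · subst hr; simp
      · rw [updateRow_ne hr, updateRow_ne hr, conjTranspose_apply, conjTranspose_apply]
        congr 1
        by_cases hs : s = p
        · simp [hA', hs]
        · simp only [hA']
          rw [updateRow_ne hs, updateRow_ne hs, shiftedCyclic_apply, shiftedCyclic_apply]
          congr 1
          split_ifs with hrs
          · simp only [Function.comp_apply]
            rw [hx]
            rintro ⟨j, hj⟩
            simp only [he, Prod.mk.injEq] at hj
            apply hr
            ext1
            · rw [hrs, ← hj.1, hca]
            · exact hj.2.2.symm
          · rfl
    simp only [hR', this]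
  have hinj : Function.Injective e := injective_colEntry c i
  set Q : (Fin m × Fin n × Fin n → E) → Fin n → Fin n → ℂ := fun x j k => R' x (c, k) (c, j) with hQ
  have mQ : ∀ j k, Measurable fun x => Q x j k := fun j k => mR' _ _
  have bQ : ∀ x j k, ‖Q x j k‖ ≤ 1 / α.im := fun x j k => bR' _ _ _
  have q0 := integral_norm_centredForm_le h hinj mQ bQ
    (fun x x' hx => by simp only [hQ, dR' x x' hx])
    (fun x => by
      rw [Finset.sum_comm]
      exact sum_sum_block_sq_le (A := (A' x)ᴴ.updateRow p 0) hα c)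
  have q3 := integral_norm_blockMean_conjTranspose_sub_le (μ := μ) (z := z) h.measurable hn hα
    hs hs2 c
  have i0 := integrable_norm_of_bound (P := π) (measurable_centredForm_coeff (e := e) h mQ)
    (norm_centredForm_coeff_le (e := e) h bQ)
  have i3 : Integrable (fun x =>
      ‖blockMean c (gramResolvent (shiftedCyclic (φ ∘ x) z)ᴴ α) - g‖) π :=
    ((integrable_blockMean hn hα (measurable_shiftedCyclic_conjTranspose h.measurable z)
      c).sub (integrable_const g)).norm
  have expand : ∀ x, rowForm (A' x)ᴴ α p - g
      = centredForm φ ((n : ℝ)⁻¹) e (Q x) Finset.univ x + (blockMean c (R' x) - g) := by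
    intro x
    have hrow : (A' x)ᴴ p = fun q =>
        (if q.1 = c then (fun j => star (φ (x (e j)))) q.2 else 0) := by
      ext q
      rw [conjTranspose_apply]
      by_cases hq : q = p
      · have : q.1 ≠ c := by
          intro h1
          have h2 : a = c := by rw [← h1, hq]
          exact finRotate_ne_self hm c (hca.trans h2)
        rw [if_neg this, hq]
        simp [hA']
      · simp only [hA']
        rw [updateRow_ne hq, shiftedCyclic_apply, if_neg hq, sub_zero]
        by_cases hqc : q.1 = c
        · rw [if_pos hqc, if_pos (by rw [hqc, hca])]
          simp only [Function.comp_apply, he, hqc]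
          rfl
        · rw [if_neg hqc, if_neg, star_zero]
          intro h1
          apply hqc
          rw [hc, Equiv.eq_symm_apply]
          exact h1.symm
    rw [rowForm, quadForm_block c (fun j => star (φ (x (e j)))) _ hrow, Finset.sum_comm]
    simp only [centredForm, blockMean, hQ, star_star]
    have : ∀ j k, star (φ (x (e k))) * gramResolvent ((A' x)ᴴ.updateRow p 0) α (c, k) (c, j)
        * φ (x (e j)) = φ (x (e j)) * R' x (c, k) (c, j) * star (φ (x (e k))) := fun j k => by
      simp only [hR']; ring
    simp only [this]
    push_cast
    ring
  have hbm : ∀ x, ‖blockMean c (R' x) - g‖ ≤ 4 / α.im / n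
      + ‖blockMean c (gramResolvent (shiftedCyclic (φ ∘ x) z)ᴴ α) - g‖ := by
    intro x
    have h1 := norm_blockMean_sub_le c (fun d hd =>
      norm_sum_diag_updateRow_sub_le (A' x)ᴴ hα p hd)
    have h2 := norm_blockMean_sub_le c (fun d hd =>
      norm_sum_diag_conjTranspose_updateRow_sub_le (shiftedCyclic (φ ∘ x) z) hα p hd)
    have h3 := (norm_sub_le_norm_sub_add_norm_sub (blockMean c (R' x))
      (blockMean c (gramResolvent (A' x)ᴴ α)) g)
    have h4 := (norm_sub_le_norm_sub_add_norm_sub (blockMean c (gramResolvent (A' x)ᴴ α))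
      (blockMean c (gramResolvent (shiftedCyclic (φ ∘ x) z)ᴴ α)) g)
    have h5 : 4 / α.im / n = 1 / α.im / n + 3 / α.im / n := by ring
    linarith
  have hpt : ∀ x, ‖rowForm (A' x)ᴴ α p - g‖ ≤
      ‖centredForm φ ((n : ℝ)⁻¹) e (Q x) Finset.univ x‖ + 4 / α.im / n
      + ‖blockMean c (gramResolvent (shiftedCyclic (φ ∘ x) z)ᴴ α) - g‖ := by
    intro x
    rw [expand, add_assoc]
    exact (norm_add_le _ _).trans (add_le_add_right (hbm x) _)
  have iR : Integrable (fun x => ‖centredForm φ ((n : ℝ)⁻¹) e (Q x) Finset.univ x‖ + 4 / α.im / n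
      + ‖blockMean c (gramResolvent (shiftedCyclic (φ ∘ x) z)ᴴ α) - g‖) π :=
    (i0.add (integrable_const _)).add i3
  have mF : Measurable fun x => rowForm (A' x)ᴴ α p - g := by
    simp only [expand]
    exact (measurable_centredForm_coeff (e := e) h mQ).add ((measurable_blockMean mR' c).sub_const g)
  refine ⟨iR.mono' mF.norm.aestronglyMeasurable (Eventually.of_forall fun x => ?_), ?_⟩
  · rw [Real.norm_of_nonneg (norm_nonneg _)]
    exact hpt x
  calc _ ≤ ∫ x, (‖centredForm φ ((n : ℝ)⁻¹) e (Q x) Finset.univ x‖ + 4 / α.im / n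
      + ‖blockMean c (gramResolvent (shiftedCyclic (φ ∘ x) z)ᴴ α) - g‖) ∂π :=
        integral_mono_of_nonneg (Eventually.of_forall fun _ => norm_nonneg _) iR
          (Eventually.of_forall hpt)
    _ = ∫ x, ‖centredForm φ ((n : ℝ)⁻¹) e (Q x) Finset.univ x‖ ∂π + 4 / α.im / n
      + ∫ x, ‖blockMean c (gramResolvent (shiftedCyclic (φ ∘ x) z)ᴴ α) - g‖ ∂π := by
        rw [integral_add (by exact i0.add (integrable_const _)) i3,
          integral_add i0 (integrable_const _)]
        simp
    _ ≤ _ := by linarith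

end Expectation

/-- The cubic polynomial that the limiting Stieltjes transform annihilates. -/
noncomputable def cubicDefect (α z g : ℂ) : ℂ :=
  g ^ 3 + 2 * g ^ 2 + (α + 1 - (‖z‖ : ℂ) ^ 2) / α * g + 1 / α

section SelfConsistent

variable {m n : ℕ} {E : Type*} {φ : E → ℂ} {z α : ℂ} [MeasurableSpace E] {μ : Measure E}
  [IsProbabilityMeasure μ] {b : ℝ}

theorem norm_meanTransform_le (hm : 0 < m) (hφ : Measurable φ) (hn : 0 < n) (hα : 0 < α.im) :
    ‖meanTransform m n μ φ α z‖ ≤ 1 / α.im := by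
  rw [← integral_blockMean_eq hφ hn hα ⟨0, hm⟩]
  refine (norm_integral_le_of_norm_le_const (C := 1 / α.im) (Eventually.of_forall fun x =>
    norm_blockMean_le hn _ fun p => norm_gramResolvent_diag_le _ hα p)).trans ?_
  simp

theorem im_mul_meanTransform_nonneg (hm : 0 < m) (hφ : Measurable φ) (hn : 0 < n)
    (hα : 0 < α.im) : 0 ≤ (α * meanTransform m n μ φ α z).im := by
  have hi := integrable_blockMean (P := Measure.pi fun _ : Fin m × Fin n × Fin n => μ) hn hα
    (measurable_shiftedCyclic hφ z) ⟨0, hm⟩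
  rw [← integral_blockMean_eq hφ hn hα ⟨0, hm⟩, ← integral_const_mul]
  have := integral_im (hi.const_mul α)
  simp only [RCLike.im_eq_complex_im] at this
  rw [← this]
  refine integral_nonneg fun x => ?_
  have e : α * blockMean ⟨0, hm⟩ (gramResolvent (shiftedCyclic (φ ∘ x) z) α)
      = ((n : ℝ)⁻¹ : ℝ) * ∑ i, α * gramResolvent (shiftedCyclic (φ ∘ x) z) α (⟨0, hm⟩, i)
        (⟨0, hm⟩, i) := by
    rw [blockMean, ← Finset.mul_sum]
    push_cast
    ring
  simp only [Pi.zero_apply]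
  rw [e, Complex.im_ofReal_mul, Complex.im_sum]
  exact mul_nonneg (by positivity)
    (Finset.sum_nonneg fun i _ => im_mul_gramResolvent_diag_nonneg _ hα _)

theorem im_le_norm_mul_one_add_meanTransform (hm : 0 < m) (hφ : Measurable φ) (hn : 0 < n)
    (hα : 0 < α.im) : α.im ≤ ‖α * (1 + meanTransform m n μ φ α z)‖ := by
  have h1 := im_mul_meanTransform_nonneg (μ := μ) (z := z) hm hφ hn hα
  have h2 := (le_abs_self _).trans (Complex.abs_im_le_norm (α * (1 + meanTransform m n μ φ α z)))
  rw [mul_add, mul_one, Complex.add_im] at h2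
  rw [mul_add, mul_one]
  linarith

/-- The expected Stieltjes transform almost satisfies the cubic equation. -/
theorem norm_cubicDefect_meanTransform_le (h : IsBoundedCentred μ φ b ((n : ℝ)⁻¹)) (hm : 1 < m)
    (hn : 0 < n) (hα : 0 < α.im) {s e₁ e₂ : ℝ} (hs : 0 < s)
    (hs2 : (m * n : ℕ) * (6 / α.im / n) ^ 2 ≤ s ^ 2)
    (he₁ : Real.sqrt (3 * (b ^ 2 * (n : ℝ)⁻¹ + ((n : ℝ)⁻¹) ^ 2) * (n * (1 / α.im) ^ 2))
      + 1 / α.im / n + 8 * s + 2 * (‖z‖ * Real.sqrt ((n : ℝ)⁻¹ * (1 / α.im) ^ 2)) ≤ e₁)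
    (he₂ : Real.sqrt (3 * (b ^ 2 * (n : ℝ)⁻¹ + ((n : ℝ)⁻¹) ^ 2) * (n * (1 / α.im) ^ 2))
      + 4 / α.im / n + 8 * s ≤ e₂) :
    ‖cubicDefect α z (meanTransform m n μ φ α z)‖ ≤ (1 + 1 / α.im) * (1 / α.im *
      (e₁ + ‖z‖ ^ 2 * (‖α‖ * (1 / α.im) ^ 2) * e₂)) := by
  set π := (Measure.pi fun _ : Fin m × Fin n × Fin n => μ)
  set g := meanTransform m n μ φ α z with hg
  have hm0 : 0 < m := by omega
  have h0 : α ≠ 0 := by rintro rfl; simp at hα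
  have hgn : ‖g‖ ≤ 1 / α.im := norm_meanTransform_le hm0 h.measurable hn hα
  have hden : α.im ≤ ‖α * (1 + g)‖ := im_le_norm_mul_one_add_meanTransform hm0 h.measurable hn hα
  have hg1 : 1 + g ≠ 0 := by
    intro h1
    rw [h1, mul_zero, norm_zero] at hden
    linarith
  set w₀ : ℂ := -1 / (α * (1 + g)) with hw₀
  have hw₀n : ‖w₀‖ ≤ 1 / α.im := by
    rw [hw₀, norm_div, norm_neg, norm_one]
    exact one_div_le_one_div_of_le hα hden
  have hw₀e : α * w₀ * (1 + g) = -1 := by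
    rw [hw₀]; field_simp
  set a : Fin m := ⟨0, hm0⟩
  set Rt : (Fin m × Fin n × Fin n → E) → Matrix (Fin m × Fin n) (Fin m × Fin n) ℂ :=
    fun x => gramResolvent (shiftedCyclic (φ ∘ x) z)ᴴ α with hRt
  have mRt : ∀ q r, Measurable fun x => Rt x q r :=
    measurable_gramResolvent_apply (measurable_shiftedCyclic_conjTranspose h.measurable z) α
  have bRt : ∀ x p, ‖Rt x p p‖ ≤ 1 / α.im := fun x p => norm_gramResolvent_diag_le _ hα p
  have iRt : ∀ p, Integrable (fun x => Rt x p p) π := fun p =>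
    integrable_of_measurable_bound_complex (mRt p p) fun x => bRt x p
  set err : Fin m × Fin n → (Fin m × Fin n × Fin n → E) → ℂ := fun p x =>
    rowForm (shiftedCyclic (φ ∘ x) z) α p - (g + (‖z‖ : ℂ) ^ 2 * w₀) with herr
  have eq1 : ∀ p x, Rt x p p * err p x = -α⁻¹ - Rt x p p * (1 + g + (‖z‖ : ℂ) ^ 2 * w₀) := by
    intro p x
    have h1 := mul_gramResolvent_diag_eq (shiftedCyclic (φ ∘ x) z) hα p
    change α * Rt x p p * (1 + rowForm (shiftedCyclic (φ ∘ x) z) α p) = -1 at h1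
    have h2 : Rt x p p * (1 + rowForm (shiftedCyclic (φ ∘ x) z) α p) = -α⁻¹ := by
      rw [eq_neg_iff_add_eq_zero]
      field_simp
      linear_combination h1
    simp only [herr]
    linear_combination h2
  set C := e₁ + ‖z‖ ^ 2 * (‖α‖ * (1 / α.im) ^ 2) * e₂ with hC
  have bound : ∀ p, ‖∫ x, Rt x p p * err p x ∂π‖ ≤ 1 / α.im * C := by
    intro p
    obtain ⟨i1, b1⟩ := integral_norm_rowForm_sub_le (z := z) h hn hα hs hs2 p
    obtain ⟨i2, b2⟩ := integral_norm_colForm_sub_le (z := z) h hm hn hα hs hs2 p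
    have hpt : ∀ x, ‖Rt x p p * err p x‖ ≤ 1 / α.im *
        (‖rowForm (shiftedCyclic (φ ∘ x) z) α p - (g + (‖z‖ : ℂ) ^ 2 *
            gramResolvent ((shiftedCyclic (φ ∘ x) z).updateRow p 0) α p p)‖
          + ‖z‖ ^ 2 * (‖α‖ * (1 / α.im) ^ 2) *
            ‖rowForm ((shiftedCyclic (φ ∘ x) z).updateRow p 0)ᴴ α p - g‖) := by
      intro x
      rw [norm_mul]
      refine mul_le_mul (bRt x p) ?_ (norm_nonneg _) (by positivity)
      set w := gramResolvent ((shiftedCyclic (φ ∘ x) z).updateRow p 0) α p p with hw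
      set σ := rowForm ((shiftedCyclic (φ ∘ x) z).updateRow p 0)ᴴ α p
      have hσ : α * w * (1 + σ) = -1 := by
        have := mul_gramResolvent_diag_eq ((shiftedCyclic (φ ∘ x) z).updateRow p 0)ᴴ hα p
        rwa [conjTranspose_conjTranspose] at this
      have hwn : ‖w‖ ≤ 1 / α.im := norm_gramResolvent_diag_le _ hα p
      have hdiff : w - w₀ = α * w * w₀ * (σ - g) := by
        linear_combination (-w₀) * hσ + w * hw₀e
      have e3 : err p x = (rowForm (shiftedCyclic (φ ∘ x) z) α p - (g + (‖z‖ : ℂ) ^ 2 * w))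
          + (‖z‖ : ℂ) ^ 2 * (w - w₀) := by
        simp only [herr]; ring
      rw [e3]
      refine (norm_add_le _ _).trans (add_le_add_right ?_ _)
      rw [hdiff, norm_mul, norm_mul, norm_mul, norm_mul, norm_pow, Complex.norm_real, norm_norm,
        sq (1 / α.im), mul_assoc (‖z‖ ^ 2), mul_assoc ‖α‖]
      gcongr
    have iB : Integrable (fun x => 1 / α.im *
        (‖rowForm (shiftedCyclic (φ ∘ x) z) α p - (g + (‖z‖ : ℂ) ^ 2 *
            gramResolvent ((shiftedCyclic (φ ∘ x) z).updateRow p 0) α p p)‖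
          + ‖z‖ ^ 2 * (‖α‖ * (1 / α.im) ^ 2) *
            ‖rowForm ((shiftedCyclic (φ ∘ x) z).updateRow p 0)ᴴ α p - g‖)) π :=
      (i1.add (i2.const_mul _)).const_mul _
    refine (norm_integral_le_of_norm_le iB (Eventually.of_forall hpt)).trans ?_
    rw [integral_const_mul, integral_add i1 (i2.const_mul _), integral_const_mul]
    have b1' := b1.trans he₁
    have b2' := b2.trans he₂
    rw [hC]
    gcongr
  have hint : ∀ p, ∫ x, Rt x p p * err p x ∂π
      = -α⁻¹ - (∫ x, Rt x p p ∂π) * (1 + g + (‖z‖ : ℂ) ^ 2 * w₀) := by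
    intro p
    simp only [eq1]
    rw [integral_sub (integrable_const _) ((iRt p).mul_const _), integral_mul_const]
    simp
  have hgs : g = (n : ℂ)⁻¹ * ∑ i, ∫ x, Rt x (a, i) (a, i) ∂π := by
    rw [hg, ← integral_blockMean_conjTranspose_eq h.measurable hn hα a]
    simp only [blockMean]
    rw [integral_const_mul, integral_finsetSum _ fun i _ => iRt (a, i)]
  have hn0 : (n : ℂ) ≠ 0 := by exact_mod_cast hn.ne'
  have hsum : (n : ℂ)⁻¹ * ∑ i, ∫ x, Rt x (a, i) (a, i) * err (a, i) x ∂π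
      = -α⁻¹ - g * (1 + g + (‖z‖ : ℂ) ^ 2 * w₀) := by
    simp only [hint]
    rw [Finset.sum_sub_distrib, ← Finset.sum_mul, mul_sub, ← mul_assoc, ← hgs]
    simp [hn0]
  have key : cubicDefect α z g = -(1 + g) *
      ((n : ℂ)⁻¹ * ∑ i, ∫ x, Rt x (a, i) (a, i) * err (a, i) x ∂π) := by
    rw [hsum, cubicDefect, hw₀]
    field_simp
    ring
  rw [key, norm_mul, norm_neg]
  refine mul_le_mul ((norm_add_le _ _).trans (by rw [norm_one]; gcongr)) ?_ (norm_nonneg _)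
    (by positivity)
  rw [norm_mul, norm_inv, Complex.norm_natCast, inv_mul_le_iff₀ (by positivity)]
  refine (norm_sum_le_of_le _ fun i _ => bound (a, i)).trans ?_
  simp

end SelfConsistent

section Perturbation

variable {α z : ℂ}

theorem cubicDefect_sub_le (hα : 0 < α.im) {a g : ℂ} {M T : ℝ} (hT : 1 ≤ T) (hτ : 1 / α.im ≤ T)
    (ha : ‖a‖ ≤ T) (hg : ‖g‖ ≤ T) (hz : ‖z‖ ≤ M) :
    ‖cubicDefect α z a - cubicDefect α z g‖ ≤ ‖a - g‖ * ((9 + M ^ 2) * T ^ 2) := by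
  have h0 : α ≠ 0 := by rintro rfl; simp at hα
  have e : cubicDefect α z a - cubicDefect α z g
      = (a - g) * ((a ^ 2 + a * g + g ^ 2) + 2 * (a + g) + 1 + (1 - (‖z‖ : ℂ) ^ 2) / α) := by
    rw [cubicDefect, cubicDefect]
    field_simp
    ring
  rw [e, norm_mul]
  refine mul_le_mul_of_nonneg_left ?_ (norm_nonneg _)
  have hT0 : 0 ≤ T := by linarith
  have h1 : ‖a ^ 2 + a * g + g ^ 2‖ ≤ 3 * T ^ 2 := by
    refine (norm_add₃_le).trans ?_
    rw [norm_pow, norm_mul, norm_pow]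
    have := pow_le_pow_left₀ (norm_nonneg a) ha 2
    have := pow_le_pow_left₀ (norm_nonneg g) hg 2
    have := mul_le_mul ha hg (norm_nonneg g) hT0
    nlinarith
  have h2 : ‖2 * (a + g)‖ ≤ 4 * T := by
    rw [norm_mul, Complex.norm_ofNat]
    have := norm_add_le a g
    linarith
  have h3 : ‖(1 - (‖z‖ : ℂ) ^ 2) / α‖ ≤ (1 + M ^ 2) * T := by
    rw [div_eq_mul_one_div, norm_mul]
    refine mul_le_mul ?_ ?_ (norm_nonneg _) (by positivity)
    · refine (norm_sub_le _ _).trans ?_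
      rw [norm_one, norm_pow, Complex.norm_real, norm_norm]
      gcongr
    · refine le_trans ?_ hτ
      rw [norm_div, norm_one]
      exact one_div_le_one_div_of_le hα ((le_abs_self _).trans (Complex.abs_im_le_norm α))
  calc _ ≤ 3 * T ^ 2 + 4 * T + 1 + (1 + M ^ 2) * T := by
        refine (norm_add_le _ _).trans (add_le_add ((norm_add_le _ _).trans (add_le_add
          ((norm_add_le _ _).trans (add_le_add h1 h2)) ?_)) h3)
        simp
    _ ≤ (9 + M ^ 2) * T ^ 2 := by
        have : T ≤ T ^ 2 := by nlinarith
        nlinarith [sq_nonneg M, mul_le_mul_of_nonneg_left this (sq_nonneg M)]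

variable {ι : Type*} [Fintype ι] [DecidableEq ι]

theorem norm_gram_shift_sub_le {Y : Matrix ι ι ℂ} {B M : ℝ} (hY : ∀ i j, ‖Y i j‖ ≤ B) {z z' : ℂ}
    (hz : ‖z‖ ≤ M) (hz' : ‖z'‖ ≤ M) (i j : ι) :
    ‖((Y - z' • (1 : Matrix ι ι ℂ))ᴴ * (Y - z' • (1 : Matrix ι ι ℂ))
      - (Y - z • (1 : Matrix ι ι ℂ))ᴴ * (Y - z • (1 : Matrix ι ι ℂ))) i j‖
      ≤ 2 * (B + M) * ‖z' - z‖ := by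
  have hM : 0 ≤ M := (norm_nonneg _).trans hz
  have e : ((Y - z' • (1 : Matrix ι ι ℂ))ᴴ * (Y - z' • (1 : Matrix ι ι ℂ))
      - (Y - z • (1 : Matrix ι ι ℂ))ᴴ * (Y - z • (1 : Matrix ι ι ℂ)))
      = (star (z' - z) * z' + star z * (z' - z)) • (1 : Matrix ι ι ℂ) - (z' - z) • Yᴴ
        - star (z' - z) • Y := by
    rw [conjTranspose_sub, conjTranspose_sub, conjTranspose_smul, conjTranspose_smul,
      conjTranspose_one]
    simp only [mul_sub, sub_mul, mul_smul_comm, smul_mul_assoc, mul_one, one_mul, sub_smul,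
      add_smul, star_sub, smul_sub, smul_smul]
    module
  rw [e]
  simp only [Matrix.sub_apply, Matrix.smul_apply, conjTranspose_apply, smul_eq_mul]
  have h1 : ‖(star (z' - z) * z' + star z * (z' - z)) * (1 : Matrix ι ι ℂ) i j‖
      ≤ 2 * M * ‖z' - z‖ := by
    have h2 : ‖(1 : Matrix ι ι ℂ) i j‖ ≤ 1 := by
      rw [Matrix.one_apply]; split_ifs <;> simp
    rw [norm_mul]
    refine (mul_le_of_le_one_right (norm_nonneg _) h2).trans ((norm_add_le _ _).trans ?_)
    rw [norm_mul, norm_mul, norm_star, norm_star]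
    nlinarith [norm_nonneg (z' - z)]
  have h3 : ‖(z' - z) * star (Y j i)‖ ≤ B * ‖z' - z‖ := by
    rw [norm_mul, norm_star, mul_comm]
    exact mul_le_mul_of_nonneg_right (hY j i) (norm_nonneg _)
  have h4 : ‖star (z' - z) * Y i j‖ ≤ B * ‖z' - z‖ := by
    rw [norm_mul, norm_star, mul_comm]
    exact mul_le_mul_of_nonneg_right (hY i j) (norm_nonneg _)
  refine (norm_sub_le _ _).trans ?_
  have := norm_sub_le ((star (z' - z) * z' + star z * (z' - z)) * (1 : Matrix ι ι ℂ) i j)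
    ((z' - z) * star (Y j i))
  linarith

theorem norm_trace_gramResolvent_sub_le {Y : Matrix ι ι ℂ} {B M T : ℝ} (hY : ∀ i j, ‖Y i j‖ ≤ B)
    {α α' z z' : ℂ} (hz : ‖z‖ ≤ M) (hz' : ‖z'‖ ≤ M) (hα : 0 < α.im) (hα' : 0 < α'.im)
    (hT : 1 / α.im ≤ T) (hT' : 1 / α'.im ≤ T) :
    ‖(gramResolvent (Y - z • (1 : Matrix ι ι ℂ)) α).trace
      - (gramResolvent (Y - z' • (1 : Matrix ι ι ℂ)) α').trace‖
      ≤ (Fintype.card ι : ℝ) ^ 3 * (T ^ 2 * (2 * (B + M) * ‖z' - z‖ + ‖α' - α‖)) := by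
  set A := Y - z • (1 : Matrix ι ι ℂ)
  set A' := Y - z' • (1 : Matrix ι ι ℂ)
  set R := gramResolvent A α
  set R' := gramResolvent A' α'
  set F : Matrix ι ι ℂ := (A'ᴴ * A' - Aᴴ * A) - (α' - α) • (1 : Matrix ι ι ℂ) with hF
  have h1 : R * (Aᴴ * A - α • (1 : Matrix ι ι ℂ)) = 1 := gramResolvent_mul_gram_sub A hα
  have h2 : (A'ᴴ * A' - α' • (1 : Matrix ι ι ℂ)) * R' = 1 := gram_sub_mul_gramResolvent A' hα'
  have e : R - R' = R * F * R' := by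
    have : F = (A'ᴴ * A' - α' • (1 : Matrix ι ι ℂ)) - (Aᴴ * A - α • (1 : Matrix ι ι ℂ)) := by
      rw [hF, sub_smul]; abel
    rw [this, mul_sub, sub_mul, h1, mul_assoc, h2, mul_one, one_mul]
  have hFn : ∀ i j, ‖F i j‖ ≤ 2 * (B + M) * ‖z' - z‖ + ‖α' - α‖ := by
    intro i j
    rw [hF, Matrix.sub_apply]
    refine (norm_sub_le _ _).trans (add_le_add (norm_gram_shift_sub_le hY hz hz' i j) ?_)
    rw [Matrix.smul_apply, smul_eq_mul, norm_mul]
    refine mul_le_of_le_one_right (norm_nonneg _) ?_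
    rw [Matrix.one_apply]; split_ifs <;> simp
  set f := 2 * (B + M) * ‖z' - z‖ + ‖α' - α‖
  have hT0 : 0 ≤ T := le_trans (by positivity) hT
  rw [← trace_sub, e, trace]
  simp only [diag_apply, mul_apply, Finset.sum_mul]
  calc _ ≤ ∑ _ : ι, ∑ _ : ι, ∑ _ : ι, T ^ 2 * f := by
        refine norm_sum_le_of_le _ fun i _ => norm_sum_le_of_le _ fun j _ =>
          norm_sum_le_of_le _ fun k _ => ?_
        rw [norm_mul, norm_mul]
        have r1 := (norm_gramResolvent_apply_le A hα i k).trans hT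
        have r2 := (norm_gramResolvent_apply_le A' hα' j i).trans hT'
        have r3 := hFn k j
        calc ‖R i k‖ * ‖F k j‖ * ‖R' j i‖ ≤ T * f * T := by
              have := norm_nonneg (F k j)
              gcongr
              exact mul_nonneg hT0 (this.trans r3)
          _ = T ^ 2 * f := by ring
    _ = _ := by
        simp only [Finset.sum_const, Finset.card_univ, nsmul_eq_mul]
        ring

end Perturbation

section Transform

variable {m n : ℕ} {E : Type*} {φ : E → ℂ} {z α : ℂ} [MeasurableSpace E] {μ : Measure E}
  [IsProbabilityMeasure μ] {b : ℝ}

/-- The normalized trace of the resolvent of the Gram matrix of the shifted block cyclic matrix. -/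
noncomputable def cyclicTransform (c : Fin m × Fin n × Fin n → ℂ) (α z : ℂ) : ℂ :=
  ((m * n : ℕ) : ℂ)⁻¹ * (gramResolvent (shiftedCyclic c z) α).trace

theorem shiftedStieltjes_blockCyclic (X : Fin m → Matrix (Fin n) (Fin n) ℂ) (z : ℂ)
    (hα : 0 < α.im) :
    shiftedStieltjes (blockCyclic X) α z = cyclicTransform (fun k => X k.1 k.2.1 k.2.2) α z := by
  rw [shiftedStieltjes_eq _ _ hα, cyclicTransform, Fintype.card_prod, Fintype.card_fin,
    Fintype.card_fin]
  rfl

theorem norm_cyclicTransform_le (hm : 0 < m) (hn : 0 < n) (c : Fin m × Fin n × Fin n → ℂ)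
    (z : ℂ) (hα : 0 < α.im) : ‖cyclicTransform c α z‖ ≤ 1 / α.im := by
  have h : 0 < m * n := Nat.mul_pos hm hn
  rw [cyclicTransform, norm_mul, norm_inv, Complex.norm_natCast,
    inv_mul_le_iff₀ (by exact_mod_cast h)]
  refine (norm_sum_le_of_le _ fun p _ => norm_gramResolvent_diag_le _ hα p).trans ?_
  simp

theorem measurable_cyclicTransform (hφ : Measurable φ) (α z : ℂ) :
    Measurable fun x : Fin m × Fin n × Fin n → E => cyclicTransform (φ ∘ x) α z :=
  (Finset.measurable_sum _ fun p _ => measurable_gramResolvent_apply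
    (measurable_shiftedCyclic hφ z) α p p).const_mul _

theorem norm_cyclicTransform_sub_le (hm : 0 < m) (hn : 0 < n)
    {c : Fin m × Fin n × Fin n → ℂ} {B M T : ℝ} (hc : ∀ k, ‖c k‖ ≤ B)
    {α α' z z' : ℂ} (hz : ‖z‖ ≤ M) (hz' : ‖z'‖ ≤ M) (hα : 0 < α.im) (hα' : 0 < α'.im)
    (hT : 1 / α.im ≤ T) (hT' : 1 / α'.im ≤ T) :
    ‖cyclicTransform c α z - cyclicTransform c α' z'‖
      ≤ (m * n : ℝ) ^ 2 * (T ^ 2 * (2 * (B + M) * ‖z' - z‖ + ‖α' - α‖)) := by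
  have h : (0 : ℝ) < m * n := by positivity
  have hB : 0 ≤ B := (norm_nonneg _).trans (hc (⟨0, hm⟩, ⟨0, hn⟩, ⟨0, hn⟩))
  have hY : ∀ p q, ‖blockCyclic (fun k => of fun i j => c (k, i, j)) p q‖ ≤ B := by
    intro p q
    simp only [blockCyclic, of_apply]
    split_ifs
    · exact hc _
    · simpa using hB
  have := norm_trace_gramResolvent_sub_le hY hz hz' hα hα' hT hT'
  rw [cyclicTransform, cyclicTransform, ← mul_sub, norm_mul, norm_inv, Complex.norm_natCast,
    inv_mul_le_iff₀ (by exact_mod_cast h)]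
  refine this.trans_eq ?_
  simp only [Fintype.card_prod, Fintype.card_fin]
  push_cast
  ring

theorem norm_cyclicTransform_diff_le (hα : 0 < α.im) {p : Fin m × Fin n}
    {x x' : Fin m × Fin n × Fin n → E} (h : ∀ k, entryRow k ≠ p → x k = x' k) :
    ‖cyclicTransform (φ ∘ x) α z - cyclicTransform (φ ∘ x') α z‖
      ≤ 6 / α.im / (m * n : ℕ) := by
  have h1 := norm_sum_diag_sub_le (φ := φ) (z := z) hα h (d := fun _ => 1) (by simp)
  rw [cyclicTransform, cyclicTransform, ← mul_sub, norm_mul, norm_inv, Complex.norm_natCast,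
    inv_mul_eq_div, trace, trace, ← Finset.sum_sub_distrib]
  gcongr
  simpa using h1

theorem measure_norm_sub_ge_le_of_boundedDifferences {f : (Fin m × Fin n × Fin n → E) → ℂ}
    {B c ε : ℝ} {V : NNReal} (hf : Measurable f) (hB : ∀ x, ‖f x‖ ≤ B)
    (hc : ∀ p x x', (∀ k, entryRow k ≠ p → x k = x' k) → ‖f x - f x'‖ ≤ c) (hε : 0 ≤ ε)
    (hV : (m * n : ℕ) * c ^ 2 ≤ V) :
    (Measure.pi fun _ : Fin m × Fin n × Fin n => μ).real {x | 2 * ε <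
      ‖f x - ∫ y, f y ∂(Measure.pi fun _ : Fin m × Fin n × Fin n => μ)‖}
      ≤ 4 * Real.exp (-ε ^ 2 / (2 * V)) := by
  set π := (Measure.pi fun _ : Fin m × Fin n × Fin n => μ)
  have hi : Integrable f π := integrable_of_measurable_bound_complex hf hB
  have hV' : Fintype.card (Fin m × Fin n) * c ^ 2 ≤ (V : ℝ) := by
    simpa using hV
  have h1 := hasSubgaussianMGF_of_boundedDifferences μ (f := fun x => (f x).re)
    (Complex.measurable_re.comp hf) (B := B) (fun x => (Complex.abs_re_le_norm _).trans (hB x))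
    entryRow (fun p x x' h => by
      rw [← Complex.sub_re]; exact (Complex.abs_re_le_norm _).trans (hc p x x' h)) hV'
  have h2 := hasSubgaussianMGF_of_boundedDifferences μ (f := fun x => (f x).im)
    (Complex.measurable_im.comp hf) (B := B) (fun x => (Complex.abs_im_le_norm _).trans (hB x))
    entryRow (fun p x x' h => by
      rw [← Complex.sub_im]; exact (Complex.abs_im_le_norm _).trans (hc p x x' h)) hV'
  have er : ∫ x, (f x).re ∂π = (∫ x, f x ∂π).re := integral_re hi
  have ei : ∫ x, (f x).im ∂π = (∫ x, f x ∂π).im := integral_im hi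
  have a1 := h1.measure_ge_le hε
  have a2 := h1.neg.measure_ge_le hε
  have a3 := h2.measure_ge_le hε
  have a4 := h2.neg.measure_ge_le hε
  set X := fun x => (f x).re - ∫ y, (f y).re ∂π with hX
  set X' := fun x => (f x).im - ∫ y, (f y).im ∂π with hX'
  have hsub : {x | 2 * ε < ‖f x - ∫ y, f y ∂π‖} ⊆
      (({x | ε ≤ X x} ∪ {x | ε ≤ (-X) x}) ∪ ({x | ε ≤ X' x} ∪ {x | ε ≤ (-X') x})) := by
    intro x hx
    simp only [Set.mem_ofPred_eq] at hx
    have h3 := Complex.norm_le_abs_re_add_abs_im (f x - ∫ y, f y ∂π)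
    rw [Complex.sub_re, Complex.sub_im, ← er, ← ei] at h3
    change _ ≤ |X x| + |X' x| at h3
    simp only [Set.mem_union, Set.mem_ofPred_eq, Pi.neg_apply]
    by_contra! hcon
    obtain ⟨⟨c1, c2⟩, c3, c4⟩ := hcon
    have d1 : |X x| ≤ ε := abs_le.mpr ⟨by linarith, by linarith⟩
    have d2 : |X' x| ≤ ε := abs_le.mpr ⟨by linarith, by linarith⟩
    linarith
  have u1 := measureReal_union_le (μ := π) {x | ε ≤ X x} {x | ε ≤ (-X) x}
  have u2 := measureReal_union_le (μ := π) {x | ε ≤ X' x} {x | ε ≤ (-X') x}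
  have u3 := measureReal_union_le (μ := π) ({x | ε ≤ X x} ∪ {x | ε ≤ (-X) x})
    ({x | ε ≤ X' x} ∪ {x | ε ≤ (-X') x})
  have u4 := measureReal_mono (μ := π) hsub
  linarith

/-- Concentration of the Stieltjes transform at a point. -/
theorem measure_norm_cyclicTransform_sub_le (hm : 0 < m) (hn : 0 < n) (hφ : Measurable φ)
    (hα : 0 < α.im) {y ε : ℝ} (hy : 0 < y) (hyα : y ≤ α.im) (hε : 0 ≤ ε) :
    (Measure.pi fun _ : Fin m × Fin n × Fin n => μ).real {x | 2 * ε <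
      ‖cyclicTransform (φ ∘ x) α z - meanTransform m n μ φ α z‖}
      ≤ 4 * Real.exp (-(ε ^ 2 * n * y ^ 2) / 72) := by
  have hn' : (0 : ℝ) < n := by exact_mod_cast hn
  have hm' : (1 : ℝ) ≤ m := by exact_mod_cast hm
  set V : NNReal := ⟨36 / (n * y ^ 2), by positivity⟩
  have hV : (m * n : ℕ) * (6 / α.im / (m * n : ℕ)) ^ 2 ≤ (V : ℝ) := by
    change _ ≤ 36 / (n * y ^ 2)
    have e : ((m * n : ℕ) : ℝ) * (6 / α.im / (m * n : ℕ)) ^ 2 = 36 / (m * (n * α.im ^ 2)) := by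
      push_cast
      field_simp
      norm_num
    rw [e]
    refine div_le_div_of_nonneg_left (by norm_num) (by positivity) ?_
    have h1 : n * y ^ 2 ≤ n * α.im ^ 2 := by gcongr
    have h2 : (0 : ℝ) ≤ n * α.im ^ 2 := by positivity
    nlinarith
  have := measure_norm_sub_ge_le_of_boundedDifferences (μ := μ) (V := V) (ε := ε)
    (measurable_cyclicTransform (m := m) (n := n) hφ α z)
    (fun x => norm_cyclicTransform_le hm hn _ z hα)
    (fun p x x' h => norm_cyclicTransform_diff_le hα h) hε hV
  refine this.trans_eq ?_
  congr 2
  change -ε ^ 2 / (2 * (36 / (n * y ^ 2))) = _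
  field_simp
  ring

end Transform

section Rates

variable {m n : ℕ} {E : Type*} {φ : E → ℂ} {z α : ℂ} [MeasurableSpace E] {μ : Measure E}
  [IsProbabilityMeasure μ]

/-- The constant in the bound for the expected Stieltjes transform. -/
noncomputable def meanConstant (m : ℕ) (M N K : ℝ) : ℝ :=
  2 * (Real.sqrt (3 * (K ^ 2 + 1)) + 4 + 48 * m + 2 * |M|) * (1 + M ^ 2 * (|N| + 1))

theorem meanConstant_nonneg (m : ℕ) (M N K : ℝ) : 0 ≤ meanConstant m M N K := by
  unfold meanConstant; positivity

theorem sqrt_quadForm_bound_le {K D T τ : ℝ} (hD : 1 ≤ D) (hτ0 : 0 ≤ τ) (hτ : τ ≤ T)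
    (hn : 0 < n) :
    Real.sqrt (3 * ((K * D / Real.sqrt n) ^ 2 * (n : ℝ)⁻¹ + ((n : ℝ)⁻¹) ^ 2) * (n * τ ^ 2))
      ≤ Real.sqrt (3 * (K ^ 2 + 1)) * (T * (1 / Real.sqrt n) * D) := by
  have hn' : (0 : ℝ) < n := by exact_mod_cast hn
  have hT0 : 0 ≤ T := hτ0.trans hτ
  have e1 : (K * D / Real.sqrt n) ^ 2 = K ^ 2 * D ^ 2 * (n : ℝ)⁻¹ := by
    rw [div_pow, Real.sq_sqrt hn'.le]; ring
  have e2 : (n : ℝ) * (n : ℝ)⁻¹ = 1 := mul_inv_cancel₀ hn'.ne'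
  have e : 3 * ((K * D / Real.sqrt n) ^ 2 * (n : ℝ)⁻¹ + ((n : ℝ)⁻¹) ^ 2) * (n * τ ^ 2)
      = 3 * (K ^ 2 * D ^ 2 + 1) * (n : ℝ)⁻¹ * τ ^ 2 := by
    rw [e1]
    linear_combination (3 * (K ^ 2 * D ^ 2 + 1) * (n : ℝ)⁻¹ * τ ^ 2) * e2
  have e3 : (T * (1 / Real.sqrt n) * D) ^ 2 = T ^ 2 * (n : ℝ)⁻¹ * D ^ 2 := by
    rw [mul_pow, mul_pow, div_pow, Real.sq_sqrt hn'.le]; ring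
  have h1 : K ^ 2 * D ^ 2 + 1 ≤ (K ^ 2 + 1) * D ^ 2 := by nlinarith
  have h2 : τ ^ 2 ≤ T ^ 2 := by gcongr
  have hle : 3 * (K ^ 2 * D ^ 2 + 1) * (n : ℝ)⁻¹ * τ ^ 2
      ≤ 3 * (K ^ 2 + 1) * (T * (1 / Real.sqrt n) * D) ^ 2 := by
    rw [e3]
    calc 3 * (K ^ 2 * D ^ 2 + 1) * (n : ℝ)⁻¹ * τ ^ 2
        ≤ 3 * ((K ^ 2 + 1) * D ^ 2) * (n : ℝ)⁻¹ * T ^ 2 := by gcongr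
      _ = _ := by ring
  rw [e]
  refine (Real.sqrt_le_sqrt hle).trans_eq ?_
  rw [Real.sqrt_mul (by positivity), Real.sqrt_sq (by positivity)]

theorem norm_mul_inv_im_sq_le {N T : ℝ} (hα : 0 < α.im) (hT : 1 ≤ T) (hτ : 1 / α.im ≤ T)
    (hre : |α.re| ≤ N) : ‖α‖ * (1 / α.im) ^ 2 ≤ (|N| + 1) * T ^ 2 := by
  set τ := 1 / α.im with hτdef
  have hτ0 : 0 < τ := by positivity
  have h1 : ‖α‖ ≤ |N| + α.im := by
    have := Complex.norm_le_abs_re_add_abs_im α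
    rw [abs_of_pos hα] at this
    linarith [le_abs_self N]
  have h2 : α.im * τ = 1 := by rw [hτdef]; field_simp
  have h3 : τ ≤ T ^ 2 := hτ.trans (by nlinarith)
  calc ‖α‖ * τ ^ 2 ≤ (|N| + α.im) * τ ^ 2 := by gcongr
    _ = |N| * τ ^ 2 + τ := by linear_combination τ * h2
    _ ≤ |N| * T ^ 2 + T ^ 2 := by gcongr
    _ = _ := by ring

theorem one_add_mul_mul_add_le {τ T W L c d : ℝ} (hτ0 : 0 ≤ τ) (hτ : τ ≤ T) (hT : 1 ≤ T) (hW : 0 ≤ W)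
    (hL : 0 ≤ L) (hc : 0 ≤ c) (hcd : c ≤ d * T ^ 2) :
    (1 + τ) * (τ * (L * W + c * (L * W))) ≤ 2 * L * (1 + d) * (T ^ 4 * W) := by
  have hT2 : 1 ≤ T ^ 2 := one_le_pow₀ hT
  have h1 : 1 + c ≤ (1 + d) * T ^ 2 := by linarith
  have h2 : L * W + c * (L * W) ≤ L * W * ((1 + d) * T ^ 2) := by
    calc _ = L * W * (1 + c) := by ring
      _ ≤ _ := by gcongr
  have h3 : 0 ≤ L * W + c * (L * W) := by positivity
  have h4 : 1 + τ ≤ 2 * T := by linarith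
  have hT0 : 0 ≤ T := by linarith
  calc (1 + τ) * (τ * (L * W + c * (L * W)))
      ≤ 2 * T * (T * (L * W * ((1 + d) * T ^ 2))) := by gcongr
    _ = _ := by ring

theorem norm_cubicDefect_meanTransform_le_rate {M N K D T : ℝ} (hD : 1 ≤ D) (hT : 1 ≤ T)
    (h : IsBoundedCentred μ φ (K * D / Real.sqrt n) ((n : ℝ)⁻¹)) (hm : 1 < m) (hn : 0 < n)
    (hα : 0 < α.im) (hτ : 1 / α.im ≤ T) (hz : ‖z‖ ≤ M) (hre : |α.re| ≤ N) :
    ‖cubicDefect α z (meanTransform m n μ φ α z)‖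
      ≤ meanConstant m M N K * (T ^ 5 * D / Real.sqrt n) := by
  have hn' : (0 : ℝ) < n := by exact_mod_cast hn
  have hn1 : (1 : ℝ) ≤ n := by exact_mod_cast hn
  have hm' : (1 : ℝ) ≤ m := by exact_mod_cast hm.le
  have hτ0 : 0 < 1 / α.im := by positivity
  have hατ := norm_mul_inv_im_sq_le hα hT hτ hre
  have q := sqrt_quadForm_bound_le (n := n) (K := K) hD hτ0.le hτ hn
  have hu0 : 0 < 1 / Real.sqrt n := by positivity
  have hu2 : (1 / Real.sqrt n) ^ 2 = (n : ℝ)⁻¹ := by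
    rw [div_pow, one_pow, Real.sq_sqrt hn'.le, one_div]
  have hu1 : 1 / Real.sqrt n ≤ 1 := by
    rw [div_le_one (by positivity)]
    exact Real.one_le_sqrt.mpr hn1
  have hdiv : ∀ k : ℝ, k / α.im / n = k * (1 / α.im * (1 / Real.sqrt n) ^ 2) := fun k => by
    rw [hu2]; ring
  have key := fun s e => norm_cubicDefect_meanTransform_le (z := z) (s := s) (e₁ := e) (e₂ := e)
    h hm hn hα
  rw [hdiv 1, hdiv 4, hdiv 6, one_mul, ← hu2] at key
  rw [← hu2] at q
  have e5 : T ^ 5 * D / Real.sqrt n = T ^ 4 * (T * (1 / Real.sqrt n) * D) := by ring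
  rw [e5]
  generalize 1 / Real.sqrt n = u at *
  generalize 1 / α.im = τ at *
  have hT0 : 0 < T := by linarith
  set W := T * u * D with hW
  have hW0 : 0 < W := by positivity
  have hTu : τ * u ≤ W := by
    calc τ * u ≤ T * u := by gcongr
      _ ≤ T * u * D := le_mul_of_one_le_right (by positivity) hD
  have hTu2 : τ * u ^ 2 ≤ W := by
    calc τ * u ^ 2 = τ * u * u := by ring
      _ ≤ τ * u := mul_le_of_le_one_right (by positivity) hu1
      _ ≤ W := hTu
  clear_value W
  have hM' : ‖z‖ ≤ |M| := hz.trans (le_abs_self M)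
  have q1 : Real.sqrt (u ^ 2 * τ ^ 2) ≤ W := by
    rw [← mul_pow, Real.sqrt_sq (by positivity), mul_comm]
    exact hTu
  have q2 : ‖z‖ * Real.sqrt (u ^ 2 * τ ^ 2) ≤ |M| * W :=
    mul_le_mul hM' q1 (Real.sqrt_nonneg _) (abs_nonneg M)
  have hs2 : (m * n : ℕ) * (6 * (τ * u ^ 2)) ^ 2 ≤ (6 * m * (τ * u)) ^ 2 := by
    have e1 : (n : ℝ) * u ^ 2 = 1 := by rw [hu2]; field_simp
    have e : ((m * n : ℕ) : ℝ) * (6 * (τ * u ^ 2)) ^ 2 = m * (36 * (τ ^ 2 * u ^ 2)) := by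
      push_cast
      linear_combination (m * 36 * τ ^ 2 * u ^ 2) * e1
    have h0 : (0 : ℝ) ≤ 36 * (τ ^ 2 * u ^ 2) := by positivity
    have h1 : (m : ℝ) ≤ m ^ 2 := by nlinarith
    calc _ = m * (36 * (τ ^ 2 * u ^ 2)) := e
      _ ≤ m ^ 2 * (36 * (τ ^ 2 * u ^ 2)) := by gcongr
      _ = _ := by ring
  have hsW : 8 * (6 * m * (τ * u)) ≤ 48 * m * W := by
    calc 8 * (6 * m * (τ * u)) = 48 * m * (τ * u) := by ring
      _ ≤ _ := by gcongr
  have hMW : 0 ≤ |M| * W := by positivity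
  have hmW : 0 ≤ m * W := by positivity
  refine (key (6 * m * (τ * u)) ((Real.sqrt (3 * (K ^ 2 + 1)) + 4 + 48 * m + 2 * |M|) * W)
    (by positivity) hs2 (by linarith) (by linarith)).trans ?_
  have hz2 : ‖z‖ ^ 2 ≤ M ^ 2 := by gcongr
  refine one_add_mul_mul_add_le hτ0.le hτ hT hW0.le (by positivity) (by positivity) ?_
  calc ‖z‖ ^ 2 * (‖α‖ * τ ^ 2) ≤ M ^ 2 * ((|N| + 1) * T ^ 2) := by gcongr
    _ = _ := by ring

end Rates

section Net

variable {m n : ℕ} {E : Type*} {φ : E → ℂ} [MeasurableSpace E] {μ : Measure E}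
  [IsProbabilityMeasure μ]

/-- The complex number with the given coordinates in units of `n⁻⁴`. -/
noncomputable def gridPoint (n : ℕ) (k : ℤ × ℤ) : ℂ := ⟨k.1 / (n : ℝ) ^ 4, k.2 / (n : ℝ) ^ 4⟩

/-- The square grid of mesh `n⁻⁴` and side `2 n²`. -/
noncomputable def grid (n : ℕ) : Finset (ℤ × ℤ) :=
  Finset.Icc (-(n : ℤ) ^ 6) ((n : ℤ) ^ 6) ×ˢ Finset.Icc (-(n : ℤ) ^ 6) ((n : ℤ) ^ 6)

theorem card_grid (n : ℕ) : ((grid n).card : ℝ) = (2 * (n : ℝ) ^ 6 + 1) ^ 2 := by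
  have h : ((Finset.Icc (-(n : ℤ) ^ 6) ((n : ℤ) ^ 6)).card : ℝ) = 2 * (n : ℝ) ^ 6 + 1 := by
    rw [Int.card_Icc]
    have : (((n : ℤ) ^ 6 + 1 - -(n : ℤ) ^ 6).toNat : ℤ) = 2 * (n : ℤ) ^ 6 + 1 := by
      have h0 : 0 ≤ (n : ℤ) ^ 6 := by positivity
      rw [Int.toNat_of_nonneg (by linarith)]
      ring
    exact_mod_cast this
  rw [grid, Finset.card_product, Nat.cast_mul, h]
  ring

theorem mem_Icc_of_abs_sub_le (hn : 2 ≤ n) {t : ℝ} {k : ℤ}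
    (hk : |(k : ℝ) / (n : ℝ) ^ 4 - t| ≤ 1 / (n : ℝ) ^ 4) (ht : |t| + 1 ≤ (n : ℝ) ^ 2) :
    k ∈ Finset.Icc (-(n : ℤ) ^ 6) ((n : ℤ) ^ 6) := by
  have hn' : (0 : ℝ) < n := by positivity
  have hn1 : (1 : ℝ) ≤ (n : ℝ) ^ 4 := one_le_pow₀ (by exact_mod_cast (by omega : 1 ≤ n))
  have h1 : |(k : ℝ) / (n : ℝ) ^ 4| ≤ (n : ℝ) ^ 2 := by
    have h2 := abs_sub_abs_le_abs_sub ((k : ℝ) / (n : ℝ) ^ 4) t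
    have h3 : 1 / (n : ℝ) ^ 4 ≤ 1 := div_le_one_of_le₀ hn1 (by positivity)
    linarith
  rw [abs_div, abs_of_pos (by positivity : (0 : ℝ) < (n : ℝ) ^ 4), div_le_iff₀ (by positivity)] at h1
  have h4 : |(k : ℝ)| ≤ (n : ℝ) ^ 6 := h1.trans_eq (by ring)
  have h5 : |k| ≤ (n : ℤ) ^ 6 := by exact_mod_cast h4
  rw [Finset.mem_Icc]
  exact abs_le.mp h5

theorem norm_gridPoint_sub_le {w : ℂ} {k : ℤ × ℤ}
    (h1 : |(k.1 : ℝ) / (n : ℝ) ^ 4 - w.re| ≤ 1 / (n : ℝ) ^ 4)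
    (h2 : |(k.2 : ℝ) / (n : ℝ) ^ 4 - w.im| ≤ 1 / (n : ℝ) ^ 4) :
    ‖gridPoint n k - w‖ ≤ 2 / (n : ℝ) ^ 4 := by
  refine (Complex.norm_le_abs_re_add_abs_im _).trans ?_
  rw [Complex.sub_re, Complex.sub_im]
  have : 2 / (n : ℝ) ^ 4 = 1 / (n : ℝ) ^ 4 + 1 / (n : ℝ) ^ 4 := by ring
  rw [this]
  exact add_le_add h1 h2

/-- Every point of the square has a grid point nearby whose imaginary part is not smaller. -/
theorem exists_grid (hn : 2 ≤ n) {w : ℂ} (hre : |w.re| + 1 ≤ (n : ℝ) ^ 2)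
    (him : |w.im| + 1 ≤ (n : ℝ) ^ 2) :
    ∃ k ∈ grid n, ‖gridPoint n k - w‖ ≤ 2 / (n : ℝ) ^ 4 ∧ w.im ≤ (gridPoint n k).im := by
  have hn4 : (0 : ℝ) < (n : ℝ) ^ 4 := by positivity
  have hdiv : ∀ (t : ℝ), |(⌈t * (n : ℝ) ^ 4⌉ : ℝ) / (n : ℝ) ^ 4 - t| ≤ 1 / (n : ℝ) ^ 4 := by
    intro t
    have e : (⌈t * (n : ℝ) ^ 4⌉ : ℝ) / (n : ℝ) ^ 4 - t
        = ((⌈t * (n : ℝ) ^ 4⌉ : ℝ) - t * (n : ℝ) ^ 4) / (n : ℝ) ^ 4 := by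
      field_simp
    rw [e, abs_div, abs_of_pos hn4]
    gcongr
    rw [abs_le]
    constructor <;> linarith [Int.le_ceil (t * (n : ℝ) ^ 4), Int.ceil_lt_add_one (t * (n : ℝ) ^ 4)]
  refine ⟨(⌈w.re * (n : ℝ) ^ 4⌉, ⌈w.im * (n : ℝ) ^ 4⌉), ?_, ?_, ?_⟩
  · rw [grid, Finset.mem_product]
    exact ⟨mem_Icc_of_abs_sub_le hn (hdiv _) hre, mem_Icc_of_abs_sub_le hn (hdiv _) him⟩
  · exact norm_gridPoint_sub_le (hdiv _) (hdiv _)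
  · simp only [gridPoint]
    rw [le_div_iff₀ hn4]
    exact Int.le_ceil _

/-- The event that the Stieltjes transform deviates from its mean at some point. -/
def deviationSet (m n : ℕ) (μ : Measure E) (φ : E → ℂ) (M N y ε : ℝ) :
    Set (Fin m × Fin n × Fin n → E) :=
  {x | ∃ α z : ℂ, ‖z‖ ≤ M ∧ |α.re| ≤ N ∧ y ≤ α.im ∧
    3 * ε < ‖cyclicTransform (φ ∘ x) α z - meanTransform m n μ φ α z‖}

theorem norm_meanTransform_sub_le (hm : 0 < m) (hn : 0 < n) (hφ : Measurable φ) {B M T : ℝ}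
    (hB : ∀ u, ‖φ u‖ ≤ B) {α α' z z' : ℂ} (hz : ‖z‖ ≤ M) (hz' : ‖z'‖ ≤ M) (hα : 0 < α.im)
    (hα' : 0 < α'.im) (hT : 1 / α.im ≤ T) (hT' : 1 / α'.im ≤ T) :
    ‖meanTransform m n μ φ α z - meanTransform m n μ φ α' z'‖
      ≤ (m * n : ℝ) ^ 2 * (T ^ 2 * (2 * (B + M) * ‖z' - z‖ + ‖α' - α‖)) := by
  have hi : ∀ {α z : ℂ}, 0 < α.im → Integrable (fun x => cyclicTransform (φ ∘ x) α z)
      (Measure.pi fun _ : Fin m × Fin n × Fin n => μ) := fun {α z} h =>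
    integrable_of_measurable_bound_complex (measurable_cyclicTransform hφ α z)
      fun x => norm_cyclicTransform_le hm hn _ z h
  have e : ∀ α z : ℂ, meanTransform m n μ φ α z =
      ∫ x, cyclicTransform (φ ∘ x) α z ∂(Measure.pi fun _ : Fin m × Fin n × Fin n => μ) :=
    fun _ _ => rfl
  rw [e, e, ← integral_sub (hi hα) (hi hα')]
  have hb := fun x : Fin m × Fin n × Fin n → E =>
    norm_cyclicTransform_sub_le hm hn (c := φ ∘ x) (fun k => hB (x k)) hz hz' hα hα' hT hT'
  have := norm_integral_le_of_norm_le_const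
    (μ := Measure.pi fun _ : Fin m × Fin n × Fin n => μ) (Eventually.of_forall hb)
  rwa [probReal_univ, mul_one] at this

theorem deviationSet_subset (hm : 0 < m) (hφ : Measurable φ) {B M N y ε : ℝ}
    (hB : ∀ u, ‖φ u‖ ≤ B) (hB0 : 0 ≤ B) (hn : 2 ≤ n) (hN : |N| + 1 ≤ n) (hM : |M| + 1 ≤ n)
    (hy : 0 < y) (hy2 : 1 / y ^ 2 ≤ n) (hε1 : 1 / (n : ℝ) ≤ ε)
    (hε2 : (m : ℝ) ^ 2 * (8 * (B + |M| + 2) + 4) / n ≤ ε) :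
    deviationSet m n μ φ M N y ε ⊆
      ⋃ k ∈ (grid n ×ˢ grid n).filter (fun k => y ≤ (gridPoint n k.1).im),
        {x | 2 * ε < ‖cyclicTransform (φ ∘ x) (gridPoint n k.1) (gridPoint n k.2)
          - meanTransform m n μ φ (gridPoint n k.1) (gridPoint n k.2)‖} := by
  rintro x ⟨α, z, hz, hre, him, hx⟩
  have hn' : (0 : ℝ) < n := by positivity
  have hn2 : (2 : ℝ) ≤ n := by exact_mod_cast hn
  have hα : 0 < α.im := hy.trans_le him
  have hnsq : (n : ℝ) + n ≤ (n : ℝ) ^ 2 := by nlinarith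
  have hMz : ‖z‖ ≤ |M| := hz.trans (le_abs_self M)
  by_cases hbig : α.im ≤ n
  · obtain ⟨k, hk, hkα, hkim⟩ := exists_grid hn (w := α)
      (by linarith [le_abs_self N]) (by rw [abs_of_pos hα]; linarith)
    obtain ⟨l, hl, hlz, -⟩ := exists_grid hn (w := z)
      (by linarith [Complex.abs_re_le_norm z]) (by linarith [Complex.abs_im_le_norm z])
    set α' := gridPoint n k
    set z' := gridPoint n l
    have hα' : y ≤ α'.im := him.trans hkim
    have hz1 : 2 / (n : ℝ) ^ 4 ≤ 2 :=
      div_le_self (by norm_num) (one_le_pow₀ (by linarith))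
    have hz' : ‖z'‖ ≤ |M| + 2 := by
      have := norm_sub_norm_le z' z
      linarith
    have hTα : 1 / α.im ≤ 1 / y := one_div_le_one_div_of_le hy him
    have hTα' : 1 / α'.im ≤ 1 / y := one_div_le_one_div_of_le hy hα'
    have lip : (m * n : ℝ) ^ 2 * ((1 / y) ^ 2 * (2 * (B + (|M| + 2)) * ‖z' - z‖ + ‖α' - α‖))
        ≤ ε / 2 := by
      have h1 : 2 * (B + (|M| + 2)) * ‖z' - z‖ + ‖α' - α‖
          ≤ (4 * (B + |M| + 2) + 2) / (n : ℝ) ^ 4 := by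
        calc _ ≤ 2 * (B + (|M| + 2)) * (2 / (n : ℝ) ^ 4) + 2 / (n : ℝ) ^ 4 := by gcongr
          _ = _ := by ring
      have h2 : (1 / y) ^ 2 ≤ n := by rw [div_pow, one_pow]; exact hy2
      calc _ ≤ (m * n : ℝ) ^ 2 * (n * ((4 * (B + |M| + 2) + 2) / (n : ℝ) ^ 4)) := by gcongr
        _ = (m : ℝ) ^ 2 * (8 * (B + |M| + 2) + 4) / n / 2 := by field_simp; ring
        _ ≤ ε / 2 := by gcongr
    have l1 := (norm_cyclicTransform_sub_le hm (by omega) (fun k => hB (x k))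
      (hMz.trans (by linarith)) hz' hα (hy.trans_le hα') hTα hTα').trans lip
    have l2 := (norm_meanTransform_sub_le (μ := μ) hm (by omega : 0 < n) hφ hB
      (hMz.trans (by linarith)) hz' hα (hy.trans_le hα') hTα hTα').trans lip
    simp only [Set.mem_iUnion]
    refine ⟨(k, l), ?_, ?_⟩
    · rw [Finset.mem_filter, Finset.mem_product]
      exact ⟨⟨hk, hl⟩, hα'⟩
    · change 2 * ε < ‖cyclicTransform (φ ∘ x) α' z' - meanTransform m n μ φ α' z'‖
      by_contra! hcon
      have e : cyclicTransform (φ ∘ x) α z - meanTransform m n μ φ α z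
          = (cyclicTransform (φ ∘ x) α z - cyclicTransform (φ ∘ x) α' z')
            + (cyclicTransform (φ ∘ x) α' z' - meanTransform m n μ φ α' z')
            - (meanTransform m n μ φ α z - meanTransform m n μ φ α' z') := by ring
      rw [e] at hx
      have t1 := norm_sub_le ((cyclicTransform (φ ∘ x) α z - cyclicTransform (φ ∘ x) α' z')
            + (cyclicTransform (φ ∘ x) α' z' - meanTransform m n μ φ α' z'))
            (meanTransform m n μ φ α z - meanTransform m n μ φ α' z')
      have t2 := norm_add_le (cyclicTransform (φ ∘ x) α z - cyclicTransform (φ ∘ x) α' z')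
            (cyclicTransform (φ ∘ x) α' z' - meanTransform m n μ φ α' z')
      have l1' : ‖cyclicTransform (φ ∘ x) α z - cyclicTransform (φ ∘ x) α' z'‖ ≤ ε / 2 := l1
      linarith
  · exfalso
    push Not at hbig
    have h1 := norm_cyclicTransform_le hm (by omega : 0 < n) (φ ∘ x) z hα
    have h2 := norm_meanTransform_le (μ := μ) (z := z) hm hφ (by omega : 0 < n) hα
    have h3 : 1 / α.im ≤ 1 / n := one_div_le_one_div_of_le hn' hbig.le
    have h4 := norm_sub_le (cyclicTransform (φ ∘ x) α z) (meanTransform m n μ φ α z)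
    have h5 : (0 : ℝ) < 1 / n := by positivity
    linarith

theorem measure_deviationSet_le (hm : 0 < m) (hφ : Measurable φ) {B M N y ε : ℝ}
    (hB : ∀ u, ‖φ u‖ ≤ B) (hB0 : 0 ≤ B) (hn : 2 ≤ n) (hN : |N| + 1 ≤ n) (hM : |M| + 1 ≤ n)
    (hy : 0 < y) (hy2 : 1 / y ^ 2 ≤ n) (hε1 : 1 / (n : ℝ) ≤ ε)
    (hε2 : (m : ℝ) ^ 2 * (8 * (B + |M| + 2) + 4) / n ≤ ε) :
    (Measure.pi fun _ : Fin m × Fin n × Fin n => μ) (deviationSet m n μ φ M N y ε) ≤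
      ENNReal.ofReal ((2 * (n : ℝ) ^ 6 + 1) ^ 4 *
        (4 * Real.exp (-(ε ^ 2 * n * y ^ 2) / 72))) := by
  set π := (Measure.pi fun _ : Fin m × Fin n × Fin n => μ)
  have hn' : (0 : ℝ) < n := by positivity
  have hε : 0 ≤ ε := le_trans (by positivity) hε1
  rw [← ENNReal.ofReal_toReal (measure_ne_top π (deviationSet m n μ φ M N y ε))]
  refine ENNReal.ofReal_le_ofReal ?_
  change π.real _ ≤ _
  refine (measureReal_mono (deviationSet_subset hm hφ hB hB0 hn hN hM hy hy2 hε1 hε2)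
    (measure_ne_top _ _)).trans ?_
  refine (measureReal_biUnion_finset_le _ _).trans ?_
  calc _ ≤ ∑ _ ∈ (grid n ×ˢ grid n).filter (fun k => y ≤ (gridPoint n k.1).im),
        (4 * Real.exp (-(ε ^ 2 * n * y ^ 2) / 72)) := by
        refine Finset.sum_le_sum fun k hk => ?_
        have hk' := (Finset.mem_filter.mp hk).2
        exact measure_norm_cyclicTransform_sub_le hm (by omega) hφ (hy.trans_le hk') hy hk' hε
    _ ≤ ∑ _ ∈ grid n ×ˢ grid n, (4 * Real.exp (-(ε ^ 2 * n * y ^ 2) / 72)) :=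
        Finset.sum_le_sum_of_subset_of_nonneg (Finset.filter_subset _ _)
          fun _ _ _ => by positivity
    _ = _ := by
        rw [Finset.sum_const, nsmul_eq_mul, Finset.card_product, Nat.cast_mul, card_grid]
        ring

end Net

section Ensemble

/-- Truncation at level `b`. -/
noncomputable def truncate (b : ℝ) (u : ℂ) : ℂ := if ‖u‖ ≤ b then u else 0

theorem measurable_truncate (b : ℝ) : Measurable (truncate b) :=
  Measurable.ite (measurableSet_le measurable_norm measurable_const) measurable_id measurable_const

theorem norm_truncate_le {b : ℝ} (hb : 0 ≤ b) (u : ℂ) : ‖truncate b u‖ ≤ b := by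
  unfold truncate
  split_ifs with h
  · exact h
  · simpa using hb

variable {Ω : Type*} [MeasurableSpace Ω] {P : Measure Ω} [IsProbabilityMeasure P] {m n : ℕ}
  {X : Fin m → Ω → Matrix (Fin n) (Fin n) ℂ} {ξ : Ω → ℂ} {b : ℝ}

/-- The array of all entries of the matrices. -/
def entryArray (X : Fin m → Ω → Matrix (Fin n) (Fin n) ℂ) (ω : Ω) :
    Fin m × Fin n × Fin n → ℂ := fun k => X k.1 ω k.2.1 k.2.2

namespace IsBoundedEnsemble

theorem bound_nonneg (h : IsBoundedEnsemble P X ξ b) : 0 ≤ b := by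
  obtain ⟨ω, hω⟩ := h.bounded.exists
  exact (norm_nonneg _).trans hω

theorem aemeasurable_scaled (h : IsBoundedEnsemble P X ξ b) (hm : 0 < m) (hn : 0 < n) :
    AEMeasurable (fun ω => ξ ω / ((Real.sqrt (n : ℝ) : ℝ) : ℂ)) P :=
  (h.identDistrib ⟨0, hm⟩ ⟨0, hn⟩ ⟨0, hn⟩).aemeasurable_snd

theorem truncate_scaled_ae (h : IsBoundedEnsemble P X ξ b) :
    ∀ᵐ ω ∂P, truncate (b / Real.sqrt n) (ξ ω / ((Real.sqrt (n : ℝ) : ℝ) : ℂ))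
      = ξ ω / ((Real.sqrt (n : ℝ) : ℝ) : ℂ) := by
  filter_upwards [h.bounded] with ω hω
  rw [truncate, if_pos]
  rw [norm_div, Complex.norm_real, Real.norm_of_nonneg (Real.sqrt_nonneg _)]
  gcongr

theorem isBoundedCentred (h : IsBoundedEnsemble P X ξ b) (hm : 0 < m) (hn : 0 < n) :
    IsBoundedCentred (P.map fun ω => ξ ω / ((Real.sqrt (n : ℝ) : ℝ) : ℂ))
      (truncate (b / Real.sqrt n)) (b / Real.sqrt n) ((n : ℝ)⁻¹) where
  measurable := measurable_truncate _
  bound := norm_truncate_le (div_nonneg h.bound_nonneg (Real.sqrt_nonneg _))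
  mean_zero := by
    rw [integral_map (h.aemeasurable_scaled hm hn)
      (measurable_truncate _).aestronglyMeasurable, integral_congr_ae h.truncate_scaled_ae,
      integral_div, h.mean_zero, zero_div]
  variance := by
    rw [integral_map (h.aemeasurable_scaled hm hn)
      ((measurable_truncate _).norm.pow_const 2).aestronglyMeasurable]
    have : ∀ᵐ ω ∂P, ‖truncate (b / Real.sqrt n) (ξ ω / ((Real.sqrt (n : ℝ) : ℝ) : ℂ))‖ ^ 2
        = (n : ℝ)⁻¹ * ‖ξ ω‖ ^ 2 := by
      filter_upwards [h.truncate_scaled_ae] with ω hω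
      rw [hω, norm_div, Complex.norm_real, Real.norm_of_nonneg (Real.sqrt_nonneg _), div_pow,
        Real.sq_sqrt (Nat.cast_nonneg n), div_eq_inv_mul]
    rw [integral_congr_ae this, integral_const_mul, h.variance_one, mul_one]

theorem aemeasurable_entryArray (h : IsBoundedEnsemble P X ξ b) :
    AEMeasurable (entryArray X) P :=
  aemeasurable_pi_lambda _ fun k => (h.identDistrib k.1 k.2.1 k.2.2).aemeasurable_fst

theorem map_entryArray (h : IsBoundedEnsemble P X ξ b) :
    P.map (entryArray X) = Measure.pi fun _ : Fin m × Fin n × Fin n =>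
      P.map fun ω => ξ ω / ((Real.sqrt (n : ℝ) : ℝ) : ℂ) := by
  have := h.indep.map_fun_eq_pi_map fun k : Fin m × Fin n × Fin n =>
    (h.identDistrib k.1 k.2.1 k.2.2).aemeasurable_fst
  refine this.trans ?_
  congr 1
  ext1 k
  exact (h.identDistrib k.1 k.2.1 k.2.2).map_eq

theorem truncate_entryArray_ae (h : IsBoundedEnsemble P X ξ b) :
    ∀ᵐ ω ∂P, truncate (b / Real.sqrt n) ∘ entryArray X ω = entryArray X ω := by
  have h1 : ∀ k : Fin m × Fin n × Fin n, ∀ᵐ ω ∂P,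
      truncate (b / Real.sqrt n) (entryArray X ω k) = entryArray X ω k := by
    intro k
    refine (h.identDistrib k.1 k.2.1 k.2.2).symm.ae_snd
      (p := fun u => truncate (b / Real.sqrt n) u = u) ?_ h.truncate_scaled_ae
    exact measurableSet_eq_fun (measurable_truncate _) measurable_id
  filter_upwards [ae_all_iff.mpr h1] with ω hω
  exact funext hω

end IsBoundedEnsemble

end Ensemble

section Asymptotics

theorem summable_tail : Summable fun n : ℕ =>
    (2 * (n : ℝ) ^ 6 + 1) ^ 4 * (4 * Real.exp (-((n : ℝ) ^ (7 / 16 : ℝ)) / 72)) := by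
  have h1 := (isLittleO_exp_neg_mul_rpow_atTop (a := 1 / 72) (by norm_num) (-64)).bound one_pos
  have h2 : Tendsto (fun n : ℕ => (n : ℝ) ^ (7 / 16 : ℝ)) atTop atTop :=
    (tendsto_rpow_atTop (by norm_num)).comp tendsto_natCast_atTop_atTop
  have h3 := h2.eventually h1
  refine summable_of_isBigO_nat (g := fun n : ℕ => ((n : ℝ) ^ 2)⁻¹)
    (Real.summable_nat_pow_inv.mpr (by norm_num)) ?_
  refine Asymptotics.IsBigO.of_bound 324 ?_
  filter_upwards [h3, eventually_ge_atTop 1] with n hn hn1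
  have hn' : (1 : ℝ) ≤ n := by exact_mod_cast hn1
  have hn0 : (0 : ℝ) < n := by linarith
  have e1 : ((n : ℝ) ^ (7 / 16 : ℝ)) ^ (-64 : ℝ) = ((n : ℝ) ^ 28)⁻¹ := by
    rw [← Real.rpow_mul hn0.le, show (7 / 16 : ℝ) * (-64) = -((28 : ℕ) : ℝ) by norm_num,
      Real.rpow_neg hn0.le, Real.rpow_natCast]
  rw [e1, one_mul, Real.norm_of_nonneg (Real.exp_pos _).le,
    Real.norm_of_nonneg (by positivity)] at hn
  rw [Real.norm_of_nonneg (by positivity), Real.norm_of_nonneg (by positivity)]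
  have e2 : -((n : ℝ) ^ (7 / 16 : ℝ)) / 72 = -(1 / 72) * (n : ℝ) ^ (7 / 16 : ℝ) := by ring
  rw [e2]
  have h4 : 2 * (n : ℝ) ^ 6 + 1 ≤ 3 * (n : ℝ) ^ 6 := by
    have : (1 : ℝ) ≤ (n : ℝ) ^ 6 := one_le_pow₀ hn'
    linarith
  have h5 : (1 : ℝ) ≤ (n : ℝ) ^ 2 := one_le_pow₀ hn'
  calc _ ≤ (3 * (n : ℝ) ^ 6) ^ 4 * (4 * ((n : ℝ) ^ 28)⁻¹) := by gcongr
    _ = 324 * (((n : ℝ) ^ 2)⁻¹ * ((n : ℝ) ^ 2)⁻¹) := by field_simp; norm_num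
    _ ≤ 324 * ((n : ℝ) ^ 2)⁻¹ := by
        gcongr
        exact mul_le_of_le_one_right (by positivity) (inv_le_one_of_one_le₀ h5)

variable {η δ : ℝ} {n : ℕ}

theorem cutoff_pos (hn : 0 < n) : 0 < cutoff η δ n :=
  Real.rpow_pos_of_pos (by exact_mod_cast hn) _

theorem cutoff_le_one (hn : 0 < n) (h : 0 ≤ η * δ) : cutoff η δ n ≤ 1 :=
  Real.rpow_le_one_of_one_le_of_nonpos (by exact_mod_cast hn) (by linarith)

theorem rpow_le_cutoff_sq (hn : 0 < n) (h : δ * η ≤ 1 / 32) :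
    (n : ℝ) ^ (-(1 / 16) : ℝ) ≤ cutoff η δ n ^ 2 := by
  have hn0 : (0 : ℝ) < n := by exact_mod_cast hn
  rw [cutoff, ← Real.rpow_natCast, ← Real.rpow_mul hn0.le]
  refine Real.rpow_le_rpow_of_exponent_le (by exact_mod_cast hn) ?_
  push_cast
  linarith

theorem rpow_neg_quarter_sq (hn : 0 < n) :
    ((n : ℝ) ^ (-(1 / 4) : ℝ)) ^ 2 * n = (n : ℝ) ^ (1 / 2 : ℝ) := by
  have hn0 : (0 : ℝ) < n := by exact_mod_cast hn
  rw [← Real.rpow_natCast, ← Real.rpow_mul hn0.le]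
  nth_rewrite 2 [← Real.rpow_one (n : ℝ)]
  rw [← Real.rpow_add hn0]
  norm_num

theorem one_div_cutoff_sq_le (hn : 0 < n) (h : δ * η ≤ 1 / 32) : 1 / cutoff η δ n ^ 2 ≤ n := by
  have hn0 : (0 : ℝ) < n := by exact_mod_cast hn
  have h1 := rpow_le_cutoff_sq (η := η) hn h
  have h2 : (0 : ℝ) < (n : ℝ) ^ (-(1 / 16) : ℝ) := Real.rpow_pos_of_pos hn0 _
  refine (one_div_le_one_div_of_le h2 h1).trans ?_
  rw [one_div, ← Real.rpow_neg hn0.le]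
  conv_rhs => rw [← Real.rpow_one (n : ℝ)]
  exact Real.rpow_le_rpow_of_exponent_le (by exact_mod_cast hn) (by norm_num)

theorem exp_tail_le (hn : 0 < n) (h : δ * η ≤ 1 / 32) :
    Real.exp (-(((n : ℝ) ^ (-(1 / 4) : ℝ)) ^ 2 * n * cutoff η δ n ^ 2) / 72)
      ≤ Real.exp (-((n : ℝ) ^ (7 / 16 : ℝ)) / 72) := by
  have hn0 : (0 : ℝ) < n := by exact_mod_cast hn
  have h1 := rpow_le_cutoff_sq (η := η) hn h
  have h2 : (n : ℝ) ^ (7 / 16 : ℝ) ≤ (n : ℝ) ^ (1 / 2 : ℝ) * cutoff η δ n ^ 2 := by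
    calc (n : ℝ) ^ (7 / 16 : ℝ) = (n : ℝ) ^ (1 / 2 : ℝ) * (n : ℝ) ^ (-(1 / 16) : ℝ) := by
          rw [← Real.rpow_add hn0]; norm_num
      _ ≤ _ := by gcongr
  rw [rpow_neg_quarter_sq hn]
  gcongr

theorem one_div_le_rpow_neg_quarter (hn : 0 < n) : 1 / (n : ℝ) ≤ (n : ℝ) ^ (-(1 / 4) : ℝ) := by
  have hn0 : (0 : ℝ) < n := by exact_mod_cast hn
  rw [one_div, ← Real.rpow_neg_one]
  exact Real.rpow_le_rpow_of_exponent_le (by exact_mod_cast hn) (by norm_num)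

theorem one_div_sqrt_le_rpow_neg_quarter (hn : 0 < n) :
    1 / Real.sqrt n ≤ (n : ℝ) ^ (-(1 / 4) : ℝ) := by
  have hn0 : (0 : ℝ) < n := by exact_mod_cast hn
  rw [Real.sqrt_eq_rpow, one_div, ← Real.rpow_neg hn0.le]
  exact Real.rpow_le_rpow_of_exponent_le (by exact_mod_cast hn) (by norm_num)

theorem mul_rpow_div_sqrt_le {K : ℝ} (hn : 0 < n) (hδ : δ ≤ 1 / 32) :
    K * (n : ℝ) ^ δ / Real.sqrt n ≤ |K| := by
  have hn0 : (0 : ℝ) < n := by exact_mod_cast hn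
  rw [div_le_iff₀ (by positivity)]
  have : (n : ℝ) ^ δ ≤ Real.sqrt n := by
    rw [Real.sqrt_eq_rpow]
    exact Real.rpow_le_rpow_of_exponent_le (by exact_mod_cast hn) (by linarith)
  exact mul_le_mul (le_abs_self K) this (by positivity) (abs_nonneg K)

theorem eventually_div_le_rpow_neg_quarter (A : ℝ) :
    ∀ᶠ n : ℕ in atTop, A / (n : ℝ) ≤ (n : ℝ) ^ (-(1 / 4) : ℝ) := by
  have h : Tendsto (fun n : ℕ => (n : ℝ) ^ (3 / 4 : ℝ)) atTop atTop :=
    (tendsto_rpow_atTop (by norm_num)).comp tendsto_natCast_atTop_atTop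
  filter_upwards [h.eventually_ge_atTop A, eventually_ge_atTop 1] with n hA hn
  have hn0 : (0 : ℝ) < n := by exact_mod_cast hn
  rw [div_le_iff₀ hn0]
  refine hA.trans_eq ?_
  nth_rewrite 3 [← Real.rpow_one (n : ℝ)]
  rw [← Real.rpow_add hn0]
  norm_num

end Asymptotics

section Main

/-- The final constant. -/
noncomputable def defectConstant (m : ℕ) (M N K : ℝ) : ℝ :=
  meanConstant m M N K + 3 * (9 + M ^ 2)

variable {m n : ℕ} {φ : ℂ → ℂ} {μ : Measure ℂ} [IsProbabilityMeasure μ] {M N K η δ : ℝ}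

/-- Off the deviation event, the cubic equation holds up to the error rate. -/
theorem norm_cubicDefect_le_of_notMem (hm : 1 < m) (hn : 0 < n) (hη : 0 < η) (hδ : 0 < δ)
    (h : IsBoundedCentred μ φ (K * (n : ℝ) ^ δ / Real.sqrt n) ((n : ℝ)⁻¹))
    {x : Fin m × Fin n × Fin n → ℂ}
    (hx : x ∉ deviationSet m n μ φ M N (cutoff η δ n) ((n : ℝ) ^ (-(1 / 4) : ℝ)))
    {α z : ℂ} (hz : ‖z‖ ≤ M) (hre : |α.re| ≤ N) (him : cutoff η δ n ≤ α.im) :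
    ‖cubicDefect α z (cyclicTransform (φ ∘ x) α z)‖
      ≤ defectConstant m M N K * errorRate η δ n := by
  have hn1 : (1 : ℝ) ≤ n := by exact_mod_cast hn
  have hy := cutoff_pos (η := η) (δ := δ) hn
  have hy1 := cutoff_le_one (η := η) (δ := δ) hn (by positivity)
  have hα : 0 < α.im := hy.trans_le him
  set T := (cutoff η δ n)⁻¹ with hTdef
  have hT : 1 ≤ T := (one_le_inv₀ hy).mpr hy1
  have hτ : 1 / α.im ≤ T := by
    rw [one_div]
    exact inv_anti₀ hy him
  set D := (n : ℝ) ^ δ with hDdef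
  have hD : 1 ≤ D := Real.one_le_rpow hn1 hδ.le
  set ε := (n : ℝ) ^ (-(1 / 4) : ℝ) with hεdef
  have hε : 0 ≤ ε := by positivity
  have hu : 1 / Real.sqrt n ≤ ε := one_div_sqrt_le_rpow_neg_quarter hn
  have hrate : errorRate η δ n = ε * T ^ 5 * D := by
    rw [errorRate, hTdef, inv_pow, _root_.zpow_neg]
    rfl
  have b1 := norm_cubicDefect_meanTransform_le_rate (z := z) hD hT h hm hn hα hτ hz hre
  have hdev : ‖cyclicTransform (φ ∘ x) α z - meanTransform m n μ φ α z‖ ≤ 3 * ε := by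
    by_contra! hcon
    exact hx ⟨α, z, hz, hre, him, hcon⟩
  have b2 := cubicDefect_sub_le hα hT hτ
    ((norm_cyclicTransform_le (by omega) hn (φ ∘ x) z hα).trans hτ)
    ((norm_meanTransform_le (m := m) (μ := μ) (z := z) (by omega) h.measurable hn hα).trans hτ) hz
  have hT0 : 0 ≤ T := by linarith
  have hTD : T ^ 2 ≤ T ^ 5 * D :=
    (pow_le_pow_right₀ hT (by norm_num)).trans (le_mul_of_one_le_right (by positivity) hD)
  have c1 : meanConstant m M N K * (T ^ 5 * D / Real.sqrt n)
      ≤ meanConstant m M N K * (ε * T ^ 5 * D) := by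
    refine mul_le_mul_of_nonneg_left ?_ (meanConstant_nonneg m M N K)
    calc T ^ 5 * D / Real.sqrt n = T ^ 5 * D * (1 / Real.sqrt n) := by ring
      _ ≤ T ^ 5 * D * ε := by gcongr
      _ = _ := by ring
  have c2 : ‖cyclicTransform (φ ∘ x) α z - meanTransform m n μ φ α z‖ * ((9 + M ^ 2) * T ^ 2)
      ≤ 3 * (9 + M ^ 2) * (ε * T ^ 5 * D) := by
    calc _ ≤ 3 * ε * ((9 + M ^ 2) * (T ^ 5 * D)) := by gcongr
      _ = _ := by ring
  have t := norm_sub_norm_le (cubicDefect α z (cyclicTransform (φ ∘ x) α z))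
    (cubicDefect α z (meanTransform m n μ φ α z))
  rw [hrate, defectConstant, add_mul]
  linarith

end Main

theorem mainTheorem3 (m : ℕ) (hm : 1 < m) (M N K : ℝ) :
    ∃ C : ℝ, ∀ η δ : ℝ, 0 < η → 0 < δ → δ * η ≤ 1 / 32 → δ ≤ 1 / 32 →
      ∀ (Ω : Type*) [MeasurableSpace Ω] (P : Measure Ω) [IsProbabilityMeasure P]
        (X : (n : ℕ) → Fin m → Ω → Matrix (Fin n) (Fin n) ℂ) (ξ : ℕ → Ω → ℂ),
        (∀ᶠ n : ℕ in atTop, IsBoundedEnsemble P (X n) (ξ n) (K * (n : ℝ) ^ δ)) →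
        ∀ᵐ ω ∂P, ∀ᶠ n : ℕ in atTop, ∀ α z : ℂ,
          ‖z‖ ≤ M → |α.re| ≤ N → cutoff η δ n ≤ α.im →
          let Δ : ℂ := shiftedStieltjes (blockCyclic fun k => X n k ω) α z
          ‖Δ ^ 3 + 2 * Δ ^ 2 + (α + 1 - (‖z‖ : ℂ) ^ 2) / α * Δ + 1 / α‖
            ≤ C * errorRate η δ n := by
  refine ⟨defectConstant m M N K, ?_⟩
  intro η δ hη hδ hδη hδ' Ω _ P _ X ξ hens
  have hm0 : 0 < m := by omega
  have hev : ∀ᶠ n : ℕ in atTop, IsBoundedEnsemble P (X n) (ξ n) (K * (n : ℝ) ^ δ) ∧ 2 ≤ n ∧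
      |N| + 1 ≤ (n : ℝ) ∧ |M| + 1 ≤ (n : ℝ) ∧
      (m : ℝ) ^ 2 * (8 * (|K| + |M| + 2) + 4) / (n : ℝ) ≤ (n : ℝ) ^ (-(1 / 4) : ℝ) :=
    hens.and ((eventually_ge_atTop 2).and
      ((tendsto_natCast_atTop_atTop.eventually_ge_atTop _).and
        ((tendsto_natCast_atTop_atTop.eventually_ge_atTop _).and
          (eventually_div_le_rpow_neg_quarter _))))
  obtain ⟨n₀, hn₀⟩ := eventually_atTop.mp hev
  set μ : ℕ → Measure ℂ := fun n => P.map fun ω => ξ n ω / ((Real.sqrt (n : ℝ) : ℝ) : ℂ) with hμ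
  set φ : ℕ → ℂ → ℂ := fun n => truncate (K * (n : ℝ) ^ δ / Real.sqrt n) with hφ
  set bad : (n : ℕ) → Set (Fin m × Fin n × Fin n → ℂ) := fun n =>
    deviationSet m n (μ n) (φ n) M N (cutoff η δ n) ((n : ℝ) ^ (-(1 / 4) : ℝ)) with hbad
  set badΩ : ℕ → Set Ω := fun n => if n₀ ≤ n then entryArray (X n) ⁻¹' bad n else ∅ with hbadΩ
  have hprob : ∀ n, n₀ ≤ n → IsProbabilityMeasure (μ n) := fun n hn =>
    Measure.isProbabilityMeasure_map ((hn₀ n hn).1.aemeasurable_scaled hm0 (by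
      have := (hn₀ n hn).2.1
      omega))
  have hmeas : ∀ n, P (badΩ n) ≤ ENNReal.ofReal ((2 * (n : ℝ) ^ 6 + 1) ^ 4 *
      (4 * Real.exp (-((n : ℝ) ^ (7 / 16 : ℝ)) / 72))) := by
    intro n
    by_cases hn : n₀ ≤ n
    · obtain ⟨h1, h2, h3, h4, h5⟩ := hn₀ n hn
      have := hprob n hn
      have hn0 : 0 < n := by omega
      have hc := h1.isBoundedCentred hm0 hn0
      simp only [hbadΩ, if_pos hn]
      refine (Measure.le_map_apply h1.aemeasurable_entryArray _).trans ?_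
      rw [h1.map_entryArray]
      refine (measure_deviationSet_le (μ := μ n) hm0 hc.measurable hc.bound hc.bound_nonneg h2 h3 h4
        (cutoff_pos hn0) (one_div_cutoff_sq_le hn0 hδη) (one_div_le_rpow_neg_quarter hn0)
        (le_trans ?_ h5)).trans ?_
      · have := mul_rpow_div_sqrt_le (K := K) hn0 hδ'
        gcongr
      · refine ENNReal.ofReal_le_ofReal ?_
        have := exp_tail_le (η := η) hn0 hδη
        gcongr
    · simp [hbadΩ, hn]
  have hsum : ∑' n, P (badΩ n) ≠ ∞ := by
    refine ne_top_of_le_ne_top ?_ (ENNReal.tsum_le_tsum hmeas)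
    rw [← ENNReal.ofReal_tsum_of_nonneg (fun n => by positivity) summable_tail]
    exact ENNReal.ofReal_ne_top
  have htr : ∀ᵐ ω ∂P, ∀ n, n₀ ≤ n → φ n ∘ entryArray (X n) ω = entryArray (X n) ω := by
    rw [ae_all_iff]
    intro n
    by_cases hn : n₀ ≤ n
    · filter_upwards [(hn₀ n hn).1.truncate_entryArray_ae] with ω hω _
      exact hω
    · exact Eventually.of_forall fun ω h => absurd h hn
  filter_upwards [ae_eventually_notMem hsum, htr] with ω hω htrω
  filter_upwards [hω, eventually_ge_atTop n₀] with n hωn hn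
  intro α z hz hre him
  obtain ⟨h1, h2, -⟩ := hn₀ n hn
  have := hprob n hn
  have hn0 : 0 < n := by omega
  have hx : entryArray (X n) ω ∉ bad n := by
    simp only [hbadΩ, if_pos hn] at hωn
    exact hωn
  have key := norm_cubicDefect_le_of_notMem (μ := μ n) (K := K) hm hn0 hη hδ
    (h1.isBoundedCentred hm0 hn0) hx hz hre him
  rw [htrω n hn] at key
  have hα : 0 < α.im := (cutoff_pos hn0).trans_le him
  rw [shiftedStieltjes_blockCyclic _ _ hα]
  exact key
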